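/- Fix $\nu\in\mathbb{C}$. Let $\mathbb{C}^\infty$ have basis $e_1,e_2,\dots$, let $\mathfrak{gl}_\infty$ be the Lie algebra of infinite complex matrices $(a_{ij})_{i,j\ge 1}$ with finitely many non-zero entries, and let $\mathfrak{gl}_n\subset\mathfrak{gl}_\infty$ ($n\ge 1$) be the subalgebra of matrices with $a_{ij}=0$ whenever $i>n$ or $j>n$. For $n<N\le\infty$ let $\mathfrak{gl}_n^\perp\subset\mathfrak{gl}_N$ be the subalgebra of matrices with $a_{ij}=0$ whenever $i\le n$ or $j\le n$; it commutes with $\mathfrak{gl}_n$, so for a $\mathfrak{gl}_N$-module $M$ the invariants $M^{\mathfrak{gl}_n^\perp}$ form a $\mathfrak{gl}_n$-module. For $N\in\mathbb{Z}_{\ge 1}\cup\{\infty\}$ put $U_N=\mathrm{span}(e_i : 1<i\le N)$ (all $i>1$ if $N=\infty$), $\mathfrak{gl}(U_N)=\mathfrak{gl}_1^\perp\subset\mathfrak{gl}_N$, $\mathfrak{u}_N^+=\mathrm{span}\{E_{1,j}: j>1\}$, $\mathfrak{u}_N^-=\mathrm{span}\{E_{i,1}: i>1\}$, so that $\mathcal{U}(\mathfrak{u}_N^-)=\mathrm{Sym}(U_N)$.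 A $\mathfrak{gl}(U_N)$-module is polynomial if it is a direct summand of a finite direct sum of tensor powers $U_N^{\otimes d}$, $d\ge 0$. The category $O^{\mathfrak{p}_N}_{\nu,\mathbb{C}^N}$ is the full subcategory of the category of $\mathfrak{gl}_N$-modules on the modules $M$ such that: 1. the restriction of $M$ to $\mathfrak{gl}(U_N)$ is a (possibly infinite) direct sum of polynomial modules; 2. $M$ is of degree $\nu$: $E_{1,1}$ acts by $\nu-|\lambda|$ on every $\mathfrak{gl}(U_N)$-submodule of $M$ isomorphic to a Schur functor $S^\lambda U_N$; equivalently, $E_{1,1}$ acts by $\nu-d$ on the image of every $\mathfrak{gl}(U_N)$-equivariant map $U_N^{\otimes d}\to M$, $d\ge 0$; 3. $M$ is finitely generated over $\mathrm{Sym}(U_N)$: there are a polynomial $\mathfrak{gl}(U_N)$-module $Q$ and a $\mathrm{Sym}(U_N)$-linear, $\mathfrak{gl}(U_N)$-equivariant surjection $\mathrm{Sym}(U_N)\otimes Q\to M$; 4. $M$ is locally nilpotent over $\mathcal{U}(\mathfrak{u}_N^+)$: for every $v\in M$ there is $m\ge 0$ such that every product of $m$ elements of $\mathfrak{u}_N^+$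 kills $v$. Then the following hold. (a) For $n\ge 2$, $M\mapsto M^{\mathfrak{gl}_{n-1}^\perp}$ defines a functor $\mathfrak{Res}_{n-1,n}:O^{\mathfrak{p}_n}_{\nu,\mathbb{C}^n}\to O^{\mathfrak{p}_{n-1}}_{\nu,\mathbb{C}^{n-1}}$; for $n\ge 1$, $M\mapsto M^{\mathfrak{gl}_n^\perp}$ defines a functor $\Gamma_n:O^{\mathfrak{p}_\infty}_{\nu,\mathbb{C}^\infty}\to O^{\mathfrak{p}_n}_{\nu,\mathbb{C}^n}$; and for $n\ge 2$ and $M$ in $O^{\mathfrak{p}_\infty}_{\nu,\mathbb{C}^\infty}$ the inclusion $\Gamma_{n-1}(M)\to\mathfrak{Res}_{n-1,n}(\Gamma_n(M))$ is an isomorphism. (b) Let $\varprojlim_{n\ge 1} O^{\mathfrak{p}_n}_{\nu,\mathbb{C}^n}$ be the category whose objects are the sequences $((M_n)_{n\ge 1},(\phi_{n-1,n})_{n\ge 2})$ with $M_n\in O^{\mathfrak{p}_n}_{\nu,\mathbb{C}^n}$ and isomorphisms $\phi_{n-1,n}:\mathfrak{Res}_{n-1,n}(M_n)\to M_{n-1}$,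 and whose morphisms are the sequences of morphisms $M_n\to M_n'$ compatible with the isomorphisms. Let the restricted inverse limit $\varprojlim_{n\ge 1,\,\mathrm{restr}} O^{\mathfrak{p}_n}_{\nu,\mathbb{C}^n}$ be its full subcategory on the objects for which the sequence of lengths of the $\mathfrak{gl}_n$-modules $M_n$ is eventually constant and finite. Then the functor $\Gamma_{\lim}$ that sends $M$ to $(\Gamma_n(M))_{n\ge 1}$, with the inverses of the isomorphisms in (a), takes its values in the restricted inverse limit, and $$\Gamma_{\lim}:O^{\mathfrak{p}_\infty}_{\nu,\mathbb{C}^\infty}\longrightarrow \varprojlim_{n\ge 1,\,\mathrm{restr}} O^{\mathfrak{p}_n}_{\nu,\mathbb{C}^n}$$ is an equivalence of categories. -/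

import Mathlib

open CategoryTheory
open scoped TensorProduct DirectSum

namespace ParabolicO

attribute [local instance 100] LieRing.ofAssociativeRing

/-! ### The Lie algebras `gl_n`, `gl_∞` and their subalgebras

Indices start at `0`: the basis vector `e_{i+1}` of `ℂ^∞` is `Finsupp.single i 1`, and the
distinguished vector `e_1` is `Finsupp.single 0 1`. -/

/-- The space `ℂ^∞` with its countable basis. -/
abbrev CInf : Type := ℕ →₀ ℂ

/-- The elementary matrix with a single entry `1`, in row `i` and column `j`:
it sends the basis vector number `j` to the basis vector number `i` and kills the others. -/
noncomputable def E (i j : ℕ) : Module.End ℂ CInf :=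
  (Finsupp.lsingle i).comp (Finsupp.lapply j)

theorem E_mul (i j k l : ℕ) : E i j * E k l = if j = k then E i l else 0 := by
  split_ifs with h
  · subst h
    refine LinearMap.ext fun v => ?_
    simp [E]
  · refine LinearMap.ext fun v => ?_
    simp [E, Ne.symm h]

/-- The Lie algebra `gl(S)` of matrices with finitely many non-zero entries, all of them in rows and
columns from `S`. Thus `gl Set.univ` is `gl_∞`, `gl {0, …, n - 1}` is `gl_n`,
and `gl {1, …, n - 1}` is `gl(U_n)`. -/
noncomputable def gl (S : Set ℕ) : LieSubalgebra ℂ (Module.End ℂ CInf) where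
  toSubmodule := Submodule.span ℂ {A | ∃ i ∈ S, ∃ j ∈ S, A = E i j}
  lie_mem' := by
    intro x y hx hy
    change x ∈ Submodule.span ℂ _ at hx
    change y ∈ Submodule.span ℂ _ at hy
    change ⁅x, y⁆ ∈ Submodule.span ℂ _
    induction hx, hy using Submodule.span_induction₂ with
    | mem_mem x y hx hy =>
      obtain ⟨i, hi, j, hj, rfl⟩ := hx
      obtain ⟨k, hk, l, hl, rfl⟩ := hy
      change E i j * E k l - E k l * E i j ∈ Submodule.span ℂ _
      rw [E_mul, E_mul]
      refine Submodule.sub_mem _ ?_ ?_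
      · split_ifs
        · exact Submodule.subset_span ⟨i, hi, l, hl, rfl⟩
        · exact Submodule.zero_mem _
      · split_ifs
        · exact Submodule.subset_span ⟨k, hk, j, hj, rfl⟩
        · exact Submodule.zero_mem _
    | zero_left y hy => simp
    | zero_right x hx => simp
    | add_left x y z _ _ _ h1 h2 => rw [add_lie]; exact Submodule.add_mem _ h1 h2
    | add_right x y z _ _ _ h1 h2 => rw [lie_add]; exact Submodule.add_mem _ h1 h2
    | smul_left r x y _ _ h => rw [smul_lie]; exact Submodule.smul_mem _ r h
    | smul_right r x y _ _ h => rw [lie_smul]; exact Submodule.smul_mem _ r h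

theorem gl_mono {T S : Set ℕ} (h : T ⊆ S) : gl T ≤ gl S := by
  intro x hx
  refine Submodule.span_mono ?_ hx
  rintro _ ⟨i, hi, j, hj, rfl⟩
  exact ⟨i, h hi, j, h hj, rfl⟩

/-- `gl(T)` and `gl(T')` commute when `T` and `T'` are disjoint. -/
theorem gl_commute {T T' : Set ℕ} (h : Disjoint T T') {x y : Module.End ℂ CInf}
    (hx : x ∈ gl T) (hy : y ∈ gl T') : ⁅x, y⁆ = 0 := by
  change x ∈ Submodule.span ℂ _ at hx
  change y ∈ Submodule.span ℂ _ at hy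
  induction hx, hy using Submodule.span_induction₂ with
  | mem_mem x y hx hy =>
    obtain ⟨i, hi, j, hj, rfl⟩ := hx
    obtain ⟨k, hk, l, hl, rfl⟩ := hy
    change E i j * E k l - E k l * E i j = 0
    rw [E_mul, E_mul, if_neg (h.ne_of_mem hj hk), if_neg (h.ne_of_mem hi hl).symm]
    exact sub_self (0 : Module.End ℂ CInf)
  | zero_left y hy => simp
  | zero_right x hx => simp
  | add_left x y z _ _ _ h1 h2 => rw [add_lie, h1, h2, add_zero]
  | add_right x y z _ _ _ h1 h2 => rw [lie_add, h1, h2, add_zero]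
  | smul_left r x y _ _ h => rw [smul_lie, h, smul_zero]
  | smul_right r x y _ _ h => rw [lie_smul, h, smul_zero]

/-- The first `n` indices: `gl (upTo n)` is `gl_n`. -/
def upTo (n : ℕ) : Set ℕ := {i | i < n}

theorem upTo_mono {m n : ℕ} (h : m ≤ n) : upTo m ⊆ upTo n := fun _ hi => lt_of_lt_of_le hi h

/-- The indices of the basis of `U`, the span of all basis vectors except the distinguished one. -/
def idxU (S : Set ℕ) : Set ℕ := S \ {0}

theorem idxU_subset (S : Set ℕ) : idxU S ⊆ S := Set.sdiff_subset

/-- `u⁺`: the span of the matrix units in row `0` and a column `j ≠ 0`, in `gl(S)`. -/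
noncomputable def uPlus (S : Set ℕ) : Submodule ℂ (gl S) :=
  Submodule.span ℂ {A | ∃ j ∈ idxU S, (A : Module.End ℂ CInf) = E 0 j}

/-- `u⁻`: the span of the matrix units in column `0` and a row `i ≠ 0`, in `gl(S)`. -/
noncomputable def uMinus (S : Set ℕ) : Submodule ℂ (gl S) :=
  Submodule.span ℂ {A | ∃ i ∈ idxU S, (A : Module.End ℂ CInf) = E i 0}

/-! ### The category of modules over a complex Lie algebra -/

/-- Modules over a complex Lie algebra `L`. -/
structure LieMod (L : Type) [LieRing L] [LieAlgebra ℂ L] where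
  carrier : Type
  [addCommGroup : AddCommGroup carrier]
  [module : Module ℂ carrier]
  [lieRingModule : LieRingModule L carrier]
  [lieModule : LieModule ℂ L carrier]

namespace LieMod

variable {L : Type} [LieRing L] [LieAlgebra ℂ L]

instance : CoeSort (LieMod L) Type := ⟨LieMod.carrier⟩

attribute [instance] LieMod.addCommGroup LieMod.module LieMod.lieRingModule LieMod.lieModule

/-- Morphisms are the `L`-equivariant linear maps. -/
instance category : Category (LieMod L) where
  Hom M N := M →ₗ⁅ℂ,L⁆ N
  id _ := LieModuleHom.id
  comp f g := LieModuleHom.comp g f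

/-- A module given with its structures, as an object. -/
abbrev of (L : Type) [LieRing L] [LieAlgebra ℂ L] (M : Type) [AddCommGroup M] [Module ℂ M]
    [LieRingModule L M] [LieModule ℂ L M] : LieMod L := ⟨M⟩

/-- Restriction of the action along a homomorphism of Lie algebras. -/
abbrev restrict {L' : Type} [LieRing L'] [LieAlgebra ℂ L'] (f : L' →ₗ⁅ℂ⁆ L) (M : LieMod L) :
    LieMod L' :=
  letI : LieRingModule L' M := LieRingModule.compLieHom M f
  letI : LieModule ℂ L' M := LieModule.compLieHom M f
  LieMod.of L' M

/-- The identity map, from the restriction of `M` to `M`. -/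
def restrictEquiv {L' : Type} [LieRing L'] [LieAlgebra ℂ L'] (f : L' →ₗ⁅ℂ⁆ L) (M : LieMod L) :
    M.restrict f ≃ₗ[ℂ] M := LinearEquiv.refl ℂ M

/-- The trivial one-dimensional module. -/
noncomputable abbrev trivial (L : Type) [LieRing L] [LieAlgebra ℂ L] : LieMod L :=
  letI : LieRingModule L ℂ :=
    { bracket := fun _ _ => 0
      add_lie := by intros; exact (add_zero _).symm
      lie_add := by intros; exact (add_zero _).symm
      leibniz_lie := by intros; exact (add_zero _).symm }
  letI : LieModule ℂ L ℂ :=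
    { smul_lie := by intros; exact (smul_zero _).symm
      lie_smul := by intros; exact (smul_zero _).symm }
  LieMod.of L ℂ

/-- The tensor power `X ⊗ ⋯ ⊗ X` (`d` factors), where `L` acts by the Leibniz rule. -/
noncomputable def tensorPow (X : LieMod L) : ℕ → LieMod L
  | 0 => trivial L
  | d + 1 => LieMod.of L (X ⊗[ℂ] (tensorPow X d))

/-- The length of a module: the supremum of the lengths of chains of submodules. -/
noncomputable def length (M : LieMod L) : ℕ∞ := Order.height (⊤ : LieSubmodule ℂ L M)

end LieMod

/-- Restriction from `gl(S)` to `gl(T)`, for `T ⊆ S`. -/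
noncomputable abbrev resGl {T S : Set ℕ} (h : T ⊆ S) (M : LieMod (gl S)) : LieMod (gl T) :=
  M.restrict (LieSubalgebra.inclusion (gl_mono h))

/-- The identity map, from the restriction of `M` to `M`. -/
noncomputable abbrev resGlEquiv {T S : Set ℕ} (h : T ⊆ S) (M : LieMod (gl S)) :
    resGl h M ≃ₗ[ℂ] M :=
  M.restrictEquiv (LieSubalgebra.inclusion (gl_mono h))

/-! ### Polynomial modules -/

/-- The span of the basis vectors with index in `S`, as a `gl(S)`-submodule of `ℂ^∞`. -/
noncomputable def tautSub (S : Set ℕ) : LieSubmodule ℂ (gl S) CInf where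
  toSubmodule := Finsupp.supported ℂ ℂ S
  lie_mem := by
    rintro ⟨x, hx⟩ v -
    change x v ∈ Finsupp.supported ℂ ℂ S
    change x ∈ Submodule.span ℂ _ at hx
    induction hx using Submodule.span_induction with
    | mem x hx =>
      obtain ⟨i, hi, j, hj, rfl⟩ := hx
      exact Finsupp.single_mem_supported ℂ _ hi
    | zero => simp
    | add x y _ _ h1 h2 => rw [LinearMap.add_apply]; exact Submodule.add_mem _ h1 h2
    | smul r x _ h => rw [LinearMap.smul_apply]; exact Submodule.smul_mem _ r h

/-- The tautological `gl(S)`-module: `ℂ^n`, `ℂ^∞`, `U_n` or `U_∞`, according to `S`. -/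
noncomputable abbrev taut (S : Set ℕ) : LieMod (gl S) := LieMod.of (gl S) (tautSub S)

/-- Polynomial `gl(S)`-modules: the direct summands of finite direct sums of tensor powers of the
tautological module. -/
def IsPoly {S : Set ℕ} (M : LieMod (gl S)) : Prop :=
  ∃ (k : ℕ) (d : Fin k → ℕ)
    (a : M →ₗ⁅ℂ,gl S⁆ ⨁ i, ((taut S).tensorPow (d i)))
    (b : (⨁ i, ((taut S).tensorPow (d i))) →ₗ⁅ℂ,gl S⁆ M),
    ∀ x, b (a x) = x

/-- Ind-polynomial `gl(S)`-modules: the internal direct sums of (possibly infinitely many)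
polynomial submodules. -/
def IsIndPoly {S : Set ℕ} (M : LieMod (gl S)) : Prop :=
  ∃ (ι : Type) (W : ι → LieSubmodule ℂ (gl S) M),
    iSupIndep W ∧ ⨆ i, W i = ⊤ ∧ ∀ i, IsPoly (LieMod.of (gl S) (W i))

/-! ### The parabolic category O

In this section `S` contains `0`: it is `{0, …, n - 1}` with `n ≥ 1`, or all of `ℕ`. -/

/-- `M` is of degree `ν`: the matrix unit `E_{1,1}` acts by `ν - d` on every polynomial
`gl(U)`-submodule of degree `d`. The `gl(U)`-submodules `S^λ U` of `M` with `|λ| = d` are the simple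
constituents of the images of equivariant maps from the `d`-th tensor power of `U` to `M`. -/
def IsOfDegree (ν : ℂ) {S : Set ℕ} (M : LieMod (gl S)) : Prop :=
  ∀ (d : ℕ) (φ : (taut (idxU S)).tensorPow d →ₗ⁅ℂ,gl (idxU S)⁆ resGl (idxU_subset S) M)
    (x : (taut (idxU S)).tensorPow d) (A : gl S), (A : Module.End ℂ CInf) = E 0 0 →
    ⁅A, resGlEquiv (idxU_subset S) M (φ x)⁆ = (ν - d) • resGlEquiv (idxU_subset S) M (φ x)

/-- `M` is finitely generated over `Sym(U)`, the enveloping algebra of `u⁻`: there is a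
`gl(U)`-equivariant and `Sym(U)`-linear surjection `Sym(U) ⊗ Q → M` with `Q` a polynomial
`gl(U)`-module. Such a surjection is the same as a `gl(U)`-equivariant map `Q → M` whose image
generates `M` as a module over `u⁻`. -/
def IsSymFG {S : Set ℕ} (M : LieMod (gl S)) : Prop :=
  ∃ Q : LieMod (gl (idxU S)), IsPoly Q ∧ ∃ φ : Q →ₗ⁅ℂ,gl (idxU S)⁆ resGl (idxU_subset S) M,
    ∀ W : Submodule ℂ M, (∀ q : Q, resGlEquiv (idxU_subset S) M (φ q) ∈ W) →
      (∀ A ∈ uMinus S, ∀ w ∈ W, ⁅A, w⁆ ∈ W) → W = ⊤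

/-- `M` is locally nilpotent over the enveloping algebra of `u⁺`: every vector is killed by all
products of `m` elements of `u⁺`, for some `m`. -/
def IsLocNilp {S : Set ℕ} (M : LieMod (gl S)) : Prop :=
  ∀ v : M, ∃ m : ℕ, ∀ l : List (gl S), l.length = m → (∀ A ∈ l, A ∈ uPlus S) →
    l.foldr (fun A w => ⁅A, w⁆) v = 0

/-- The parabolic category `O` of degree `ν` for `gl(S)` and the unital space spanned by the basis
vectors with index in `S`, as a property of `gl(S)`-modules. -/
def catO (ν : ℂ) (S : Set ℕ) : ObjectProperty (LieMod (gl S)) := fun M =>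
  IsIndPoly (resGl (idxU_subset S) M) ∧ IsOfDegree ν M ∧ IsSymFG M ∧ IsLocNilp M

/-! ### Invariants -/

section Invariants

variable {L L' L'' : Type} [LieRing L] [LieAlgebra ℂ L] [LieRing L'] [LieAlgebra ℂ L']
  [LieRing L''] [LieAlgebra ℂ L'']

/-- The subspace of the vectors of `M` killed by the elements of `K ⊆ L`. If `K` commutes with the
image of `f : L' → L`, it is an `L'`-submodule. -/
def invSub (f : L' →ₗ⁅ℂ⁆ L) (K : Set L) (hK : ∀ a ∈ K, ∀ x, ⁅a, f x⁆ = 0) (M : LieMod L) :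
    LieSubmodule ℂ L' (M.restrict f) where
  carrier := {v | ∀ a ∈ K, ⁅a, (show M from v)⁆ = 0}
  zero_mem' := fun a _ => lie_zero (M := M) a
  add_mem' := by
    intro v w hv hw a ha
    exact (lie_add (M := M) a v w).trans (by rw [hv a ha, hw a ha, add_zero])
  smul_mem' := by
    intro c v hv a ha
    exact (lie_smul (M := M) c a v).trans (by rw [hv a ha, smul_zero])
  lie_mem := by
    intro x v hv a ha
    change ⁅a, ⁅f x, (show M from v)⁆⁆ = 0
    rw [leibniz_lie, hK a ha, hv a ha, zero_lie, lie_zero, add_zero]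

/-- The functor of `K`-invariants, from `L`-modules to `L'`-modules. -/
def invariants (f : L' →ₗ⁅ℂ⁆ L) (K : Set L) (hK : ∀ a ∈ K, ∀ x, ⁅a, f x⁆ = 0) :
    LieMod L ⥤ LieMod L' where
  obj M := LieMod.of L' (invSub f K hK M)
  map {M N} φ :=
    let g : M →ₗ⁅ℂ,L⁆ N := φ
    ({ toFun := fun v => ⟨g v.1, fun a ha =>
          (g.map_lie a v.1).symm.trans ((congrArg g (v.2 a ha)).trans g.map_zero)⟩
       map_add' := fun v w => Subtype.ext (g.map_add v.1 w.1)
       map_smul' := fun c v => Subtype.ext (g.map_smul c v.1)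
       map_lie' := fun {x v} => Subtype.ext (g.map_lie (f x) v.1) } :
      invSub f K hK M →ₗ⁅ℂ,L'⁆ invSub f K hK N)
  map_id _ := rfl
  map_comp _ _ := rfl

/-- The inclusion of the `K₁`-invariants of `M` into the `K₃`-invariants of the `K₂`-invariants of
`M`, when `K₁` contains `K₂` and the image of `K₃`. -/
def invariantsComparison {f : L'' →ₗ⁅ℂ⁆ L} {g : L' →ₗ⁅ℂ⁆ L} {e : L'' →ₗ⁅ℂ⁆ L'}
    (hfg : ∀ x, f x = g (e x)) {K₁ K₂ : Set L} {K₃ : Set L'}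
    (hK₁ : ∀ a ∈ K₁, ∀ x, ⁅a, f x⁆ = 0) (hK₂ : ∀ a ∈ K₂, ∀ x, ⁅a, g x⁆ = 0)
    (hK₃ : ∀ a ∈ K₃, ∀ x, ⁅a, e x⁆ = 0) (h₂ : K₂ ⊆ K₁) (h₃ : ∀ a ∈ K₃, g a ∈ K₁) :
    invariants f K₁ hK₁ ⟶ invariants g K₂ hK₂ ⋙ invariants e K₃ hK₃ where
  app M :=
    ({ toFun := fun v => ⟨⟨v.1, fun a ha => v.2 a (h₂ ha)⟩,
          fun a ha => Subtype.ext (v.2 (g a) (h₃ a ha))⟩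
       map_add' := fun _ _ => rfl
       map_smul' := fun _ _ => rfl
       map_lie' := fun {x v} => Subtype.ext (Subtype.ext
        (congrArg (fun y : L => ⁅y, (show M from v.1)⁆) (hfg x))) } :
      invSub f K₁ hK₁ M →ₗ⁅ℂ,L''⁆
        invSub e K₃ hK₃ (LieMod.of L' (invSub g K₂ hK₂ M)))
  naturality _ _ _ := rfl

end Invariants

/-- The subset `gl(T)^⊥ = gl(S \ T)` of `gl(S)`. -/
def glPerp (T S : Set ℕ) : Set (gl S) := {A | (A : Module.End ℂ CInf) ∈ gl (S \ T)}

theorem glPerp_commute {T S : Set ℕ} (h : T ⊆ S) :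
    ∀ A ∈ glPerp T S, ∀ x : gl T, ⁅A, LieSubalgebra.inclusion (gl_mono h) x⁆ = 0 :=
  fun _ hA x => Subtype.ext (gl_commute Set.disjoint_sdiff_left hA x.2)

/-- The functor `M ↦ M^{gl(T)^⊥}` from `gl(S)`-modules to `gl(T)`-modules. -/
noncomputable def invFunctor {T S : Set ℕ} (h : T ⊆ S) : LieMod (gl S) ⥤ LieMod (gl T) :=
  invariants (LieSubalgebra.inclusion (gl_mono h)) (glPerp T S) (glPerp_commute h)

/-- The inclusion of `M^{gl(T)^⊥}` into the `gl(T)^⊥`-invariants of `M^{gl(S')^⊥}`,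
for `T ⊆ S' ⊆ S`. -/
noncomputable def invComparison {T S' S : Set ℕ} (h : T ⊆ S') (h' : S' ⊆ S) :
    invFunctor (h.trans h') ⟶ invFunctor h' ⋙ invFunctor h :=
  invariantsComparison (fun _ => rfl) (glPerp_commute (h.trans h')) (glPerp_commute h')
    (glPerp_commute h) (fun _ hA => gl_mono (Set.sdiff_subset_sdiff_right h) hA)
    (fun _ hA => gl_mono (Set.sdiff_subset_sdiff_left h') hA)

/-! ### Inverse limits of sequences of categories -/

universe v u

section InvLim

variable {C : ℕ → Type u} [∀ n, Category.{v} (C n)] (F : ∀ n, C (n + 1) ⥤ C n)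

/-- Objects of the inverse limit of a sequence of categories: sequences of objects, together with
isomorphisms between each of them and the image of the next one. -/
structure InvLim where
  obj : ∀ n, C n
  iso : ∀ n, (F n).obj (obj (n + 1)) ≅ obj n

variable {F}

/-- Morphisms of the inverse limit: sequences of morphisms compatible with the isomorphisms. -/
@[ext]
structure InvLim.Hom (X Y : InvLim F) where
  app : ∀ n, X.obj n ⟶ Y.obj n
  comm : ∀ n, (F n).map (app (n + 1)) ≫ (Y.iso n).hom = (X.iso n).hom ≫ app n

instance InvLim.category : Category (InvLim F) where
  Hom X Y := InvLim.Hom X Y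
  id X := { app := fun n => 𝟙 (X.obj n), comm := fun n => by simp }
  comp f g :=
    { app := fun n => f.app n ≫ g.app n
      comm := fun n => by
        rw [Functor.map_comp, Category.assoc, g.comm, ← Category.assoc, f.comm, Category.assoc] }
  id_comp f := InvLim.Hom.ext (funext fun _ => Category.id_comp _)
  comp_id f := InvLim.Hom.ext (funext fun _ => Category.comp_id _)
  assoc f g h := InvLim.Hom.ext (funext fun _ => Category.assoc _ _ _)

/-- The restricted inverse limit is the full subcategory of the inverse limit on the sequences of
objects whose lengths form a sequence that stabilizes (at a finite value). -/
def restricted (F : ∀ n, C (n + 1) ⥤ C n) (len : ∀ n, C n → ℕ∞) : ObjectProperty (InvLim F) :=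
  fun X => ∃ l : ℕ, ∀ᶠ n in Filter.atTop, len n (X.obj n) = l

end InvLim

/-! ### The functors between the categories O

The sequence of categories is indexed by `n = 0, 1, 2, …`, its term number `n` being the category
for `gl_{n+1}`. -/

/-- The category `O` of degree `ν` for `gl_{n+1}`. -/
abbrev OFin (ν : ℂ) (n : ℕ) : Type 1 := (catO ν (upTo (n + 1))).FullSubcategory

/-- The category `O` of degree `ν` for `gl_∞`. -/
abbrev OInf (ν : ℂ) : Type 1 := (catO ν Set.univ).FullSubcategory

/-- The functor `Γ_n = (·)^{gl_n^⊥}` on all `gl_∞`-modules. -/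
noncomputable abbrev gammaMod (n : ℕ) : LieMod (gl Set.univ) ⥤ LieMod (gl (upTo n)) :=
  invFunctor (Set.subset_univ _)

/-- The functor `Res_{n,n+1} = (·)^{gl_n^⊥}` on all `gl_{n+1}`-modules. -/
noncomputable abbrev resMod (n : ℕ) : LieMod (gl (upTo (n + 1))) ⥤ LieMod (gl (upTo n)) :=
  invFunctor (upTo_mono n.le_succ)

/-- The canonical inclusion `Γ_n(M) → Res_{n,n+1}(Γ_{n+1}(M))`, natural in the `gl_∞`-module `M`. -/
noncomputable abbrev gammaComparison (n : ℕ) : gammaMod n ⟶ gammaMod (n + 1) ⋙ resMod n :=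
  invComparison (upTo_mono n.le_succ) (Set.subset_univ _)

/-- The functors `Res_{n,n+1}` (`n ≥ 1`) preserve the categories `O`. -/
def ResPreserves (ν : ℂ) : Prop :=
  ∀ (n : ℕ) (M : LieMod (gl (upTo (n + 2)))), catO ν (upTo (n + 2)) M →
    catO ν (upTo (n + 1)) ((resMod (n + 1)).obj M)

/-- The functors `Γ_n` (`n ≥ 1`) map the category `O` for `gl_∞` to the one for `gl_n`. -/
def GammaPreserves (ν : ℂ) : Prop :=
  ∀ (n : ℕ) (M : LieMod (gl Set.univ)), catO ν Set.univ M →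
    catO ν (upTo (n + 1)) ((gammaMod (n + 1)).obj M)

/-- The canonical map `Γ_n(M) → Res_{n,n+1}(Γ_{n+1}(M))` is an isomorphism for all `n ≥ 1` and
all `M` in the category `O` for `gl_∞`. -/
def GammaCompatible (ν : ℂ) : Prop :=
  ∀ (n : ℕ) (M : LieMod (gl Set.univ)), catO ν Set.univ M →
    IsIso ((gammaComparison (n + 1)).app M)

section Functors

variable {ν : ℂ}

/-- `Res_{n+1,n+2}`, from the category `O` for `gl_{n+2}` to the category `O` for `gl_{n+1}`. -/
noncomputable def resO (hR : ResPreserves ν) (n : ℕ) : OFin ν (n + 1) ⥤ OFin ν n :=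
  ObjectProperty.lift _ ((catO ν (upTo (n + 2))).ι ⋙ resMod (n + 1))
    (fun M => hR n M.obj M.property)

/-- `Γ_{n+1}`, from the category `O` for `gl_∞` to the category `O` for `gl_{n+1}`. -/
noncomputable def gammaO (hG : GammaPreserves ν) (n : ℕ) : OInf ν ⥤ OFin ν n :=
  ObjectProperty.lift _ ((catO ν Set.univ).ι ⋙ gammaMod (n + 1))
    (fun M => hG n M.obj M.property)

/-- The functor induced by all `Γ_n`, to the inverse limit of the categories `O` for `gl_n`. -/
noncomputable def gammaLim (hR : ResPreserves ν) (hG : GammaPreserves ν)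
    (hC : GammaCompatible ν) : OInf ν ⥤ InvLim (resO hR) where
  obj M :=
    { obj := fun n => (gammaO hG n).obj M
      iso := fun n =>
        haveI := hC n M.obj M.property
        ObjectProperty.isoMk _ (asIso ((gammaComparison (n + 1)).app M.obj)).symm }
  map {M N} f :=
    { app := fun n => (gammaO hG n).map f
      comm := fun n => by
        have := hC n M.obj M.property
        have := hC n N.obj N.property
        apply ObjectProperty.hom_ext
        change ((gammaMod (n + 2) ⋙ resMod (n + 1)).map f.hom) ≫
            inv ((gammaComparison (n + 1)).app N.obj) =
          inv ((gammaComparison (n + 1)).app M.obj) ≫ (gammaMod (n + 1)).map f.hom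
        rw [IsIso.comp_inv_eq, Category.assoc, IsIso.eq_inv_comp]
        exact ((gammaComparison (n + 1)).naturality f.hom).symm }
  map_id _ := rfl
  map_comp _ _ := rfl

/-- The restricted inverse limit of the categories `O` for `gl_n`, `n ≥ 1`. -/
noncomputable def restrictedLim (hR : ResPreserves ν) : ObjectProperty (InvLim (resO hR)) :=
  restricted (resO hR) (fun _ M => M.obj.length)

/-- The functor `Γ_lim`, to the restricted inverse limit. -/
noncomputable def gammaRestr (hR : ResPreserves ν) (hG : GammaPreserves ν)
    (hC : GammaCompatible ν) (hS : ∀ M, restrictedLim hR ((gammaLim hR hG hC).obj M)) :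
    OInf ν ⥤ (restrictedLim hR).FullSubcategory :=
  ObjectProperty.lift _ (gammaLim hR hG hC) hS

end Functors

end ParabolicO

/-! Everything is reduced to weights. The tensor powers of `U` are semisimple, because the hermitian
form with orthonormal words makes `E k l` adjoint to `E l k`. Hence ind-polynomial modules are
exactly those spanned by the values of equivariant maps from tensor powers
(`isIndPoly_of_tensorSpan`, `tensorSpan_of_isIndPoly`). They are spanned by weight vectors with
weights in ℕ, and this non-negativity is decisive: the invariants of `gl_n^⊥` are the sum of the
weight spaces supported on the first `n` indices (`IsWtRep.glInv_eq`). So `Γ_n` and `Res` select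
weight spaces. Preservation of `O` and compatibility follow by selecting the right members of
spanning families (`IsO.of_glInv`, `isIso_invComparison`). Since every weight has finite support, a
`gl_∞`-module is the union of its invariants, which gives full faithfulness.

Two tools compare different ranks. A stable space `N` of invariants generates a submodule whose
invariants are again `N` (`IsWtRep.lower_inf_glInv`), so submodules of the invariants embed into
submodules of the module and lengths grow with `n`. Conversely, a unit of weight that is moved to a
free index can be moved back, up to a non-zero scalar. Hence a weight vector of degree at most `|T|`
lying in `W` and outside `W'` can be moved to weights supported on `T` (`IsWtRep.exists_moved`).

Finite length over `gl_∞` follows once the degrees in which two submodules differ are bounded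
(`exists_degree_bound`). Let `M` be generated in degrees at most `m`, and let the least degree of a
difference be `m + k`. Then the difference is seen on a weight with at least `k` units at one index,
and the other units, at most `m` of them, can be moved to `m` further indices. So it is seen in a
fixed finite rank, whatever `k` is, and there it gives a vector that is singular modulo the smaller
submodule. A Casimir operator acts on it by a scalar that grows quadratically with the degree. That
operator satisfies a polynomial equation, because it commutes with the lowering operators and
preserves a finite-dimensional generating subspace. So `k` is bounded.

For essential surjectivity, take the union `V` of a coherent sequence `A n`. Its invariants are the
`A n`. An equivariant map to `A n` from the `d`-th tensor power, `d ≤ n`, extends to all words: the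
graph on the small words generates the graph of the extension (`exists_tensorMap_extension`). This
makes `V` ind-polynomial of degree `ν`. When the length is constant from `n` on, `A n` generates
every later term (`IsUnion.eq_top_of_length`), and therefore `V` is finitely generated. -/

namespace ParabolicO

/-! ### Weight vectors, and representations with non-negative weights. -/

section Operators

variable {V : Type*} [AddCommGroup V] [Module ℂ V]

/-- The smallest subspace that contains `X` and is stable under the operators in `F`. -/
def opClosure (F : Set (Module.End ℂ V)) (X : Set V) : Submodule ℂ V :=
  sInf {W | X ⊆ W ∧ ∀ f ∈ F, ∀ w ∈ W, f w ∈ W}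

theorem subset_opClosure (F : Set (Module.End ℂ V)) (X : Set V) : X ⊆ opClosure F X := by
  intro x hx
  simp only [opClosure, SetLike.mem_coe, Submodule.mem_sInf]
  exact fun W hW => hW.1 hx

theorem opClosure_apply {F : Set (Module.End ℂ V)} {X : Set V} {f : Module.End ℂ V} (hf : f ∈ F)
    {w : V} (hw : w ∈ opClosure F X) : f w ∈ opClosure F X := by
  simp only [opClosure, Submodule.mem_sInf] at hw ⊢
  exact fun W hW => hW.2 f hf w (hw W hW)

theorem opClosure_le {F : Set (Module.End ℂ V)} {X : Set V} {W : Submodule ℂ V} (hX : X ⊆ W)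
    (hF : ∀ f ∈ F, ∀ w ∈ W, f w ∈ W) : opClosure F X ≤ W :=
  sInf_le ⟨hX, hF⟩

/-- An induction principle that remembers membership in the closure. -/
theorem opClosure_le' {F : Set (Module.End ℂ V)} {X : Set V} {W : Submodule ℂ V} (hX : X ⊆ W)
    (hF : ∀ f ∈ F, ∀ w ∈ opClosure F X, w ∈ W → f w ∈ W) : opClosure F X ≤ W := by
  have : opClosure F X ≤ W ⊓ opClosure F X :=
    opClosure_le (fun x hx => ⟨hX hx, subset_opClosure F X hx⟩)
      (fun f hf w hw => ⟨hF f hf w hw.2 hw.1, opClosure_apply hf hw.2⟩)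
  exact this.trans inf_le_left

/-- The operators `e i j`, for `i, j ∈ S`, satisfy the commutation relations of matrix units. -/
def IsGlRep (S : Set ℕ) (e : ℕ → ℕ → Module.End ℂ V) : Prop :=
  ∀ i ∈ S, ∀ j ∈ S, ∀ k ∈ S, ∀ l ∈ S, ∀ v, e i j (e k l v) =
    e k l (e i j v) + ((if j = k then e i l v else 0) - if i = l then e k j v else 0)

theorem IsGlRep.mono {S T : Set ℕ} {e : ℕ → ℕ → Module.End ℂ V} (h : IsGlRep S e) (hT : T ⊆ S) :
    IsGlRep T e := fun i hi j hj k hk l hl =>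
  h i (hT hi) j (hT hj) k (hT hk) l (hT hl)

/-- Stability of a subspace under the operators `e i j`, for `i, j ∈ S`. -/
def IsStable (S : Set ℕ) (e : ℕ → ℕ → Module.End ℂ V) (W : Submodule ℂ V) : Prop :=
  ∀ i ∈ S, ∀ j ∈ S, ∀ v ∈ W, e i j v ∈ W

theorem IsStable.mono {S T : Set ℕ} {e : ℕ → ℕ → Module.End ℂ V} {W : Submodule ℂ V}
    (h : IsStable S e W) (hT : T ⊆ S) : IsStable T e W := fun i hi j hj =>
  h i (hT hi) j (hT hj)

theorem IsStable.inf {S : Set ℕ} {e : ℕ → ℕ → Module.End ℂ V} {W W' : Submodule ℂ V}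
    (h : IsStable S e W) (h' : IsStable S e W') : IsStable S e (W ⊓ W') :=
  fun i hi j hj v hv => ⟨h i hi j hj v hv.1, h' i hi j hj v hv.2⟩

theorem IsStable.diag {S I : Set ℕ} {e : ℕ → ℕ → Module.End ℂ V} {W : Submodule ℂ V}
    (h : IsStable S e W) (hI : I ⊆ S) : ∀ i ∈ I, ∀ v ∈ W, e i i v ∈ W :=
  fun i hi => h i (hI hi) i (hI hi)

theorem isStable_bot (S : Set ℕ) (e : ℕ → ℕ → Module.End ℂ V) : IsStable S e ⊥ := by
  rintro i - j - v hv
  rw [Submodule.mem_bot] at hv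
  simp [hv]

/-- `v` is a weight vector of weight `μ` for the operators `e i i`, for `i ∈ I`. -/
def IsWt (I : Set ℕ) (e : ℕ → ℕ → Module.End ℂ V) (μ : ℕ →₀ ℕ) (v : V) : Prop :=
  ∀ i ∈ I, e i i v = (μ i : ℂ) • v

/-- The sum of the weight spaces for the weights in `A`. -/
def wtSpan (I : Set ℕ) (e : ℕ → ℕ → Module.End ℂ V) (A : Set (ℕ →₀ ℕ)) : Submodule ℂ V :=
  Submodule.span ℂ {v | ∃ μ ∈ A, (μ.support : Set ℕ) ⊆ I ∧ IsWt I e μ v}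

section Weights

variable {I : Set ℕ} {e : ℕ → ℕ → Module.End ℂ V}

theorem IsWt.mono {J : Set ℕ} {μ : ℕ →₀ ℕ} {v : V} (h : IsWt I e μ v) (hJ : J ⊆ I) :
    IsWt J e μ v := fun i hi => h i (hJ hi)

theorem IsWt.zero (μ : ℕ →₀ ℕ) : IsWt I e μ 0 := fun i _ => by simp

theorem IsWt.add {μ : ℕ →₀ ℕ} {v w : V} (hv : IsWt I e μ v) (hw : IsWt I e μ w) :
    IsWt I e μ (v + w) := fun i hi => by rw [map_add, hv i hi, hw i hi, smul_add]

theorem IsWt.smul {μ : ℕ →₀ ℕ} {v : V} (c : ℂ) (hv : IsWt I e μ v) :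
    IsWt I e μ (c • v) := fun i hi => by rw [map_smul, hv i hi, smul_comm]

theorem IsWt.mem_wtSpan {A : Set (ℕ →₀ ℕ)} {μ : ℕ →₀ ℕ} {v : V} (hv : IsWt I e μ v) (hμ : μ ∈ A)
    (hI : (μ.support : Set ℕ) ⊆ I) : v ∈ wtSpan I e A :=
  Submodule.subset_span ⟨μ, hμ, hI, hv⟩

theorem wtSpan_mono {A B : Set (ℕ →₀ ℕ)} (h : A ⊆ B) : wtSpan I e A ≤ wtSpan I e B :=
  Submodule.span_mono fun _ ⟨μ, hμ, h'⟩ => ⟨μ, h hμ, h'⟩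

theorem wtSpan_induction {A : Set (ℕ →₀ ℕ)} {W : Submodule ℂ V}
    (h : ∀ μ ∈ A, (μ.support : Set ℕ) ⊆ I → ∀ v, IsWt I e μ v → v ∈ W) : wtSpan I e A ≤ W :=
  Submodule.span_le.2 fun v ⟨μ, hμ, hI, hv⟩ => h μ hμ hI v hv

theorem ext_of_support_subset {μ μ' : ℕ →₀ ℕ} (h : (μ.support : Set ℕ) ⊆ I)
    (h' : (μ'.support : Set ℕ) ⊆ I) (he : ∀ i ∈ I, μ i = μ' i) : μ = μ' := by
  ext i
  by_cases hi : i ∈ I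
  · exact he i hi
  · rw [Finsupp.notMem_support_iff.1 fun hc => hi (h hc),
      Finsupp.notMem_support_iff.1 fun hc => hi (h' hc)]

/-- Two different weights supported in `I` differ at some `i ∈ I`. The operator `e i i - a i` kills
the summand of weight `a` and rescales the others, so induction on the number of summands applies.
-/
theorem wt_sum_mem {W : Submodule ℂ V} (hW : ∀ i ∈ I, ∀ v ∈ W, e i i v ∈ W)
    (s : Finset (ℕ →₀ ℕ)) (hs : ∀ μ ∈ s, (μ.support : Set ℕ) ⊆ I) (v : (ℕ →₀ ℕ) → V)
    (hv : ∀ μ ∈ s, IsWt I e μ (v μ)) (h : ∑ μ ∈ s, v μ ∈ W) : ∀ μ ∈ s, v μ ∈ W := by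
  classical
  induction s using Finset.induction_on generalizing v with
  | empty => simp
  | insert a s ha ih =>
    have key : ∀ μ ∈ s, v μ ∈ W := by
      intro μ hμ
      have hne : μ ≠ a := fun h => ha (h ▸ hμ)
      obtain ⟨i, hi, hia⟩ : ∃ i ∈ I, μ i ≠ a i := by
        by_contra! hc
        exact hne (ext_of_support_subset (hs μ (Finset.mem_insert_of_mem hμ))
          (hs a (Finset.mem_insert_self _ _)) hc)
      have h1 : ∑ μ ∈ s, ((μ i : ℂ) - a i) • v μ ∈ W := by
        have h2 := W.sub_mem (hW i hi _ h) (W.smul_mem (a i : ℂ) h)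
        rw [Finset.sum_insert ha, map_add, map_sum, smul_add, Finset.smul_sum,
          hv a (Finset.mem_insert_self _ _) i hi, add_sub_add_left_eq_sub,
          ← Finset.sum_sub_distrib] at h2
        convert h2 using 1
        refine Finset.sum_congr rfl fun μ hμ => ?_
        rw [hv μ (Finset.mem_insert_of_mem hμ) i hi, sub_smul]
      have h3 := ih (fun μ hμ => hs μ (Finset.mem_insert_of_mem hμ)) _
        (fun μ hμ => (hv μ (Finset.mem_insert_of_mem hμ)).smul _) h1 μ hμ
      refine (W.smul_mem_iff ?_).1 h3
      rw [sub_ne_zero]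
      exact_mod_cast hia
    intro μ hμ
    rcases Finset.mem_insert.1 hμ with rfl | hμ
    · rw [Finset.sum_insert ha] at h
      exact (W.add_mem_iff_left (W.sum_mem key)).1 h
    · exact key μ hμ

theorem wt_finsupp_mem {W : Submodule ℂ V} (hW : ∀ i ∈ I, ∀ v ∈ W, e i i v ∈ W)
    (v : (ℕ →₀ ℕ) →₀ V) (hs : ∀ μ ∈ v.support, (μ.support : Set ℕ) ⊆ I)
    (hv : ∀ μ, IsWt I e μ (v μ)) (h : (v.sum fun _ y => y) ∈ W) (μ : ℕ →₀ ℕ) : v μ ∈ W := by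
  by_cases hμ : μ ∈ v.support
  · exact wt_sum_mem hW v.support hs v (fun μ _ => hv μ) h μ hμ
  · rw [Finsupp.notMem_support_iff.1 hμ]
    exact W.zero_mem

theorem exists_wt_decomposition {A : Set (ℕ →₀ ℕ)} {x : V} (hx : x ∈ wtSpan I e A) :
    ∃ v : (ℕ →₀ ℕ) →₀ V, (∀ μ ∈ v.support, μ ∈ A ∧ (μ.support : Set ℕ) ⊆ I) ∧
      (∀ μ, IsWt I e μ (v μ)) ∧ (v.sum fun _ y => y) = x := by
  classical
  induction hx using Submodule.span_induction with
  | mem x hx =>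
    obtain ⟨μ, hμ, hI, hv⟩ := hx
    refine ⟨Finsupp.single μ x, fun μ' h => ?_, fun μ' => ?_, by simp⟩
    · rw [Finset.mem_singleton.1 (Finsupp.support_single_subset h)]
      exact ⟨hμ, hI⟩
    · rw [Finsupp.single_apply]
      split_ifs with h
      · exact h ▸ hv
      · exact IsWt.zero _
  | zero => exact ⟨0, by simp, fun μ => IsWt.zero _, by simp⟩
  | add x y _ _ hx hy =>
    obtain ⟨v, h1, h2, rfl⟩ := hx
    obtain ⟨w, h3, h4, rfl⟩ := hy
    refine ⟨v + w, fun μ hμ => ?_, fun μ => (h2 μ).add (h4 μ),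
      Finsupp.sum_add_index' (fun _ => rfl) (fun _ _ _ => rfl)⟩
    rcases Finset.mem_union.1 (Finsupp.support_add hμ) with h | h
    exacts [h1 μ h, h3 μ h]
  | smul c x _ hx =>
    obtain ⟨v, h1, h2, rfl⟩ := hx
    refine ⟨c • v, fun μ hμ => h1 μ (Finsupp.support_smul hμ), fun μ => (h2 μ).smul c, ?_⟩
    rw [Finsupp.sum_smul_index' (fun _ => rfl), Finsupp.smul_sum]

theorem mem_of_add_mem {W : Submodule ℂ V} (hW : ∀ i ∈ I, ∀ v ∈ W, e i i v ∈ W)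
    {A B : Set (ℕ →₀ ℕ)} (hAB : Disjoint A B) {a b : V} (ha : a ∈ wtSpan I e A)
    (hb : b ∈ wtSpan I e B) (h : a + b ∈ W) : a ∈ W := by
  classical
  obtain ⟨v, h1, h2, rfl⟩ := exists_wt_decomposition ha
  obtain ⟨w, h3, h4, rfl⟩ := exists_wt_decomposition hb
  rw [← Finsupp.sum_add_index' (fun _ => rfl) (fun _ _ _ => rfl)] at h
  have key := wt_finsupp_mem hW (v + w) (fun μ hμ => by
    rcases Finset.mem_union.1 (Finsupp.support_add hμ) with h | h
    exacts [(h1 μ h).2, (h3 μ h).2]) (fun μ => (h2 μ).add (h4 μ)) h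
  refine W.sum_mem fun μ hμ => ?_
  have := key μ
  rwa [Finsupp.add_apply, Finsupp.notMem_support_iff.1 fun hc =>
    hAB.ne_of_mem (h1 μ hμ).1 (h3 μ hc).1 rfl, add_zero] at this

theorem eq_zero_of_mem_wtSpan {A B : Set (ℕ →₀ ℕ)} (hAB : Disjoint A B) {a : V}
    (ha : a ∈ wtSpan I e A) (hb : a ∈ wtSpan I e B) : a = 0 := by
  have := mem_of_add_mem (W := ⊥) (I := I) (e := e) (fun i _ v hv => by
    rw [Submodule.mem_bot] at hv ⊢
    rw [hv, map_zero]) hAB ha (Submodule.neg_mem _ hb) (by simp)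
  simpa using this

/-- A stable subspace is spanned by its weight vectors. -/
theorem exists_wt_of_not_le {W W' : Submodule ℂ V} (hW : ∀ i ∈ I, ∀ v ∈ W, e i i v ∈ W)
    {A : Set (ℕ →₀ ℕ)} (hA : W ≤ wtSpan I e A) (h : ¬ W ≤ W') :
    ∃ μ ∈ A, (μ.support : Set ℕ) ⊆ I ∧ ∃ v ∈ W, v ∉ W' ∧ IsWt I e μ v := by
  obtain ⟨x, hx, hx'⟩ := SetLike.not_le_iff_exists.1 h
  obtain ⟨v, h1, h2, rfl⟩ := exists_wt_decomposition (hA hx)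
  have key := wt_finsupp_mem hW v (fun μ hμ => (h1 μ hμ).2) h2 hx
  obtain ⟨μ, hμ, hv⟩ : ∃ μ ∈ v.support, v μ ∉ W' := by
    by_contra! hc
    exact hx' (W'.sum_mem hc)
  exact ⟨μ, (h1 μ hμ).1, (h1 μ hμ).2, v μ, key μ, hv, h2 μ⟩

/-- Projection of a spanning family of weight vectors to a sum of weight spaces. -/
theorem mem_span_of_mem_wtSpan {κ : Type*} {b : κ → V} {μ : κ → ℕ →₀ ℕ}
    (hI : ∀ k, ((μ k).support : Set ℕ) ⊆ I) (hb : ∀ k, IsWt I e (μ k) (b k))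
    {A : Set (ℕ →₀ ℕ)} {x : V} (hx : x ∈ Submodule.span ℂ (Set.range b))
    (hxA : x ∈ wtSpan I e A) : x ∈ Submodule.span ℂ (b '' {k | μ k ∈ A}) := by
  have h1 : Set.range b = b '' {k | μ k ∈ A} ∪ b '' {k | μ k ∈ A}ᶜ := by
    rw [← Set.image_union, Set.union_compl_self, Set.image_univ]
  rw [h1, Submodule.span_union] at hx
  obtain ⟨y, hy, z, hz, rfl⟩ := Submodule.mem_sup.1 hx
  have hyA : y ∈ wtSpan I e A := by
    refine Submodule.span_le.2 ?_ hy
    rintro _ ⟨k, hk, rfl⟩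
    exact (hb k).mem_wtSpan hk (hI k)
  have hzA : z ∈ wtSpan I e Aᶜ := by
    refine Submodule.span_le.2 ?_ hz
    rintro _ ⟨k, hk, rfl⟩
    exact (hb k).mem_wtSpan hk (hI k)
  have hz0 : z = 0 := eq_zero_of_mem_wtSpan disjoint_compl_right
    ((Submodule.add_mem_iff_right _ hyA).1 hxA) hzA
  rwa [hz0, add_zero]

end Weights

/-- A representation of `gl(S)` that is spanned by weight vectors for `gl(I)`, `I ⊆ S`, with
non-negative weights. -/
structure IsWtRep (S I : Set ℕ) (e : ℕ → ℕ → Module.End ℂ V) : Prop where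
  gl : IsGlRep S e
  sub : I ⊆ S
  top : wtSpan I e Set.univ = ⊤

namespace IsWtRep

variable {S I : Set ℕ} {e : ℕ → ℕ → Module.End ℂ V}

theorem restrict (h : IsWtRep S I e) : IsWtRep I I e := ⟨h.gl.mono h.sub, subset_rfl, h.top⟩

/-- The equation between the weights is written without subtraction and only on `I`. Thus `i` or `j`
may be an index outside `I`, such as `0`, where weights are not recorded. -/
theorem wt_shift (h : IsWtRep S I e) {i j : ℕ} (hi : i ∈ S) (hj : j ∈ S) {μ μ' : ℕ →₀ ℕ}
    (hμ : ∀ k ∈ I, μ' k + (if k = j then 1 else 0) = μ k + if k = i then 1 else 0)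
    {v : V} (hv : IsWt I e μ v) : IsWt I e μ' (e i j v) := by
  intro k hk
  have h1 : (μ' k : ℂ) + (if k = j then 1 else 0) = μ k + if k = i then 1 else 0 := by
    exact_mod_cast hμ k hk
  rw [h.gl k (h.sub hk) k (h.sub hk) i hi j hj, hv k hk, map_smul, eq_sub_of_add_eq h1]
  split_ifs with h2 h3 h3 <;> subst_vars <;> module

/-- The eigenvalues of `e j j` are natural numbers, so `-1` is not one of them. This is where
non-negativity of the weights enters. -/
theorem eq_zero_of_neg (h : IsWtRep S I e) {j : ℕ} (hj : j ∈ I) {v : V} (hv : e j j v = -v) :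
    v = 0 := by
  obtain ⟨u, h1, h2, rfl⟩ := exists_wt_decomposition (h.top ▸ Submodule.mem_top : v ∈ _)
  have h3 : ∑ μ ∈ u.support, ((μ j : ℂ) + 1) • u μ ∈ (⊥ : Submodule ℂ V) := by
    rw [Finsupp.sum, map_sum, ← sub_eq_zero, sub_neg_eq_add, ← Finset.sum_add_distrib] at hv
    rw [Submodule.mem_bot, ← hv]
    refine Finset.sum_congr rfl fun μ _ => ?_
    rw [h2 μ j hj, add_smul, one_smul]
  refine Finset.sum_eq_zero fun μ hμ => ?_
  have h4 := wt_sum_mem ((isStable_bot I e).diag subset_rfl) u.support (fun μ hμ => (h1 μ hμ).2) _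
    (fun μ _ => (h2 μ).smul _) h3 μ hμ
  rw [Submodule.mem_bot] at h4
  exact (smul_eq_zero.1 h4).resolve_left (Nat.cast_add_one_ne_zero _)

/-- The image would be an eigenvector of `e j j` with eigenvalue `-1`. -/
theorem apply_eq_zero (h : IsWtRep S I e) {i j : ℕ} (hi : i ∈ S) (hj : j ∈ I) (hij : i ≠ j)
    {μ : ℕ →₀ ℕ} {v : V} (hv : IsWt I e μ v) (hμ : μ j = 0) : e i j v = 0 := by
  apply h.eq_zero_of_neg hj
  rw [h.gl j (h.sub hj) j (h.sub hj) i hi j (h.sub hj), hv j hj, if_neg hij.symm, if_pos rfl, hμ]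
  simp

/-- A unit of weight that is moved to a free place can be moved back. -/
theorem apply_apply (h : IsWtRep S I e) {i j : ℕ} (hi : i ∈ I) (hj : j ∈ I) (hij : i ≠ j)
    {μ : ℕ →₀ ℕ} {v : V} (hv : IsWt I e μ v) (hμ : μ j = 0) :
    e i j (e j i v) = (μ i : ℂ) • v := by
  rw [h.gl i (h.sub hi) j (h.sub hj) j (h.sub hj) i (h.sub hi),
    h.apply_eq_zero (h.sub hi) hj hij hv hμ, if_pos rfl, if_pos rfl, hv i hi, hv j hj, hμ]
  simp

/-- The operator `e i j` on sums of weight spaces. -/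
theorem apply_mem_wtSpan (h : IsWtRep S I e) {i j : ℕ} (hi : i ∈ S) (hj : j ∈ S)
    {A B : Set (ℕ →₀ ℕ)}
    (hAB : ∀ μ ∈ A, ∀ μ' : ℕ →₀ ℕ, (μ.support : Set ℕ) ⊆ I → (μ'.support : Set ℕ) ⊆ I →
      (∀ k ∈ I, μ' k + (if k = j then 1 else 0) = μ k + if k = i then 1 else 0) → μ' ∈ B)
    {v : V} (hv : v ∈ wtSpan I e A) : e i j v ∈ wtSpan I e B := by
  classical
  refine (wtSpan_induction (W := (wtSpan I e B).comap (e i j)) fun μ hμ hI v hv => ?_) hv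
  rw [Submodule.mem_comap]
  -- This is the case in which the truncated subtraction defining `μ'` would give a wrong weight;
  -- there the image vanishes.
  by_cases hc : j ∈ I ∧ μ j = 0 ∧ i ≠ j
  · rw [h.apply_eq_zero hi hc.1 hc.2.2 hv hc.2.1]
    exact Submodule.zero_mem _
  let μ' : ℕ →₀ ℕ := (μ + (if i ∈ I then Finsupp.single i 1 else 0)) -
    if j ∈ I then Finsupp.single j 1 else 0
  have h1 : ∀ k ∈ I, μ' k + (if k = j then 1 else 0) = μ k + if k = i then 1 else 0 := by
    intro k hk
    have e1 : (if i ∈ I then Finsupp.single i 1 else 0 : ℕ →₀ ℕ) k = if k = i then 1 else 0 := by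
      split_ifs with h1 h2 h2 <;> simp_all [eq_comm]
    have e2 : (if j ∈ I then Finsupp.single j 1 else 0 : ℕ →₀ ℕ) k = if k = j then 1 else 0 := by
      split_ifs with h1 h2 h2 <;> simp_all [eq_comm]
    simp only [μ', Finsupp.coe_tsub, Pi.sub_apply, Finsupp.coe_add, Pi.add_apply, e1, e2]
    by_cases hkj : k = j
    · subst hkj
      by_cases hki : k = i
      · simp [hki]
      · have : μ k ≠ 0 := fun h0 => hc ⟨hk, h0, fun h => hki h.symm⟩
        simp only [if_true, if_neg hki]
        omega
    · simp [hkj]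
  have h2 : (μ'.support : Set ℕ) ⊆ I := by
    intro k hk
    by_contra hkI
    rw [Finset.mem_coe, Finsupp.mem_support_iff] at hk
    apply hk
    have e1 : (if i ∈ I then Finsupp.single i 1 else 0 : ℕ →₀ ℕ) k = 0 := by
      split_ifs with h1
      · exact Finsupp.single_eq_of_ne fun h => hkI (h ▸ h1)
      · rfl
    have e3 : μ k = 0 := Finsupp.notMem_support_iff.1 fun h => hkI (hI h)
    simp only [μ', Finsupp.coe_tsub, Pi.sub_apply, Finsupp.coe_add, Pi.add_apply, e1, e3]
    simp
  exact (h.wt_shift hi hj h1 hv).mem_wtSpan (hAB μ hμ μ' hI h2 h1) h2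

end IsWtRep

/-! ### Invariants of `gl(S \ T)` and the submodules they generate. -/

/-- The vectors killed by `gl(S \ T)`. -/
def glInv (S T : Set ℕ) (e : ℕ → ℕ → Module.End ℂ V) : Submodule ℂ V where
  carrier := {v | ∀ i ∈ S \ T, ∀ j ∈ S \ T, e i j v = 0}
  zero_mem' := by simp
  add_mem' := by
    intro v w hv hw i hi j hj
    rw [map_add, hv i hi j hj, hw i hi j hj, add_zero]
  smul_mem' := by
    intro c v hv i hi j hj
    rw [map_smul, hv i hi j hj, smul_zero]

namespace IsWtRep

variable {S I : Set ℕ} {e : ℕ → ℕ → Module.End ℂ V}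

/-- The invariants of `gl(S \ T)` are sums of weight spaces. -/
theorem glInv_eq (h : IsWtRep S I e) {T : Set ℕ} (hT : S \ T ⊆ I) :
    glInv S T e = wtSpan I e {μ | (μ.support : Set ℕ) ⊆ T} := by
  apply le_antisymm
  · intro v hv
    obtain ⟨u, h1, h2, rfl⟩ := exists_wt_decomposition (h.top ▸ Submodule.mem_top : v ∈ _)
    refine Submodule.sum_mem _ fun μ hμ => (h2 μ).mem_wtSpan ?_ (h1 μ hμ).2
    intro i hi
    by_contra hiT
    have hiI := (h1 μ hμ).2 hi
    have hv' := hv i ⟨h.sub hiI, hiT⟩ i ⟨h.sub hiI, hiT⟩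
    have h3 : ∑ μ ∈ u.support, (μ i : ℂ) • u μ ∈ (⊥ : Submodule ℂ V) := by
      rw [Submodule.mem_bot, ← hv', Finsupp.sum, map_sum]
      exact Finset.sum_congr rfl fun μ _ => (h2 μ i hiI).symm
    have h4 := wt_sum_mem ((isStable_bot I e).diag subset_rfl) u.support (fun μ hμ => (h1 μ hμ).2) _
      (fun μ _ => (h2 μ).smul _) h3 μ hμ
    rw [Submodule.mem_bot] at h4
    rcases smul_eq_zero.1 h4 with h5 | h5
    · exact Finsupp.mem_support_iff.1 hi (by exact_mod_cast h5)
    · exact Finsupp.mem_support_iff.1 hμ h5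
  · refine wtSpan_induction fun μ hμ hI v hv i hi j hj => ?_
    have hμj : μ j = 0 := Finsupp.notMem_support_iff.1 fun hc => hj.2 (hμ hc)
    by_cases hij : i = j
    · subst hij
      rw [hv i (hT hi), hμj]
      simp
    · exact h.apply_eq_zero hi.1 (hT hj) hij hv hμj

/-- If the diagonal units outside `T` kill `v`, its weights vanish outside `T`, and then the
off-diagonal units kill it too, again because `-1` is not an eigenvalue. -/
theorem mem_glInv_of_diag (h : IsWtRep S I e) {T : Set ℕ} (hT : S \ T ⊆ I) {v : V}
    (hv : ∀ i ∈ S \ T, e i i v = 0) : v ∈ glInv S T e := by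
  intro i hi j hj
  by_cases hij : i = j
  · exact hij ▸ hv i hi
  · obtain ⟨u, h1, h2, rfl⟩ := exists_wt_decomposition (h.top ▸ Submodule.mem_top : v ∈ _)
    rw [Finsupp.sum, map_sum]
    have h3 : ∑ μ ∈ u.support, (μ j : ℂ) • u μ ∈ (⊥ : Submodule ℂ V) := by
      rw [Submodule.mem_bot, ← hv j hj, Finsupp.sum, map_sum]
      exact Finset.sum_congr rfl fun μ _ => (h2 μ j (hT hj)).symm
    refine Finset.sum_eq_zero fun μ hμ => ?_
    have h4 := wt_sum_mem ((isStable_bot I e).diag subset_rfl) u.support (fun μ hμ => (h1 μ hμ).2) _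
      (fun μ _ => (h2 μ).smul _) h3 μ hμ
    rw [Submodule.mem_bot] at h4
    rcases smul_eq_zero.1 h4 with h5 | h5
    · exact h.apply_eq_zero hi.1 (hT hj) hij (h2 μ) (by exact_mod_cast h5)
    · rw [h5, map_zero]

/-- The subspace generated by a `gl(T)`-stable subspace of the invariants of `gl(S \ T)`. -/
def lower (S T : Set ℕ) (e : ℕ → ℕ → Module.End ℂ V) (N : Submodule ℂ V) : Submodule ℂ V :=
  opClosure {f | ∃ i ∈ S \ T, ∃ j ∈ T, f = e i j} N

theorem le_lower (S T : Set ℕ) (e : ℕ → ℕ → Module.End ℂ V) (N : Submodule ℂ V) :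
    N ≤ lower S T e N := subset_opClosure _ _

theorem lower_le {T : Set ℕ} (hT : T ⊆ S) {N W : Submodule ℂ V} (hN : N ≤ W)
    (hW : IsStable S e W) : lower S T e N ≤ W := by
  refine opClosure_le hN ?_
  rintro _ ⟨i, hi, j, hj, rfl⟩ w hw
  exact hW i hi.1 j (hT hj) w hw

theorem lower_mono (S T : Set ℕ) (e : ℕ → ℕ → Module.End ℂ V) : Monotone (lower S T e) :=
  fun _ _ hN => opClosure_le (fun _ hx => subset_opClosure _ _ (hN hx))
    fun _ hf _ hw => opClosure_apply hf hw

/-- The units split into four blocks according to whether row and column lie in `T`. Each remaining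
block preserves `N` or kills it, and its commutator with a lowering operator lies in blocks already
treated. This fixes the order: first `gl(T)` and `gl(S \ T)`, then the raising block, whose
commutators fall in these two. -/
theorem isStable_lower (h : IsWtRep S I e) {T : Set ℕ} (hT : T ⊆ S) (hI : S \ T ⊆ I)
    {N : Submodule ℂ V} (hN : N ≤ glInv S T e) (hs : IsStable T e N) :
    IsStable S e (lower S T e N) := by
  have hlow : ∀ i ∈ S \ T, ∀ j ∈ T, ∀ v ∈ lower S T e N, e i j v ∈ lower S T e N :=
    by
    intro i hi j hj v hv
    refine opClosure_apply ?_ hv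
    exact ⟨i, hi, j, hj, rfl⟩
  have h1 : IsStable T e (lower S T e N) := by
    intro k hk l hl
    refine opClosure_le' (W := (lower S T e N).comap (e k l)) ?_ ?_
    · exact fun v hv => le_lower S T e N (hs k hk l hl v hv)
    · rintro _ ⟨i, hi, j, hj, rfl⟩ v hv hv'
      rw [Submodule.mem_comap] at hv' ⊢
      rw [h.gl k (hT hk) l (hT hl) i hi.1 j (hT hj)]
      refine Submodule.add_mem _ (hlow i hi j hj _ hv') (Submodule.sub_mem _ ?_ ?_)
      · rw [if_neg (ne_of_mem_of_not_mem hl hi.2)]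
        exact Submodule.zero_mem _
      · split_ifs
        · exact hlow i hi l hl v hv
        · exact Submodule.zero_mem _
  have h2 : IsStable (S \ T) e (lower S T e N) := by
    intro k hk l hl
    refine opClosure_le' (W := (lower S T e N).comap (e k l)) ?_ ?_
    · intro v hv
      rw [SetLike.mem_coe, Submodule.mem_comap, hN hv k hk l hl]
      exact Submodule.zero_mem _
    · rintro _ ⟨i, hi, j, hj, rfl⟩ v hv hv'
      rw [Submodule.mem_comap] at hv' ⊢
      rw [h.gl k hk.1 l hl.1 i hi.1 j (hT hj)]
      refine Submodule.add_mem _ (hlow i hi j hj _ hv') (Submodule.sub_mem _ ?_ ?_)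
      · split_ifs
        · exact hlow k hk j hj v hv
        · exact Submodule.zero_mem _
      · rw [if_neg (ne_of_mem_of_not_mem hj hk.2).symm]
        exact Submodule.zero_mem _
  have h3 : ∀ k ∈ T, ∀ l ∈ S \ T, ∀ v ∈ lower S T e N, e k l v ∈ lower S T e N := by
    intro k hk l hl
    refine opClosure_le' (W := (lower S T e N).comap (e k l)) ?_ ?_
    · intro v hv
      have hv' := hN hv
      rw [h.glInv_eq hI] at hv'
      rw [SetLike.mem_coe, Submodule.mem_comap]
      have : e k l v ∈ wtSpan I e ∅ := by
        refine h.apply_mem_wtSpan (hT hk) hl.1 (fun μ hμ μ' h1 h2 h3 => ?_) hv'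
        have h4 := h3 l (hI hl)
        rw [if_pos rfl, if_neg (ne_of_mem_of_not_mem hk hl.2).symm,
          Finsupp.notMem_support_iff.1 fun hc => hl.2 (hμ hc)] at h4
        omega
      simp only [wtSpan, Set.mem_empty_iff_false, false_and, exists_false, Set.ofPred_false,
        Submodule.span_empty, Submodule.mem_bot] at this
      rw [this]
      exact Submodule.zero_mem _
    · rintro _ ⟨i, hi, j, hj, rfl⟩ v hv hv'
      rw [Submodule.mem_comap] at hv' ⊢
      rw [h.gl k (hT hk) l hl.1 i hi.1 j (hT hj)]
      refine Submodule.add_mem _ (hlow i hi j hj _ hv') (Submodule.sub_mem _ ?_ ?_)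
      · split_ifs
        · exact h1 k hk j hj v hv
        · exact Submodule.zero_mem _
      · split_ifs
        · exact h2 i hi l hl v hv
        · exact Submodule.zero_mem _
  intro i hi j hj v hv
  by_cases hiT : i ∈ T <;> by_cases hjT : j ∈ T
  · exact h1 i hiT j hjT v hv
  · exact h3 i hiT j ⟨hj, hjT⟩ v hv
  · exact hlow i ⟨hi, hiT⟩ j hjT v hv
  · exact h2 i ⟨hi, hiT⟩ j ⟨hj, hjT⟩ v hv

/-- The generated subspace has no new invariants. -/
theorem lower_inf_glInv (h : IsWtRep S I e) {T : Set ℕ} (hT : T ⊆ S) (hI : S \ T ⊆ I)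
    {N : Submodule ℂ V} (hN : N ≤ glInv S T e) : lower S T e N ⊓ glInv S T e = N := by
  apply le_antisymm
  · rintro x ⟨hx, hx'⟩
    -- A lowering operator `e i j` with `i ∉ T` creates a unit of weight at `i`, so everything it
    -- produces lies in weight spaces not supported on `T`.
    have key : lower S T e N ≤ N ⊔ wtSpan I e {μ | (μ.support : Set ℕ) ⊆ T}ᶜ := by
      refine opClosure_le (fun x hx => Submodule.mem_sup_left hx) ?_
      rintro _ ⟨i, hi, j, hj, rfl⟩ w hw
      obtain ⟨y, hy, z, hz, rfl⟩ := Submodule.mem_sup.1 hw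
      have key : ∀ v, e i j v ∈ wtSpan I e {μ | (μ.support : Set ℕ) ⊆ T}ᶜ := by
        intro v
        refine h.apply_mem_wtSpan (A := Set.univ) hi.1 (hT hj) (fun μ _ μ' _ _ h3 => ?_)
          (h.top ▸ Submodule.mem_top)
        intro hμ'
        have h4 := h3 i (hI hi)
        rw [if_pos rfl, if_neg (ne_of_mem_of_not_mem hj hi.2).symm,
          Finsupp.notMem_support_iff.1 fun hc => hi.2 (hμ' hc)] at h4
        omega
      exact Submodule.mem_sup_right (key _)
    obtain ⟨y, hy, z, hz, rfl⟩ := Submodule.mem_sup.1 (key hx)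
    have hz' : z ∈ glInv S T e := (Submodule.add_mem_iff_right _ (hN hy)).1 hx'
    rw [h.glInv_eq hI] at hz'
    rw [eq_zero_of_mem_wtSpan disjoint_compl_right hz' hz, add_zero]
    exact hy
  · exact le_inf (le_lower S T e N) hN

/-- A weight vector can be moved into the invariants of `gl(S \ T)` when `T` has enough elements,
without leaving a stable subspace `W` and without entering a stable subspace `W'`. -/
theorem exists_moved (h : IsWtRep S I e) {T : Finset ℕ} (hT : (T : Set ℕ) ⊆ I)
    {W W' : Submodule ℂ V} (hW : ∀ i ∈ I, ∀ j ∈ T, ∀ v ∈ W, e j i v ∈ W)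
    (hW' : ∀ i ∈ I, ∀ j ∈ T, ∀ v ∈ W', e i j v ∈ W')
    {J : Finset ℕ} (hJ : Disjoint T J) (μ : ℕ →₀ ℕ)
    (hμI : (μ.support : Set ℕ) ⊆ I) (hμ : (μ.filter (fun i => i ∉ J)).degree ≤ T.card) {v : V}
    (hv : IsWt I e μ v) (hvW : v ∈ W) (hvW' : v ∉ W') :
    ∃ μ' : ℕ →₀ ℕ, μ'.support ⊆ T ∪ J ∧ (μ'.support : Set ℕ) ⊆ I ∧
      (∀ i ∈ J, μ' i = μ i) ∧ μ'.degree = μ.degree ∧ ∃ v' ∈ W, v' ∉ W' ∧ IsWt I e μ' v' := by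
  classical
  -- Induction on the number of units of weight outside `T ∪ J`; each step moves one of them into
  -- `T`.
  obtain ⟨n, hn⟩ : ∃ n, (μ.filter (fun i => i ∉ T ∪ J)).degree = n := ⟨_, rfl⟩
  induction n generalizing μ v with
  | zero =>
    refine ⟨μ, fun i hi => ?_, hμI, fun _ _ => rfl, rfl, v, hvW, hvW', hv⟩
    by_contra hc
    rw [Finsupp.degree_eq_zero_iff] at hn
    have := DFunLike.congr_fun hn i
    rw [Finsupp.filter_apply_pos (fun i => i ∉ T ∪ J) _ hc] at this
    exact Finsupp.mem_support_iff.1 hi this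
  | succ n ih =>
    obtain ⟨i, hi⟩ : ∃ i, (μ.filter (fun i => i ∉ T ∪ J)) i ≠ 0 := by
      by_contra! hc
      rw [show μ.filter (fun i => i ∉ T ∪ J) = 0 from Finsupp.ext hc] at hn
      simp at hn
    have hi' : i ∉ T ∪ J := by
      by_contra hc
      exact hi (Finsupp.filter_apply_neg (fun i => i ∉ T ∪ J) _ (not_not.2 hc))
    rw [Finsupp.filter_apply_pos (fun i => i ∉ T ∪ J) _ hi'] at hi
    have hiT : i ∉ T := fun h => hi' (Finset.mem_union_left _ h)
    have hiJ : i ∉ J := fun h => hi' (Finset.mem_union_right _ h)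
    have hiI : i ∈ I := hμI (Finsupp.mem_support_iff.2 hi)
    -- Pigeonhole: if all of `T` were occupied, then together with `i` there would be at least
    -- `T.card + 1` units outside `J`.
    obtain ⟨j, hj, hμj⟩ : ∃ j ∈ T, μ j = 0 := by
      by_contra! hc
      have h1 : insert i T ⊆ (μ.filter (fun i => i ∉ J)).support := by
        intro k hk
        rw [Finsupp.support_filter, Finset.mem_filter, Finsupp.mem_support_iff]
        rcases Finset.mem_insert.1 hk with rfl | hk
        · exact ⟨hi, hiJ⟩
        · exact ⟨hc k hk, fun h => Finset.disjoint_left.1 hJ hk h⟩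
      have h2 := Finset.card_le_card h1
      rw [Finset.card_insert_of_notMem hiT] at h2
      have h3 : (μ.filter (fun i => i ∉ J)).support.card ≤ (μ.filter (fun i => i ∉ J)).degree := by
        rw [Finsupp.degree_apply, Finset.card_eq_sum_ones]
        exact Finset.sum_le_sum fun k hk =>
          Nat.one_le_iff_ne_zero.2 (Finsupp.mem_support_iff.1 hk)
      omega
    have hij : i ≠ j := (ne_of_mem_of_not_mem hj hiT).symm
    have hjJ : j ∉ J := fun h => Finset.disjoint_left.1 hJ hj h
    obtain ⟨ν, rfl⟩ : ∃ ν, μ = ν + Finsupp.single i 1 :=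
      ⟨μ - Finsupp.single i 1, (tsub_add_cancel_of_le
        (Finsupp.single_le_iff.2 (Nat.one_le_iff_ne_zero.2 hi))).symm⟩
    have hwt : IsWt I e (ν + Finsupp.single j 1) (e j i v) := by
      refine h.wt_shift (h.sub (hT hj)) (h.sub hiI) (fun k _ => ?_) hv
      simp only [Finsupp.add_apply, Finsupp.single_apply, eq_comm (a := k)]
      omega
    have hI' : ((ν + Finsupp.single j 1).support : Set ℕ) ⊆ I := by
      intro k hk
      rcases Finset.mem_union.1 (Finsupp.support_add hk) with hk | hk
      · refine hμI ?_
        rw [Finset.mem_coe, Finsupp.mem_support_iff, Finsupp.add_apply]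
        rw [Finsupp.mem_support_iff] at hk
        omega
      · rw [Finset.mem_singleton.1 (Finsupp.support_single_subset hk)]
        exact hT hj
    have hdeg : ((ν + Finsupp.single j 1).filter (fun i => i ∉ J)).degree ≤ T.card := by
      rw [Finsupp.filter_add, Finsupp.filter_single_of_pos (fun i => i ∉ J) hiJ] at hμ
      rw [Finsupp.filter_add, Finsupp.filter_single_of_pos (fun i => i ∉ J) hjJ]
      rw [map_add, Finsupp.degree_single] at hμ ⊢
      exact hμ
    -- As `j` is free, `e i j` brings the moved vector back to `μ i • v` with `μ i ≠ 0`, and `W'` is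
    -- stable under `e i j`.
    have hmoved : e j i v ∉ W' := by
      intro hc
      refine hvW' ((W'.smul_mem_iff (Nat.cast_ne_zero (R := ℂ).2 hi)).1 ?_)
      rw [← h.apply_apply hiI (hT hj) hij hv hμj]
      exact hW' i hiI j hj _ hc
    have hout : ((ν + Finsupp.single j 1).filter (fun i => i ∉ T ∪ J)).degree = n := by
      rw [Finsupp.filter_add, Finsupp.filter_single_of_pos (fun i => i ∉ T ∪ J) hi'] at hn
      rw [Finsupp.filter_add, Finsupp.filter_single_of_neg (fun i => i ∉ T ∪ J)
        (not_not.2 (Finset.mem_union_left _ hj)), add_zero]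
      rw [map_add, Finsupp.degree_single] at hn
      exact Nat.succ_injective hn
    obtain ⟨μ', h1, h2, h3, h4, h5⟩ := ih (ν + Finsupp.single j 1) hI' hdeg hwt
      (hW i hiI j hj v hvW) hmoved hout
    refine ⟨μ', h1, h2, fun k hk => ?_, ?_, h5⟩
    · rw [h3 k hk, Finsupp.add_apply, Finsupp.add_apply,
        Finsupp.single_eq_of_ne (ne_of_mem_of_not_mem hk hjJ),
        Finsupp.single_eq_of_ne (ne_of_mem_of_not_mem hk hiJ)]
    · rw [h4, map_add, map_add, Finsupp.degree_single, Finsupp.degree_single]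

end IsWtRep

end Operators

end ParabolicO

namespace ParabolicO

attribute [local instance 100] LieRing.ofAssociativeRing

/-! ### Equivariant maps from tensor powers, as functions on words. -/

section TensorMaps

variable {V : Type*} [AddCommGroup V] [Module ℂ V]

/-- The weight of a word. -/
noncomputable def wordWt {I : Set ℕ} {d : ℕ} (w : Fin d → I) : ℕ →₀ ℕ :=
  ∑ s, Finsupp.single (w s : ℕ) 1

theorem wordWt_apply {I : Set ℕ} {d : ℕ} (w : Fin d → I) (i : ℕ) :
    wordWt w i = ∑ s, if (w s : ℕ) = i then 1 else 0 := by
  simp [wordWt, Finsupp.finsetSum_apply, Finsupp.single_apply]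

theorem degree_wordWt {I : Set ℕ} {d : ℕ} (w : Fin d → I) : (wordWt w).degree = d := by
  simp [wordWt, map_sum]

theorem mem_support_wordWt {I : Set ℕ} {d : ℕ} (w : Fin d → I) {i : ℕ} :
    i ∈ (wordWt w).support ↔ ∃ s, (w s : ℕ) = i := by
  rw [Finsupp.mem_support_iff, wordWt_apply, ne_eq, Finset.sum_eq_zero_iff]
  simp

theorem support_wordWt_subset {I : Set ℕ} {d : ℕ} (w : Fin d → I) :
    ((wordWt w).support : Set ℕ) ⊆ I := by
  intro i hi
  obtain ⟨s, rfl⟩ := (mem_support_wordWt w).1 hi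
  exact (w s).2

/-- A `gl(I)`-equivariant map from the `d`-th tensor power of the tautological module, given by its
values on the words that form the basis of the tensor power. -/
def IsTensorMap (I : Set ℕ) (e : ℕ → ℕ → Module.End ℂ V) (d : ℕ) (f : (Fin d → I) → V) : Prop :=
  ∀ (k l : I) (w : Fin d → I),
    e k l (f w) = ∑ s, if w s = l then f (Function.update w s k) else 0

theorem IsTensorMap.isWt {I : Set ℕ} {e : ℕ → ℕ → Module.End ℂ V} {d : ℕ} {f : (Fin d → I) → V}
    (hf : IsTensorMap I e d f) (w : Fin d → I) : IsWt I e (wordWt w) (f w) := by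
  intro i hi
  rw [hf ⟨i, hi⟩ ⟨i, hi⟩ w, wordWt_apply, Nat.cast_sum, Finset.sum_smul]
  refine Finset.sum_congr rfl fun s _ => ?_
  by_cases h : w s = ⟨i, hi⟩
  · rw [if_pos h, if_pos (congrArg Subtype.val h), ← h, Function.update_eq_self]
    simp
  · rw [if_neg h, if_neg fun h' => h (Subtype.ext h')]
    simp

/-- The span of the values of all equivariant maps from tensor powers. -/
def tensorSpan (I : Set ℕ) (e : ℕ → ℕ → Module.End ℂ V) : Submodule ℂ V :=
  Submodule.span ℂ {v | ∃ (d : ℕ) (f : (Fin d → I) → V) (w : Fin d → I),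
    IsTensorMap I e d f ∧ v = f w}

end TensorMaps

/-! ### Matrix units acting on modules -/

theorem E_mem {S : Set ℕ} {i j : ℕ} (hi : i ∈ S) (hj : j ∈ S) : E i j ∈ gl S :=
  Submodule.subset_span ⟨i, hi, j, hj, rfl⟩

open Classical in
/-- The matrix unit as an element of `gl(S)`; it is `0` when an index is not in `S`. -/
noncomputable def glE (S : Set ℕ) (i j : ℕ) : gl S :=
  if h : i ∈ S ∧ j ∈ S then ⟨E i j, E_mem h.1 h.2⟩ else 0

theorem glE_of_mem {S : Set ℕ} {i j : ℕ} (hi : i ∈ S) (hj : j ∈ S) :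
    glE S i j = ⟨E i j, E_mem hi hj⟩ := dif_pos ⟨hi, hj⟩

theorem coe_glE {S : Set ℕ} {i j : ℕ} (hi : i ∈ S) (hj : j ∈ S) :
    (glE S i j : Module.End ℂ CInf) = E i j := by rw [glE_of_mem hi hj]

theorem gl_induction {S : Set ℕ} {p : gl S → Prop} (hE : ∀ i ∈ S, ∀ j ∈ S, p (glE S i j))
    (h0 : p 0) (hadd : ∀ A B, p A → p B → p (A + B)) (hsmul : ∀ (c : ℂ) A, p A → p (c • A))
    (A : gl S) : p A := by
  obtain ⟨A, hA⟩ := A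
  change A ∈ Submodule.span ℂ _ at hA
  induction hA using Submodule.span_induction with
  | mem x hx =>
    obtain ⟨i, hi, j, hj, rfl⟩ := hx
    have := hE i hi j hj
    rwa [glE_of_mem hi hj] at this
  | zero => exact h0
  | add x y hx hy h1 h2 => exact hadd _ _ h1 h2
  | smul c x hx h1 => exact hsmul c _ h1

theorem glE_lie {S : Set ℕ} {i j k l : ℕ} (hi : i ∈ S) (hj : j ∈ S) (hk : k ∈ S) (hl : l ∈ S) :
    ⁅glE S i j, glE S k l⁆ =
      (if j = k then glE S i l else 0) - if i = l then glE S k j else 0 := by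
  apply Subtype.ext
  rw [LieSubalgebra.coe_bracket, coe_glE hi hj, coe_glE hk hl]
  change E i j * E k l - E k l * E i j = _
  rw [E_mul, E_mul, AddSubgroupClass.coe_sub]
  congr 1
  · split_ifs
    · rw [coe_glE hi hl]
    · rfl
  · by_cases h : i = l
    · rw [if_pos h, if_pos h.symm, coe_glE hk hj]
    · rw [if_neg h, if_neg (Ne.symm h)]
      rfl

/-- The action of the matrix units on a `gl(S)`-module. -/
noncomputable def LieMod.e {S : Set ℕ} (M : LieMod (gl S)) (i j : ℕ) : Module.End ℂ M :=
  LieModule.toEnd ℂ (gl S) M (glE S i j)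

theorem LieMod.e_apply {S : Set ℕ} (M : LieMod (gl S)) (i j : ℕ) (v : M) :
    M.e i j v = ⁅glE S i j, v⁆ := rfl

theorem LieMod.e_of_coe {S : Set ℕ} (M : LieMod (gl S)) {i j : ℕ} (hi : i ∈ S) (hj : j ∈ S)
    {A : gl S} (hA : (A : Module.End ℂ CInf) = E i j) (v : M) : ⁅A, v⁆ = M.e i j v := by
  rw [M.e_apply, show A = glE S i j from Subtype.ext (hA.trans (coe_glE hi hj).symm)]

theorem LieMod.isGlRep {S : Set ℕ} (M : LieMod (gl S)) : IsGlRep S M.e := by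
  intro i hi j hj k hk l hl v
  simp only [M.e_apply]
  rw [leibniz_lie, glE_lie hi hj hk hl, add_comm, sub_lie]
  congr 2 <;> split_ifs <;> simp

theorem LieMod.lie_mem {S : Set ℕ} (M : LieMod (gl S)) {W : Submodule ℂ M}
    (hW : IsStable S M.e W) (A : gl S) {v : M} (hv : v ∈ W) : ⁅A, v⁆ ∈ W := by
  induction A using gl_induction with
  | hE i hi j hj => exact hW i hi j hj v hv
  | h0 => rw [zero_lie]; exact W.zero_mem
  | hadd A B h1 h2 => rw [add_lie]; exact W.add_mem h1 h2
  | hsmul c A h => rw [smul_lie]; exact W.smul_mem c h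

theorem LieMod.map_lie_of_e {S : Set ℕ} {M N : LieMod (gl S)} (f : M →ₗ[ℂ] N)
    (h : ∀ i ∈ S, ∀ j ∈ S, ∀ v, f (M.e i j v) = N.e i j (f v)) (A : gl S) (v : M) :
    f ⁅A, v⁆ = ⁅A, f v⁆ := by
  induction A using gl_induction with
  | hE i hi j hj => exact h i hi j hj v
  | h0 => rw [zero_lie, zero_lie, map_zero]
  | hadd A B h1 h2 => rw [add_lie, add_lie, map_add, h1, h2]
  | hsmul c A h => rw [smul_lie, smul_lie, map_smul, h]

/-- A linear map that commutes with the matrix units, as a homomorphism of modules. -/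
noncomputable def LieMod.homOfE {S : Set ℕ} {M N : LieMod (gl S)} (f : M →ₗ[ℂ] N)
    (h : ∀ i ∈ S, ∀ j ∈ S, ∀ v, f (M.e i j v) = N.e i j (f v)) : M →ₗ⁅ℂ,gl S⁆ N :=
  { f with map_lie' := fun {A v} => LieMod.map_lie_of_e f h A v }

theorem LieMod.hom_e {S : Set ℕ} {M N : LieMod (gl S)} (f : M →ₗ⁅ℂ,gl S⁆ N) (i j : ℕ) (v : M) :
    f (M.e i j v) = N.e i j (f v) := f.map_lie _ _

/-- The submodules of a `gl(S)`-module are the stable subspaces. -/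
noncomputable def LieMod.submoduleOfStable {S : Set ℕ} (M : LieMod (gl S)) (W : Submodule ℂ M)
    (hW : IsStable S M.e W) : LieSubmodule ℂ (gl S) M :=
  { W with lie_mem := fun {A _} hv => M.lie_mem hW A hv }

theorem LieMod.isStable_submodule {S : Set ℕ} (M : LieMod (gl S)) (N : LieSubmodule ℂ (gl S) M) :
    IsStable S M.e (N : Submodule ℂ M) := fun _ _ _ _ _ hv => N.lie_mem hv

theorem resGl_e {T S : Set ℕ} (h : T ⊆ S) (M : LieMod (gl S)) {i j : ℕ} (hi : i ∈ T)
    (hj : j ∈ T) (v : M) : (resGl h M).e i j v = M.e i j v := by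
  change ⁅LieSubalgebra.inclusion (gl_mono h) (glE T i j), (v : M)⁆ = _
  exact M.e_of_coe (h hi) (h hj) (A := LieSubalgebra.inclusion (gl_mono h) (glE T i j))
    (coe_glE hi hj) v

/-! ### Tensor powers of the tautological module -/

/-- The basis of the tautological module. -/
noncomputable def tautBasis (S : Set ℕ) : Module.Basis S ℂ (taut S) :=
  Module.Basis.ofRepr (Finsupp.supportedEquivFinsupp S)

theorem coe_tautBasis {S : Set ℕ} (i : S) :
    (tautBasis S i : CInf) = Finsupp.single (i : ℕ) 1 := by
  have : tautBasis S i = (⟨Finsupp.single (i : ℕ) 1, Finsupp.single_mem_supported ℂ _ i.2⟩ :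
      Finsupp.supported ℂ ℂ S) := by
    apply (Finsupp.supportedEquivFinsupp S).injective
    erw [LinearEquiv.apply_symm_apply]
    ext j
    simp [Finsupp.single_apply, Subtype.ext_iff]
  rw [this]

theorem taut_e {S : Set ℕ} (k l i : S) :
    (taut S).e k l (tautBasis S i) = if i = l then tautBasis S k else 0 := by
  apply Subtype.ext
  change (glE S k l : Module.End ℂ CInf) (tautBasis S i : CInf) = _
  rw [coe_glE k.2 l.2, coe_tautBasis]
  split_ifs with h
  · rw [coe_tautBasis, h]
    simp [E]
  · have : (i : ℕ) ≠ l := fun h' => h (Subtype.ext h')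
    simp [E, this]

/-- The basis of the tensor power, indexed by words. -/
noncomputable def tensorBasis (S : Set ℕ) :
    ∀ d : ℕ, Module.Basis (Fin d → S) ℂ ((taut S).tensorPow d)
  | 0 => (Module.Basis.singleton (Fin 0 → S) ℂ : Module.Basis (Fin 0 → S) ℂ ℂ)
  | d + 1 => ((tautBasis S).tensorProduct (tensorBasis S d) : Module.Basis _ ℂ
      ((taut S) ⊗[ℂ] ((taut S).tensorPow d))).reindex (Fin.consEquiv fun _ => S)

theorem isTensorMap_tensorBasis (S : Set ℕ) (d : ℕ) :
    IsTensorMap S ((taut S).tensorPow d).e d (tensorBasis S d) := by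
  induction d with
  | zero =>
    intro k l w
    rw [Finset.univ_eq_empty, Finset.sum_empty]
    rfl
  | succ d ih =>
    intro k l w
    have hb : ∀ (i : S) (w : Fin d → S), tensorBasis S (d + 1) (Fin.cons i w) =
        (tautBasis S i ⊗ₜ[ℂ] tensorBasis S d w : (taut S) ⊗[ℂ] ((taut S).tensorPow d)) := by
      intro i w
      change (((tautBasis S).tensorProduct (tensorBasis S d)).reindex (Fin.consEquiv fun _ => S))
        (Fin.cons i w) = _
      rw [Module.Basis.reindex_apply]
      have : (Fin.consEquiv fun _ => S).symm (Fin.cons i w) = (i, w) :=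
        (Equiv.symm_apply_eq _).2 rfl
      erw [this, Module.Basis.tensorProduct_apply]
    obtain ⟨i, w, rfl⟩ : ∃ i w', w = Fin.cons i w' := ⟨w 0, Fin.tail w, (Fin.cons_self_tail w).symm⟩
    rw [hb, Fin.sum_univ_succ]
    change ⁅glE S k l, (tautBasis S i ⊗ₜ[ℂ] tensorBasis S d w :
      (taut S) ⊗[ℂ] ((taut S).tensorPow d))⁆ = _
    rw [TensorProduct.LieModule.lie_tmul_right]
    have h1 := taut_e k l i
    have h2 := ih k l w
    rw [LieMod.e_apply] at h1 h2
    erw [h1, h2]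
    congr 1
    · simp only [Fin.cons_zero, Fin.update_cons_zero]
      split_ifs
      · exact (hb _ _).symm
      · exact TensorProduct.zero_tmul _ _
    · rw [TensorProduct.tmul_sum]
      refine Finset.sum_congr rfl fun s _ => ?_
      simp only [Fin.cons_succ, ← Fin.cons_update]
      split_ifs
      · exact (hb _ _).symm
      · exact TensorProduct.tmul_zero _ _

theorem IsTensorMap.comp {S : Set ℕ} {M N : LieMod (gl S)} {d : ℕ} {f : (Fin d → S) → M}
    (hf : IsTensorMap S M.e d f) (φ : M →ₗ⁅ℂ,gl S⁆ N) :
    IsTensorMap S N.e d (fun w => φ (f w)) := by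
  intro k l w
  rw [← LieMod.hom_e, hf k l w, map_sum]
  refine Finset.sum_congr rfl fun s _ => ?_
  split_ifs <;> simp

/-- The homomorphism given by its values on words. -/
noncomputable def IsTensorMap.hom {S : Set ℕ} {N : LieMod (gl S)} {d : ℕ} {f : (Fin d → S) → N}
    (hf : IsTensorMap S N.e d f) : (taut S).tensorPow d →ₗ⁅ℂ,gl S⁆ N :=
  LieMod.homOfE ((tensorBasis S d).constr ℂ f) (by
    intro k hk l hl v
    suffices h : (tensorBasis S d).constr ℂ f ∘ₗ ((taut S).tensorPow d).e k l =
        N.e k l ∘ₗ (tensorBasis S d).constr ℂ f from LinearMap.congr_fun h v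
    refine (tensorBasis S d).ext fun w => ?_
    rw [LinearMap.comp_apply, LinearMap.comp_apply]
    rw [isTensorMap_tensorBasis S d ⟨k, hk⟩ ⟨l, hl⟩ w, Module.Basis.constr_basis,
      hf ⟨k, hk⟩ ⟨l, hl⟩ w, map_sum]
    refine Finset.sum_congr rfl fun s _ => ?_
    split_ifs
    · rw [Module.Basis.constr_basis]
    · rw [map_zero])

theorem IsTensorMap.hom_basis {S : Set ℕ} {N : LieMod (gl S)} {d : ℕ} {f : (Fin d → S) → N}
    (hf : IsTensorMap S N.e d f) (w : Fin d → S) : hf.hom (tensorBasis S d w) = f w :=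
  Module.Basis.constr_basis _ _ _ _

end ParabolicO

namespace ParabolicO

attribute [local instance 100] LieRing.ofAssociativeRing

/-! ### Semisimplicity of the tensor powers -/

section HermitianForm

variable {V κ : Type*} [AddCommGroup V] [Module ℂ V]

/-- The hermitian form for which the given basis is orthonormal. -/
noncomputable def hermForm (b : Module.Basis κ ℂ V) (x y : V) : ℂ :=
  (b.repr y).sum fun w a => star (b.repr x w) * a

variable (b : Module.Basis κ ℂ V)

theorem hermForm_add_right (x y z : V) :
    hermForm b x (y + z) = hermForm b x y + hermForm b x z := by
  rw [hermForm, map_add, Finsupp.sum_add_index' (by simp) (by intros; ring)]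
  rfl

theorem hermForm_smul_right (x y : V) (c : ℂ) :
    hermForm b x (c • y) = c * hermForm b x y := by
  rw [hermForm, map_smul, Finsupp.sum_smul_index (by simp), hermForm, Finsupp.mul_sum]
  exact Finsupp.sum_congr fun _ _ => by ring

theorem hermForm_add_left (x y z : V) :
    hermForm b (x + y) z = hermForm b x z + hermForm b y z := by
  rw [hermForm, hermForm, hermForm, ← Finsupp.sum_add]
  exact Finsupp.sum_congr fun _ _ => by simp [add_mul]

theorem hermForm_smul_left (x y : V) (c : ℂ) :
    hermForm b (c • x) y = star c * hermForm b x y := by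
  rw [hermForm, hermForm, Finsupp.mul_sum]
  exact Finsupp.sum_congr fun _ _ => by simp [mul_assoc]

theorem hermForm_zero_left (y : V) : hermForm b 0 y = 0 := by simp [hermForm]

theorem hermForm_zero_right (x : V) : hermForm b x 0 = 0 := by simp [hermForm]

theorem hermForm_basis [DecidableEq κ] (v w : κ) :
    hermForm b (b v) (b w) = if v = w then 1 else 0 := by
  rw [hermForm, b.repr_self, b.repr_self, Finsupp.sum_single_index (by simp), Finsupp.single_apply]
  split_ifs <;> simp

theorem hermForm_sum_left {ι : Type*} (s : Finset ι) (x : ι → V) (y : V) :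
    hermForm b (∑ i ∈ s, x i) y = ∑ i ∈ s, hermForm b (x i) y := by
  classical
  induction s using Finset.induction_on with
  | empty => simp [hermForm_zero_left]
  | insert i s hi ih => rw [Finset.sum_insert hi, Finset.sum_insert hi, hermForm_add_left, ih]

theorem hermForm_sum_right {ι : Type*} (s : Finset ι) (x : V) (y : ι → V) :
    hermForm b x (∑ i ∈ s, y i) = ∑ i ∈ s, hermForm b x (y i) := by
  classical
  induction s using Finset.induction_on with
  | empty => simp [hermForm_zero_right]
  | insert i s hi ih => rw [Finset.sum_insert hi, Finset.sum_insert hi, hermForm_add_right, ih]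

theorem eq_zero_of_hermForm_self {x : V} (h : hermForm b x x = 0) : x = 0 := by
  have h1 : ∑ w ∈ (b.repr x).support, ‖b.repr x w‖ ^ 2 = 0 := by
    have h2 : ((∑ w ∈ (b.repr x).support, ‖b.repr x w‖ ^ 2 : ℝ) : ℂ) = 0 := by
      rw [← h, hermForm, Finsupp.sum, Complex.ofReal_sum]
      exact Finset.sum_congr rfl fun w _ => by
        rw [Complex.ofReal_pow]
        exact (Complex.conj_mul' _).symm
    exact_mod_cast h2
  rw [Finset.sum_eq_zero_iff_of_nonneg fun _ _ => by positivity] at h1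
  apply b.repr.injective
  rw [map_zero]
  ext w
  by_cases hw : w ∈ (b.repr x).support
  · simpa using h1 w hw
  · simpa using hw

/-- Operators that are adjoint on the basis are adjoint. -/
theorem hermForm_adjoint {f g : Module.End ℂ V}
    (h : ∀ v w, hermForm b (f (b v)) (b w) = hermForm b (b v) (g (b w))) (x y : V) :
    hermForm b (f x) y = hermForm b x (g y) := by
  have hx : x ∈ Submodule.span ℂ (Set.range b) := b.span_eq ▸ Submodule.mem_top
  have hy : y ∈ Submodule.span ℂ (Set.range b) := b.span_eq ▸ Submodule.mem_top
  induction hx, hy using Submodule.span_induction₂ with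
  | mem_mem x y hx hy =>
    obtain ⟨v, rfl⟩ := hx
    obtain ⟨w, rfl⟩ := hy
    exact h v w
  | zero_left y hy => simp [hermForm_zero_left]
  | zero_right x hx => simp [hermForm_zero_right]
  | add_left x y z _ _ _ h1 h2 => rw [map_add, hermForm_add_left, hermForm_add_left, h1, h2]
  | add_right x y z _ _ _ h1 h2 => rw [map_add, hermForm_add_right, hermForm_add_right, h1, h2]
  | smul_left r x y _ _ h => rw [map_smul, hermForm_smul_left, hermForm_smul_left, h]
  | smul_right r x y _ _ h => rw [map_smul, hermForm_smul_right, hermForm_smul_right, h]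

/-- The orthogonal complement of a subspace. -/
noncomputable def hermPerp (W : Submodule ℂ V) : Submodule ℂ V where
  carrier := {y | ∀ x ∈ W, hermForm b x y = 0}
  zero_mem' := fun x _ => hermForm_zero_right b x
  add_mem' := fun {y z} hy hz x hx => by rw [hermForm_add_right, hy x hx, hz x hx, add_zero]
  smul_mem' := fun c y hy x hx => by rw [hermForm_smul_right, hy x hx, mul_zero]

/-- The part of a vector that is supported on a finite set of basis vectors. -/
noncomputable def truncate (K : Finset κ) (x : V) : V := ∑ w ∈ K, b.repr x w • b w

theorem repr_truncate [DecidableEq κ] (K : Finset κ) (x : V) (w : κ) :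
    b.repr (truncate b K x) w = if w ∈ K then b.repr x w else 0 := by
  simp [truncate, Finsupp.single_apply]

/-- Orthogonal decomposition, for subspaces that are stable under truncation. -/
theorem exists_sub_mem_hermPerp {W : Submodule ℂ V} {K : Finset κ}
    (hW : ∀ x ∈ W, truncate b K x ∈ W) {x : V} (hx : truncate b K x = x) :
    ∃ y ∈ W, x - y ∈ hermPerp b W := by
  classical
  let π : V →ₗ[ℂ] EuclideanSpace ℂ K :=
    (WithLp.linearEquiv 2 ℂ (K → ℂ)).symm.toLinearMap ∘ₗ
      LinearMap.pi fun w : K => b.coord w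
  have hπ : ∀ z w, π z w = b.repr z w := fun z w => rfl
  obtain ⟨p, hp, q, hq, hpq⟩ := Submodule.exists_add_mem_mem_orthogonal (K := W.map π) (π x)
  obtain ⟨y, hy, rfl⟩ := hp
  have hy' : π (truncate b K y) = π y := by
    ext w
    rw [hπ, hπ, repr_truncate, if_pos w.2]
  refine ⟨truncate b K y, hW y hy, fun z hz => ?_⟩
  -- The form on all of `V` agrees with the inner product of the coordinates in `K`, since the
  -- second argument is supported on `K`. So the orthogonal projection in a finite-dimensional space
  -- can be used.
  have h1 : hermForm b z (x - truncate b K y) = inner ℂ (π z) (π (x - truncate b K y)) := by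
    rw [PiLp.inner_apply, hermForm, Finsupp.sum_of_support_subset (s := K)]
    · rw [← Finset.sum_coe_sort]
      refine Finset.sum_congr rfl fun w _ => ?_
      rw [hπ, hπ, RCLike.inner_apply]
      exact mul_comm _ _
    · intro w hw
      by_contra hwK
      rw [Finsupp.mem_support_iff, map_sub, Finsupp.sub_apply, ← hx, repr_truncate, repr_truncate,
        if_neg hwK, if_neg hwK] at hw
      simp at hw
    · simp
  rw [h1, map_sub, hy', hpq, add_sub_cancel_left]
  exact hq (π z) (Submodule.mem_map_of_mem hz)

end HermitianForm

/-- On words the two sides agree position by position: changing the letter `l` of `v` at `s` into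
`k` gives `w` exactly when changing the letter `k` of `w` at `s` into `l` gives `v`. -/
theorem tensorPow_adjoint {S : Set ℕ} {d : ℕ} (k l : S) (x y : (taut S).tensorPow d) :
    hermForm (tensorBasis S d) (((taut S).tensorPow d).e k l x) y =
      hermForm (tensorBasis S d) x (((taut S).tensorPow d).e l k y) := by
  classical
  refine hermForm_adjoint _ (fun v w => ?_) x y
  rw [isTensorMap_tensorBasis, isTensorMap_tensorBasis, hermForm_sum_left, hermForm_sum_right]
  refine Finset.sum_congr rfl fun s _ => ?_
  have : ∀ (v w : Fin d → S) (k l : S), (v s = l ∧ Function.update v s k = w) →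
      (w s = k ∧ v = Function.update w s l) := by
    rintro v w k l ⟨rfl, rfl⟩
    simp
  have h1 := this v w k l
  have h2 := this w v l k
  split_ifs with h3 h4 h4
  · rw [hermForm_basis, hermForm_basis]
    exact if_congr ⟨fun h => (h1 ⟨h3, h⟩).2, fun h => (h2 ⟨h4, h.symm⟩).2.symm⟩ rfl rfl
  · rw [hermForm_basis, hermForm_zero_right, if_neg fun h => h4 (h1 ⟨h3, h⟩).1]
  · rw [hermForm_basis, hermForm_zero_left, if_neg fun h => h3 (h2 ⟨h4, h.symm⟩).1]
  · rw [hermForm_zero_left, hermForm_zero_right]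

theorem tensorPow_top (S : Set ℕ) (d : ℕ) :
    wtSpan S ((taut S).tensorPow d).e {μ | μ.degree = d} = ⊤ := by
  rw [eq_top_iff, ← (tensorBasis S d).span_eq, Submodule.span_le]
  rintro _ ⟨w, rfl⟩
  exact ((isTensorMap_tensorBasis S d).isWt w).mem_wtSpan (degree_wordWt w)
    (support_wordWt_subset w)

/-- The orthogonal complement is stable by adjointness. In infinite dimension it need not be a
complement for an arbitrary subspace; for a stable one it is, because weights allow truncation to
finitely many words. -/
theorem tensorPow_exists_isCompl {S : Set ℕ} {d : ℕ} {W : Submodule ℂ ((taut S).tensorPow d)}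
    (hW : IsStable S ((taut S).tensorPow d).e W) :
    ∃ W', IsStable S ((taut S).tensorPow d).e W' ∧ IsCompl W W' := by
  classical
  set b := tensorBasis S d with hb
  refine ⟨hermPerp b W, fun k hk l hl y hy x hx => ?_, ?_, ?_⟩
  · rw [← tensorPow_adjoint ⟨l, hl⟩ ⟨k, hk⟩]
    exact hy _ (hW l hl k hk x hx)
  · rw [Submodule.disjoint_def]
    exact fun x hx hx' => eq_zero_of_hermForm_self b (hx' x hx)
  · rw [codisjoint_iff, eq_top_iff]
    intro x _
    -- `T` is the set of letters occurring in `x`, and `K` consists of all words in these letters.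
    -- Membership in `K` depends only on the weight, so truncation to `K` is a sum of weight
    -- projections and preserves `W`.
    let T : Finset S := (b.repr x).support.biUnion fun w => Finset.univ.image w
    let K : Finset (Fin d → S) := Fintype.piFinset fun _ => T
    have hK : ∀ w : Fin d → S, w ∈ K ↔
        wordWt w ∈ {μ : ℕ →₀ ℕ | (μ.support : Set ℕ) ⊆ Subtype.val '' (T : Set S)} := by
      intro w
      rw [Fintype.mem_piFinset]
      constructor
      · intro h i hi
        obtain ⟨s, rfl⟩ := (mem_support_wordWt w).1 hi
        exact ⟨w s, h s, rfl⟩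
      · intro h s
        obtain ⟨j, hj, hjs⟩ := h ((mem_support_wordWt w).2 ⟨s, rfl⟩)
        exact Subtype.ext hjs ▸ hj
    have htr : ∀ y ∈ W, truncate b K y ∈ W := by
      intro y hy
      refine mem_of_add_mem (I := S) (e := ((taut S).tensorPow d).e) (hW.diag subset_rfl)
        (A := {μ : ℕ →₀ ℕ | (μ.support : Set ℕ) ⊆ Subtype.val '' (T : Set S)})
        (B := {μ : ℕ →₀ ℕ | (μ.support : Set ℕ) ⊆ Subtype.val '' (T : Set S)}ᶜ)
        disjoint_compl_right (b := ∑ w ∈ (b.repr y).support \ K, b.repr y w • b w) ?_ ?_ ?_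
      · refine Submodule.sum_mem _ fun w hw => Submodule.smul_mem _ _ ?_
        exact ((isTensorMap_tensorBasis S d).isWt w).mem_wtSpan ((hK w).1 hw)
          (support_wordWt_subset w)
      · refine Submodule.sum_mem _ fun w hw => Submodule.smul_mem _ _ ?_
        exact ((isTensorMap_tensorBasis S d).isWt w).mem_wtSpan
          (fun h => (Finset.mem_sdiff.1 hw).2 ((hK w).2 h)) (support_wordWt_subset w)
      · convert hy
        rw [truncate, add_comm, ← Finset.sum_union Finset.sdiff_disjoint,
          Finset.sdiff_union_self_eq_union]
        conv_rhs => rw [← b.linearCombination_repr y, Finsupp.linearCombination_apply]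
        rw [Finsupp.sum_of_support_subset _ Finset.subset_union_left _ (by simp)]
    have hx : truncate b K x = x := by
      apply b.repr.injective
      ext w
      rw [repr_truncate]
      split_ifs with h
      · rfl
      · by_contra hc
        refine h (Fintype.mem_piFinset.2 fun s => Finset.mem_biUnion.2 ⟨w, ?_, ?_⟩)
        · exact Finsupp.mem_support_iff.2 (Ne.symm hc)
        · exact Finset.mem_image_of_mem _ (Finset.mem_univ s)
    obtain ⟨y, hy, hxy⟩ := exists_sub_mem_hermPerp b htr hx
    exact Submodule.mem_sup.2 ⟨y, hy, _, hxy, by abel⟩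

end ParabolicO

namespace ParabolicO

attribute [local instance 100] LieRing.ofAssociativeRing

/-! ### Modules over a Lie algebra as modules over a ring -/

section FreeAlgebraModule

variable {L : Type} [LieRing L] [LieAlgebra ℂ L]

/-- The free algebra on the elements of `L` acts on every `L`-module. -/
noncomputable instance LieMod.freeModule (M : LieMod L) : Module (FreeAlgebra ℂ L) M :=
  Module.compHom M (FreeAlgebra.lift ℂ fun A : L => LieModule.toEnd ℂ L M A).toRingHom

theorem LieMod.ι_smul (M : LieMod L) (A : L) (v : M) :
    FreeAlgebra.ι ℂ A • v = ⁅A, v⁆ := by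
  change (FreeAlgebra.lift ℂ fun A : L => LieModule.toEnd ℂ L M A) (FreeAlgebra.ι ℂ A) v = _
  rw [FreeAlgebra.lift_ι_apply]
  rfl

theorem LieMod.algebraMap_smul (M : LieMod L) (c : ℂ) (v : M) :
    algebraMap ℂ (FreeAlgebra ℂ L) c • v = c • v := by
  change (FreeAlgebra.lift ℂ fun A : L => LieModule.toEnd ℂ L M A) (algebraMap _ _ c) v = _
  rw [AlgHom.commutes]
  rfl

/-- Submodules for the free algebra. -/
noncomputable def LieMod.freeSubmodule (M : LieMod L) (W : Submodule ℂ M)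
    (hW : ∀ (A : L), ∀ v ∈ W, ⁅A, v⁆ ∈ W) : Submodule (FreeAlgebra ℂ L) M :=
  { W with
    smul_mem' := by
      intro r v hv
      induction r using FreeAlgebra.induction generalizing v with
      | grade0 c => rw [M.algebraMap_smul]; exact W.smul_mem c hv
      | grade1 A => rw [M.ι_smul]; exact hW A v hv
      | mul a b ha hb => rw [mul_smul]; exact ha (hb hv)
      | add a b ha hb => rw [add_smul]; exact W.add_mem (ha hv) (hb hv) }

/-- Submodules for the free algebra are submodules for `L`. -/
noncomputable def LieMod.ofFreeSubmodule (M : LieMod L) (W : Submodule (FreeAlgebra ℂ L) M) :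
    LieSubmodule ℂ L M where
  carrier := W
  zero_mem' := W.zero_mem
  add_mem' := W.add_mem
  smul_mem' := fun c v hv => by
    have := W.smul_mem (algebraMap ℂ (FreeAlgebra ℂ L) c) hv
    rwa [M.algebraMap_smul] at this
  lie_mem := fun {A v} hv => by
    have := W.smul_mem (FreeAlgebra.ι ℂ A) hv
    rwa [M.ι_smul] at this

/-- Homomorphisms of `L`-modules are linear over the free algebra. -/
noncomputable def LieMod.freeHom {M N : LieMod L} (f : M →ₗ⁅ℂ,L⁆ N) :
    M →ₗ[FreeAlgebra ℂ L] N :=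
  { toFun := f
    map_add' := f.map_add
    map_smul' := by
      intro r v
      rw [RingHom.id_apply]
      induction r using FreeAlgebra.induction generalizing v with
      | grade0 c => rw [M.algebraMap_smul, N.algebraMap_smul]; exact f.map_smul c v
      | grade1 A => rw [M.ι_smul, N.ι_smul, f.map_lie]
      | mul a b ha hb => rw [mul_smul, ha, hb, mul_smul]
      | add a b ha hb => rw [add_smul, add_smul, ← ha, ← hb]; exact f.map_add _ _ }

/-- Both kinds of submodules form the same lattice. -/
noncomputable def LieMod.freeOrderIso (M : LieMod L) :
    Submodule (FreeAlgebra ℂ L) M ≃o LieSubmodule ℂ L M where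
  toFun := M.ofFreeSubmodule
  invFun W := M.freeSubmodule W fun _ _ hv => W.lie_mem hv
  left_inv _ := rfl
  right_inv _ := rfl
  map_rel_iff' := Iff.rfl

/-- Linear maps over the free algebra are homomorphisms of `L`-modules. -/
noncomputable def LieMod.ofFreeHom {M N : LieMod L} (f : M →ₗ[FreeAlgebra ℂ L] N) :
    M →ₗ⁅ℂ,L⁆ N :=
  { toFun := f
    map_add' := f.map_add
    map_smul' := fun c v => by
      rw [← M.algebraMap_smul, f.map_smul, N.algebraMap_smul]
      rfl
    map_lie' := fun {A v} => by
      rw [← M.ι_smul, f.map_smul, N.ι_smul] }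

end FreeAlgebraModule

theorem isSemisimpleModule_tensorPow (S : Set ℕ) (d : ℕ) :
    IsSemisimpleModule (FreeAlgebra ℂ (gl S)) ((taut S).tensorPow d) := by
  rw [isSemisimpleModule_iff]
  refine ⟨fun W => ?_⟩
  let N := ((taut S).tensorPow d).ofFreeSubmodule W
  obtain ⟨W', h1, h2⟩ := tensorPow_exists_isCompl
    (((taut S).tensorPow d).isStable_submodule N)
  refine ⟨((taut S).tensorPow d).freeSubmodule W' fun A v hv => LieMod.lie_mem _ h1 A hv, ?_, ?_⟩
  · rw [Submodule.disjoint_def]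
    exact fun x hx hx' => Submodule.disjoint_def.1 h2.1 x hx hx'
  · rw [codisjoint_iff, eq_top_iff]
    intro x _
    obtain ⟨y, hy, z, hz, h⟩ := Submodule.mem_sup.1
      (show x ∈ (N : Submodule ℂ _) ⊔ W' from (codisjoint_iff.1 h2.2).symm ▸ Submodule.mem_top)
    exact Submodule.mem_sup.2 ⟨y, hy, z, hz, h⟩

/-! ### Modules spanned by the images of tensor powers are the ind-polynomial ones. -/

section TensorSpanned

variable {S : Set ℕ} (M : LieMod (gl S))

/-- Homomorphisms from tensor powers. -/
abbrev TensorHom : Type := Σ d : ℕ, (taut S).tensorPow d →ₗ⁅ℂ,gl S⁆ M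

variable {M}

theorem exists_tensorHom_ne_zero (h : tensorSpan S M.e = ⊤) {N : Type*} [AddCommGroup N]
    [Module (FreeAlgebra ℂ (gl S)) N] (g : M →ₗ[FreeAlgebra ℂ (gl S)] N) (hg : g ≠ 0) :
    ∃ φ : TensorHom M, g ∘ₗ LieMod.freeHom φ.2 ≠ 0 := by
  by_contra! hc
  apply hg
  ext v
  have hv : v ∈ tensorSpan S M.e := h ▸ Submodule.mem_top
  induction hv using Submodule.span_induction with
  | mem v hv =>
    obtain ⟨d, f, w, hf, rfl⟩ := hv
    have := LinearMap.congr_fun (hc ⟨d, hf.hom⟩) (tensorBasis S d w)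
    rw [← hf.hom_basis]
    exact this
  | zero => exact g.map_zero
  | add x y _ _ hx hy => rw [map_add, hx, hy]; exact (add_zero _)
  | smul c x _ hx =>
    rw [← M.algebraMap_smul, map_smul, hx]
    exact smul_zero _

/-- The module is the sum of images of semisimple modules; otherwise the quotient by that sum would
be a non-zero map vanishing on all tensor powers. -/
theorem isSemisimpleModule_of_tensorSpan (h : tensorSpan S M.e = ⊤) :
    IsSemisimpleModule (FreeAlgebra ℂ (gl S)) M := by
  refine isSemisimpleModule_of_isSemisimpleModule_submodule'
    (p := fun φ : TensorHom M => LinearMap.range (LieMod.freeHom φ.2)) (fun φ => ?_) ?_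
  · have := isSemisimpleModule_tensorPow S φ.1
    exact IsSemisimpleModule.range _
  · by_contra hc
    have hne : (Submodule.mkQ (⨆ φ : TensorHom M, LinearMap.range (LieMod.freeHom φ.2))) ≠ 0 := by
      intro h0
      apply hc
      rw [← Submodule.ker_mkQ (⨆ φ : TensorHom M, LinearMap.range (LieMod.freeHom φ.2)), h0,
        LinearMap.ker_zero]
    obtain ⟨φ, hφ⟩ := exists_tensorHom_ne_zero h _ hne
    apply hφ
    ext x
    simp only [LinearMap.comp_apply, LinearMap.zero_apply, Submodule.mkQ_apply,
      Submodule.Quotient.mk_eq_zero]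
    exact Submodule.mem_iSup_of_mem φ (LinearMap.mem_range_self _ x)

/-- Stable subspaces have stable complements. -/
theorem exists_isCompl_of_tensorSpan (h : tensorSpan S M.e = ⊤) {W : Submodule ℂ M}
    (hW : IsStable S M.e W) : ∃ W', IsStable S M.e W' ∧ IsCompl W W' := by
  have := isSemisimpleModule_of_tensorSpan h
  obtain ⟨W', h2⟩ := exists_isCompl (M.freeSubmodule W fun A v hv => M.lie_mem hW A hv)
  refine ⟨M.ofFreeSubmodule W', M.isStable_submodule _, ?_, ?_⟩
  · rw [Submodule.disjoint_def]
    exact fun x hx hx' => Submodule.disjoint_def.1 h2.1 x hx hx'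
  · rw [codisjoint_iff, eq_top_iff]
    intro x _
    obtain ⟨y, hy, z, hz, h⟩ := Submodule.mem_sup.1
      (show x ∈ (M.freeSubmodule W _) ⊔ W' from
        (codisjoint_iff.1 h2.2).symm ▸ Submodule.mem_top)
    exact Submodule.mem_sup.2 ⟨y, hy, z, hz, h⟩

/-- A simple module that is spanned by images of tensor powers is polynomial. -/
theorem isPoly_of_retract {N : LieMod (gl S)} {d : ℕ}
    (a : N →ₗ[FreeAlgebra ℂ (gl S)] (taut S).tensorPow d)
    (b : (taut S).tensorPow d →ₗ[FreeAlgebra ℂ (gl S)] N) (hab : ∀ x, b (a x) = x) : IsPoly N :=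
  ⟨1, fun _ => d,
    (DirectSum.lieModuleOf ℂ (Fin 1) (gl S) (fun _ => (taut S).tensorPow d) 0).comp
      (LieMod.ofFreeHom a),
    (LieMod.ofFreeHom b).comp
      (DirectSum.lieModuleComponent ℂ (Fin 1) (gl S) (fun _ => (taut S).tensorPow d) 0),
    fun x => by
      refine Eq.trans ?_ (hab x)
      exact congrArg b (DirectSum.of_eq_same (β := fun _ : Fin 1 => (taut S).tensorPow d) 0 (a x))⟩

/-- The module `N` is a copy of the simple submodule `m`; the injection `f` carries it across the
two notions of submodule. -/
theorem isPoly_of_isSimpleModule (h : tensorSpan S M.e = ⊤)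
    (m : Submodule (FreeAlgebra ℂ (gl S)) M) [IsSimpleModule (FreeAlgebra ℂ (gl S)) m]
    {N : LieMod (gl S)} (f : N →ₗ⁅ℂ,gl S⁆ M) (hf : Function.Injective f)
    (hm : ∀ x, x ∈ m ↔ ∃ y, f y = x) : IsPoly N := by
  have hss := isSemisimpleModule_of_tensorSpan h
  let i : m ≃ₗ[FreeAlgebra ℂ (gl S)] N := (LinearEquiv.ofBijective
    ((LieMod.freeHom f).codRestrict m fun y => (hm _).2 ⟨y, rfl⟩)
    ⟨fun x y hxy => hf (congrArg Subtype.val hxy),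
      fun x => ((hm x).1 x.2).imp fun y hy => Subtype.ext hy⟩).symm
  have hNs : IsSimpleModule (FreeAlgebra ℂ (gl S)) N := IsSimpleModule.congr i.symm
  obtain ⟨m', hm'⟩ := exists_isCompl m
  let π : M →ₗ[FreeAlgebra ℂ (gl S)] N := i.toLinearMap ∘ₗ m.projectionOnto m' hm'
  have hπ : π ≠ 0 := by
    intro h0
    have := IsSimpleModule.nontrivial (FreeAlgebra ℂ (gl S)) N
    obtain ⟨x, hx⟩ := exists_ne (0 : N)
    apply hx
    have h1 : π (i.symm x) = x :=
      (congrArg i (Submodule.projectionOnto_apply_left hm' (i.symm x))).trans (i.apply_symm_apply x)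
    rw [← h1, h0, LinearMap.zero_apply]
  -- The projection to `N` is non-zero on some tensor power, hence onto because `N` is simple, and
  -- the surjection splits because the tensor power is semisimple.
  obtain ⟨φ, hφ⟩ := exists_tensorHom_ne_zero h π hπ
  have := isSemisimpleModule_tensorPow S φ.1
  obtain ⟨a, ha⟩ := IsSemisimpleModule.lifting_property (π ∘ₗ LieMod.freeHom φ.2)
    (LinearMap.surjective_of_ne_zero hφ) (LinearMap.id (M := N))
  exact isPoly_of_retract a (π ∘ₗ LieMod.freeHom φ.2) (LinearMap.congr_fun ha)

theorem isIndPoly_of_tensorSpan (h : tensorSpan S M.e = ⊤) : IsIndPoly M := by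
  have hss := isSemisimpleModule_of_tensorSpan h
  obtain ⟨s, hs1, hs2, hs3⟩ := IsSemisimpleModule.exists_sSupIndep_sSup_simples_eq_top
    (FreeAlgebra ℂ (gl S)) M
  refine ⟨s, fun m => M.freeOrderIso m, ?_, ?_, fun m => ?_⟩
  · exact (iSupIndep_map_orderIso_iff M.freeOrderIso).2 ((sSupIndep_iff s).1 hs1)
  · rw [← M.freeOrderIso.map_iSup, ← sSup_eq_iSup', hs2, OrderIso.map_top]
  · have := hs3 m m.2
    exact isPoly_of_isSimpleModule h m.1 (M.ofFreeSubmodule m.1).incl Subtype.val_injective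
      fun x => ⟨fun hx => ⟨⟨x, hx⟩, rfl⟩, fun ⟨y, hy⟩ => hy ▸ y.2⟩

/-- The values of a homomorphism from a sum of tensor powers. -/
theorem directSum_mem_of_tensorMaps {k : ℕ} {d : Fin k → ℕ} {N : LieMod (gl S)}
    (b : (⨁ i, ((taut S).tensorPow (d i))) →ₗ⁅ℂ,gl S⁆ N) {W : Submodule ℂ N}
    (hW : ∀ i, ∀ w : Fin (d i) → S,
      b (DirectSum.lieModuleOf ℂ (Fin k) (gl S) (fun i => (taut S).tensorPow (d i)) i
        (tensorBasis S (d i) w)) ∈ W) (x : ⨁ i, ((taut S).tensorPow (d i))) : b x ∈ W := by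
  induction x using DirectSum.induction_on with
  | zero => rw [map_zero]; exact W.zero_mem
  | add x y hx hy => rw [map_add]; exact W.add_mem hx hy
  | of i z =>
    let g : (taut S).tensorPow (d i) →ₗ⁅ℂ,gl S⁆ N :=
      b.comp (DirectSum.lieModuleOf ℂ (Fin k) (gl S) (fun i => (taut S).tensorPow (d i)) i)
    have hz : z ∈ Submodule.span ℂ (Set.range (tensorBasis S (d i))) :=
      (tensorBasis S (d i)).span_eq ▸ Submodule.mem_top
    change g z ∈ W
    refine (Submodule.span_le (p := W.comap g.toLinearMap)).2 ?_ hz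
    rintro _ ⟨w, rfl⟩
    exact hW i w

theorem tensorSpan_of_isIndPoly (h : IsIndPoly M) : tensorSpan S M.e = ⊤ := by
  obtain ⟨ι, W, -, hW, hp⟩ := h
  have h1 : ⨆ i, (W i : Submodule ℂ M) = ⊤ := by
    rw [← LieSubmodule.iSup_toSubmodule, hW]
    rfl
  rw [eq_top_iff, ← h1, iSup_le_iff]
  intro i x hx
  obtain ⟨k, d, a, b, hab⟩ := hp i
  have key := directSum_mem_of_tensorMaps b (W := (tensorSpan S M.e).comap (W i).incl.toLinearMap)
    (fun j w => Submodule.subset_span ⟨d j, _, w, ((isTensorMap_tensorBasis S (d j)).comp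
      (((W i).incl.comp b).comp (DirectSum.lieModuleOf ℂ (Fin k) (gl S)
        (fun i => (taut S).tensorPow (d i)) j))), rfl⟩) (a ⟨x, hx⟩)
  rw [hab] at key
  exact key

end TensorSpanned

end ParabolicO

namespace ParabolicO

attribute [local instance 100] LieRing.ofAssociativeRing

/-! ### The category `O` in terms of matrix units -/

section Degrees

variable {I : Set ℕ} {μ μ' : ℕ →₀ ℕ}

/-- Applied with `i = 0`: a unit of weight at `j` moves to the unrecorded index and disappears from
the degree. -/
theorem degree_of_lower (h : (μ.support : Set ℕ) ⊆ I) (h' : (μ'.support : Set ℕ) ⊆ I) {i j : ℕ}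
    (hi : i ∉ I) (hj : j ∈ I)
    (hk : ∀ k ∈ I, μ' k + (if k = j then 1 else 0) = μ k + if k = i then 1 else 0) :
    μ'.degree + 1 = μ.degree := by
  have : μ' + Finsupp.single j 1 = μ := by
    ext k
    rw [Finsupp.add_apply, Finsupp.single_apply]
    by_cases hkI : k ∈ I
    · have := hk k hkI
      rw [if_neg (ne_of_mem_of_not_mem hkI hi), add_zero] at this
      rw [← this]
      simp [eq_comm]
    · rw [if_neg (ne_of_mem_of_not_mem hj hkI), Finsupp.notMem_support_iff.1 fun hc => hkI (h hc),
        Finsupp.notMem_support_iff.1 fun hc => hkI (h' hc), add_zero]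
  rw [← this, map_add, Finsupp.degree_single]

theorem degree_of_raise (h : (μ.support : Set ℕ) ⊆ I) (h' : (μ'.support : Set ℕ) ⊆ I) {i j : ℕ}
    (hi : i ∈ I) (hj : j ∉ I)
    (hk : ∀ k ∈ I, μ' k + (if k = j then 1 else 0) = μ k + if k = i then 1 else 0) :
    μ'.degree = μ.degree + 1 :=
  (degree_of_lower h' h hj hi fun k hkI => (hk k hkI).symm).symm

theorem degree_of_move (h : (μ.support : Set ℕ) ⊆ I) (h' : (μ'.support : Set ℕ) ⊆ I) {i j : ℕ}
    (hi : i ∈ I) (hj : j ∈ I)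
    (hk : ∀ k ∈ I, μ' k + (if k = j then 1 else 0) = μ k + if k = i then 1 else 0) :
    μ'.degree = μ.degree := by
  have : μ' + Finsupp.single j 1 = μ + Finsupp.single i 1 := by
    ext k
    rw [Finsupp.add_apply, Finsupp.single_apply, Finsupp.add_apply, Finsupp.single_apply]
    by_cases hkI : k ∈ I
    · have := hk k hkI
      simpa [eq_comm] using this
    · rw [if_neg (ne_of_mem_of_not_mem hj hkI), if_neg (ne_of_mem_of_not_mem hi hkI),
        Finsupp.notMem_support_iff.1 fun hc => hkI (h hc),
        Finsupp.notMem_support_iff.1 fun hc => hkI (h' hc)]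
  have := congrArg Finsupp.degree this
  rw [map_add, map_add, Finsupp.degree_single, Finsupp.degree_single] at this
  omega

end Degrees

section Operators

variable {V : Type*} [AddCommGroup V] [Module ℂ V]

/-- The conditions that define the category `O`, for a vector space with operators. -/
structure IsO (ν : ℂ) (S : Set ℕ) (e : ℕ → ℕ → Module.End ℂ V) : Prop where
  gl : IsGlRep S e
  span : tensorSpan (idxU S) e = ⊤
  deg : ∀ (d : ℕ) (f : (Fin d → idxU S) → V), IsTensorMap (idxU S) e d f →
    ∀ w, e 0 0 (f w) = (ν - d) • f w
  fg : ∃ (k : ℕ) (d : Fin k → ℕ) (f : ∀ a, (Fin (d a) → idxU S) → V),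
    (∀ a, IsTensorMap (idxU S) e (d a) (f a)) ∧
      opClosure {g | ∃ i ∈ idxU S, g = e i 0} {v | ∃ a w, v = f a w} = ⊤

theorem wtSpan_empty (I : Set ℕ) (e : ℕ → ℕ → Module.End ℂ V) : wtSpan I e ∅ = ⊥ := by
  rw [eq_bot_iff]
  exact wtSpan_induction fun μ hμ => absurd hμ (Set.notMem_empty μ)

theorem exists_degree_lt {I : Set ℕ} {e : ℕ → ℕ → Module.End ℂ V} {v : V}
    (hv : v ∈ wtSpan I e Set.univ) : ∃ k, v ∈ wtSpan I e {μ | μ.degree < k} := by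
  induction hv using Submodule.span_induction with
  | mem v hv =>
    obtain ⟨μ, -, hI, hv⟩ := hv
    exact ⟨μ.degree + 1, hv.mem_wtSpan (Nat.lt_succ_self _) hI⟩
  | zero => exact ⟨0, Submodule.zero_mem _⟩
  | add x y _ _ hx hy =>
    obtain ⟨k, hk⟩ := hx
    obtain ⟨l, hl⟩ := hy
    refine ⟨max k l, Submodule.add_mem _ (wtSpan_mono ?_ hk) (wtSpan_mono ?_ hl)⟩
    · exact fun μ (hμ : μ.degree < k) => lt_of_lt_of_le hμ (le_max_left k l)
    · exact fun μ (hμ : μ.degree < l) => lt_of_lt_of_le hμ (le_max_right k l)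
  | smul c x _ hx => exact hx.imp fun k hk => Submodule.smul_mem _ c hk

theorem isWtRep_of_tensorSpan {S I : Set ℕ} {e : ℕ → ℕ → Module.End ℂ V} (h : IsGlRep S e)
    (hI : I ⊆ S) (ht : tensorSpan I e = ⊤) : IsWtRep S I e := by
  refine ⟨h, hI, ?_⟩
  rw [eq_top_iff, ← ht]
  refine Submodule.span_le.2 ?_
  rintro _ ⟨d, f, w, hf, rfl⟩
  exact (hf.isWt w).mem_wtSpan (Set.mem_univ _) (support_wordWt_subset w)

theorem zero_notMem_idxU (S : Set ℕ) : 0 ∉ idxU S := fun h => h.2 rfl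

theorem IsO.isWtRep {ν : ℂ} {S : Set ℕ} {e : ℕ → ℕ → Module.End ℂ V} (h : IsO ν S e) :
    IsWtRep S (idxU S) e := isWtRep_of_tensorSpan h.gl (idxU_subset S) h.span

theorem IsTensorMap.congr {I : Set ℕ} {e e' : ℕ → ℕ → Module.End ℂ V}
    (h : ∀ i ∈ I, ∀ j ∈ I, ∀ v, e i j v = e' i j v) {d : ℕ} {f : (Fin d → I) → V}
    (hf : IsTensorMap I e d f) : IsTensorMap I e' d f := fun k l w =>
  (h k k.2 l l.2 _).symm.trans (hf k l w)

theorem tensorSpan_congr {I : Set ℕ} {e e' : ℕ → ℕ → Module.End ℂ V}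
    (h : ∀ i ∈ I, ∀ j ∈ I, ∀ v, e i j v = e' i j v) : tensorSpan I e = tensorSpan I e' := by
  apply le_antisymm <;> refine Submodule.span_mono ?_
  · rintro v ⟨d, f, w, hf, rfl⟩
    exact ⟨d, f, w, hf.congr h, rfl⟩
  · rintro v ⟨d, f, w, hf, rfl⟩
    exact ⟨d, f, w, hf.congr fun i hi j hj v => (h i hi j hj v).symm, rfl⟩

end Operators

/-- Homomorphisms from a direct sum. -/
theorem exists_directSum_lift {L : Type} [LieRing L] [LieAlgebra ℂ L] {k : ℕ}
    (X : Fin k → LieMod L) {N : LieMod L} (ψ : ∀ a, X a →ₗ⁅ℂ,L⁆ N) :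
    ∃ φ : (⨁ a, X a) →ₗ⁅ℂ,L⁆ N, ∀ a z,
      φ (DirectSum.lieModuleOf ℂ (Fin k) L (fun a => X a) a z) = ψ a z := by
  let φ₀ : (⨁ a, X a) →ₗ[ℂ] N := DirectSum.toModule ℂ (Fin k) N fun a => (ψ a).toLinearMap
  have hφ₀ : ∀ a z, φ₀ (DirectSum.lieModuleOf ℂ (Fin k) L (fun a => X a) a z) = ψ a z :=
    fun a z => by
      change φ₀ (DirectSum.lof ℂ (Fin k) (fun a => X a) a z) = _
      rw [DirectSum.toModule_lof]
      rfl
  refine ⟨{ φ₀ with map_lie' := fun {A x} => ?_ }, hφ₀⟩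
  change φ₀ ⁅A, x⁆ = ⁅A, φ₀ x⁆
  induction x using DirectSum.induction_on with
  | zero => rw [lie_zero, map_zero, lie_zero]
  | add x y hx hy => rw [lie_add, map_add, map_add, lie_add, hx, hy]
  | of a z =>
    exact (congrArg φ₀
      ((DirectSum.lieModuleOf ℂ (Fin k) L (fun a => X a) a).map_lie A z).symm).trans
      ((hφ₀ a _).trans (((ψ a).map_lie A z).trans (congrArg (fun y => ⁅A, y⁆) (hφ₀ a z).symm)))

/-! ### Translation of the defining conditions into matrix units. -/

section Interface

variable {S : Set ℕ} (M : LieMod (gl S))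

theorem isTensorMap_resGl {T : Set ℕ} (hT : T ⊆ S) {d : ℕ} {f : (Fin d → T) → M} :
    IsTensorMap T (resGl hT M).e d f ↔ IsTensorMap T M.e d f :=
  ⟨fun h => h.congr fun _ hi _ hj v => resGl_e hT M hi hj v,
    fun h => h.congr fun _ hi _ hj v => (resGl_e hT M hi hj v).symm⟩

theorem isIndPoly_resGl_iff {T : Set ℕ} (hT : T ⊆ S) :
    IsIndPoly (resGl hT M) ↔ tensorSpan T M.e = ⊤ := by
  have h1 : tensorSpan T (resGl hT M).e = tensorSpan T M.e :=
    tensorSpan_congr fun _ hi _ hj v => resGl_e hT M hi hj v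
  rw [← h1]
  exact ⟨tensorSpan_of_isIndPoly, isIndPoly_of_tensorSpan⟩

theorem isOfDegree_iff (h0 : 0 ∈ S) {ν : ℂ} :
    IsOfDegree ν M ↔ ∀ (d : ℕ) (f : (Fin d → idxU S) → M), IsTensorMap (idxU S) M.e d f →
      ∀ w, M.e 0 0 (f w) = (ν - d) • f w := by
  constructor
  · intro h d f hf w
    have hf' := (isTensorMap_resGl M (idxU_subset S)).2 hf
    have := h d (IsTensorMap.hom (N := resGl (idxU_subset S) M) hf') (tensorBasis _ d w)
      (glE S 0 0) (coe_glE h0 h0)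
    rw [IsTensorMap.hom_basis (N := resGl (idxU_subset S) M)] at this
    exact this
  · intro h d φ x A hA
    rw [M.e_of_coe h0 h0 hA]
    have hf := (isTensorMap_resGl M (idxU_subset S)).1
      ((isTensorMap_tensorBasis (idxU S) d).comp φ)
    have hx : x ∈ Submodule.span ℂ (Set.range (tensorBasis (idxU S) d)) :=
      (tensorBasis (idxU S) d).span_eq ▸ Submodule.mem_top
    induction hx using Submodule.span_induction with
    | mem x hx =>
      obtain ⟨w, rfl⟩ := hx
      exact h d _ hf w
    | zero => rw [map_zero, map_zero, map_zero, smul_zero]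
    | add x y _ _ hx hy => rw [map_add, map_add, map_add, hx, hy, smul_add]
    | smul c x _ hx => rw [map_smul, map_smul, map_smul, hx, smul_comm]

/-- Each element of `u⁺` lowers the degree by one and degrees are non-negative, so local nilpotence
is automatic for modules with non-negative weights. -/
theorem isLocNilp_of_isWtRep (h0 : 0 ∈ S) (h : IsWtRep S (idxU S) M.e) : IsLocNilp M := by
  intro v
  obtain ⟨k, hk⟩ := exists_degree_lt (h.top ▸ Submodule.mem_top : v ∈ _)
  refine ⟨k, fun l hl hA => ?_⟩
  have hstep : ∀ n, ∀ A ∈ uPlus S, ∀ w ∈ wtSpan (idxU S) M.e {μ | μ.degree < n + 1},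
      ⁅A, w⁆ ∈ wtSpan (idxU S) M.e {μ | μ.degree < n} := by
    intro n A hA w hw
    induction hA using Submodule.span_induction with
    | mem A hA =>
      obtain ⟨j, hj, hA⟩ := hA
      rw [M.e_of_coe h0 hj.1 hA]
      refine h.apply_mem_wtSpan h0 hj.1 (fun μ hμ μ' h1 h2 h3 => ?_) hw
      have := degree_of_lower h1 h2 (zero_notMem_idxU S) hj h3
      simp only [Set.mem_ofPred_eq] at hμ ⊢
      omega
    | zero => rw [zero_lie]; exact Submodule.zero_mem _
    | add A B _ _ h1 h2 => rw [add_lie]; exact Submodule.add_mem _ h1 h2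
    | smul c A _ h1 => rw [smul_lie]; exact Submodule.smul_mem _ c h1
  have key : ∀ l : List (gl S), (∀ A ∈ l, A ∈ uPlus S) → ∀ n,
      v ∈ wtSpan (idxU S) M.e {μ | μ.degree < n + l.length} →
      l.foldr (fun A w => ⁅A, w⁆) v ∈ wtSpan (idxU S) M.e {μ | μ.degree < n} := by
    intro l
    induction l with
    | nil => exact fun _ n hv => hv
    | cons A l ih =>
      intro hA n hv
      rw [List.foldr_cons]
      refine hstep n A (hA A List.mem_cons_self) _
        (ih (fun B hB => hA B (List.mem_cons_of_mem A hB)) (n + 1) ?_)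
      rwa [List.length_cons, add_comm l.length, ← add_assoc] at hv
  have := key l hA 0 (by rwa [zero_add, hl])
  simp only [Nat.not_lt_zero, Set.ofPred_false] at this
  erw [wtSpan_empty] at this
  exact this

theorem isSymFG_iff (h0 : 0 ∈ S) :
    IsSymFG M ↔ ∃ (k : ℕ) (d : Fin k → ℕ) (f : ∀ a, (Fin (d a) → idxU S) → M),
      (∀ a, IsTensorMap (idxU S) M.e (d a) (f a)) ∧
        opClosure {g | ∃ i ∈ idxU S, g = M.e i 0} {v | ∃ a w, v = f a w} = ⊤ := by
  constructor
  · rintro ⟨Q, ⟨k, d, a, b, hab⟩, φ, hφ⟩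
    let g : ∀ i : Fin k, (taut (idxU S)).tensorPow (d i) →ₗ⁅ℂ,gl (idxU S)⁆ Q := fun i =>
      b.comp (DirectSum.lieModuleOf ℂ (Fin k) (gl (idxU S))
        (fun i => (taut (idxU S)).tensorPow (d i)) i)
    refine ⟨k, d, fun i w => φ (g i (tensorBasis (idxU S) (d i) w)), fun i => ?_, ?_⟩
    · exact (isTensorMap_resGl M (idxU_subset S)).1
        ((isTensorMap_tensorBasis (idxU S) (d i)).comp (φ.comp (g i)))
    · refine hφ _ (fun q => ?_) ?_
      · have := directSum_mem_of_tensorMaps b (W := Submodule.comap φ.toLinearMap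
          (opClosure {g | ∃ i ∈ idxU S, g = M.e i 0}
            {v | ∃ i w, v = φ (g i (tensorBasis (idxU S) (d i) w))}))
          (fun i w => subset_opClosure _ _ ⟨i, w, rfl⟩) (a q)
        rw [hab] at this
        exact this
      · intro A hA w hw
        induction hA using Submodule.span_induction with
        | mem A hA =>
          obtain ⟨i, hi, hA⟩ := hA
          rw [M.e_of_coe hi.1 h0 hA]
          refine opClosure_apply ?_ hw
          exact ⟨i, hi, rfl⟩
        | zero => rw [zero_lie]; exact Submodule.zero_mem _
        | add A B _ _ h1 h2 => rw [add_lie]; exact Submodule.add_mem _ h1 h2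
        | smul c A _ h1 => rw [smul_lie]; exact Submodule.smul_mem _ c h1
  · rintro ⟨k, d, f, hf, htop⟩
    let Q : LieMod (gl (idxU S)) := LieMod.of _ (⨁ i, ((taut (idxU S)).tensorPow (d i)))
    have hf' := fun a => (isTensorMap_resGl M (idxU_subset S)).2 (hf a)
    obtain ⟨φ, hφ⟩ := exists_directSum_lift (N := resGl (idxU_subset S) M)
      (fun a => (taut (idxU S)).tensorPow (d a))
      fun a => IsTensorMap.hom (N := resGl (idxU_subset S) M) (hf' a)
    refine ⟨Q, ⟨k, d, LieModuleHom.id, LieModuleHom.id, fun _ => rfl⟩, φ, fun W h1 h2 => ?_⟩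
    rw [eq_top_iff, ← htop]
    refine opClosure_le ?_ ?_
    · rintro _ ⟨a, w, rfl⟩
      have h3 := h1 (DirectSum.lieModuleOf ℂ (Fin k) (gl (idxU S))
        (fun i => (taut (idxU S)).tensorPow (d i)) a (tensorBasis _ _ w))
      rw [hφ, IsTensorMap.hom_basis (N := resGl (idxU_subset S) M)] at h3
      exact h3
    · rintro _ ⟨i, hi, rfl⟩ w hw
      exact h2 (glE S i 0) (Submodule.subset_span ⟨i, hi, coe_glE hi.1 h0⟩) w hw

/-- `IsO` contains no nilpotence condition, since that one follows from the others. -/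
theorem catO_iff (h0 : 0 ∈ S) {ν : ℂ} : catO ν S M ↔ IsO ν S M.e := by
  constructor
  · rintro ⟨h1, h2, h3, -⟩
    exact ⟨M.isGlRep, (isIndPoly_resGl_iff M _).1 h1, (isOfDegree_iff M h0).1 h2,
      (isSymFG_iff M h0).1 h3⟩
  · intro h
    exact ⟨(isIndPoly_resGl_iff M _).2 h.span, (isOfDegree_iff M h0).2 h.deg,
      (isSymFG_iff M h0).2 h.fg, isLocNilp_of_isWtRep M h0 h.isWtRep⟩

end Interface

end ParabolicO

namespace ParabolicO

/-! ### The category `O` under invariants, and finiteness in bounded degree. -/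

section Invariance

variable {V : Type*} [AddCommGroup V] [Module ℂ V] {ν : ℂ} {S T : Set ℕ}
  {e : ℕ → ℕ → Module.End ℂ V}

/-- Values of tensor maps are weight vectors and span the module; projecting to the weights in `A`
keeps only the words whose weight is in `A`. -/
theorem mem_span_tensor_of_mem_wtSpan {I : Set ℕ} (h : tensorSpan I e = ⊤) {A : Set (ℕ →₀ ℕ)}
    {v : V} (hv : v ∈ wtSpan I e A) :
    v ∈ Submodule.span ℂ {x | ∃ (d : ℕ) (f : (Fin d → I) → V) (w : Fin d → I),
      IsTensorMap I e d f ∧ wordWt w ∈ A ∧ x = f w} := by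
  let κ := {p : Σ d : ℕ, ((Fin d → I) → V) × (Fin d → I) // IsTensorMap I e p.1 p.2.1}
  have h1 : Submodule.span ℂ (Set.range fun p : κ => p.1.2.1 p.1.2.2) = ⊤ := by
    rw [eq_top_iff, ← h]
    refine Submodule.span_mono ?_
    rintro _ ⟨d, f, w, hf, rfl⟩
    exact ⟨⟨⟨d, f, w⟩, hf⟩, rfl⟩
  have h2 := mem_span_of_mem_wtSpan (I := I) (e := e) (κ := κ) (b := fun p => p.1.2.1 p.1.2.2)
    (μ := fun p => wordWt p.1.2.2) (fun p => support_wordWt_subset _) (fun p => p.2.isWt _)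
    (A := A) (x := v) (h1 ▸ Submodule.mem_top) hv
  refine Submodule.span_mono ?_ h2
  rintro _ ⟨p, hp, rfl⟩
  exact ⟨_, _, _, p.2, hp, rfl⟩

/-- The degree condition concerns values of tensor maps only, but by `mem_span_tensor_of_mem_wtSpan`
these span each weight space, and the degree of the weight of a word is its length. -/
theorem IsO.deg_wt (h : IsO ν S e) {μ : ℕ →₀ ℕ} (hμ : (μ.support : Set ℕ) ⊆ idxU S) {v : V}
    (hv : IsWt (idxU S) e μ v) : e 0 0 v = (ν - μ.degree) • v := by
  have h1 := mem_span_tensor_of_mem_wtSpan h.span (hv.mem_wtSpan (Set.mem_singleton μ) hμ)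
  clear hv
  induction h1 using Submodule.span_induction with
  | mem x hx =>
    obtain ⟨d, f, w, hf, hw, rfl⟩ := hx
    rw [h.deg d f hf w, ← Set.mem_singleton_iff.1 hw, degree_wordWt]
  | zero => simp
  | add x y _ _ hx hy => rw [map_add, hx, hy, smul_add]
  | smul c x _ hx => rw [map_smul, hx, smul_comm]

theorem idxU_mono (h : T ⊆ S) : idxU T ⊆ idxU S := Set.sdiff_subset_sdiff_left h

theorem sdiff_subset_idxU (h0 : 0 ∈ T) : S \ T ⊆ idxU S :=
  fun _ hi => ⟨hi.1, fun h => hi.2 (Set.mem_singleton_iff.1 h ▸ h0)⟩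

theorem wordWt_inclusion {I J : Set ℕ} (h : I ⊆ J) {d : ℕ} (w : Fin d → I) :
    wordWt (Set.inclusion h ∘ w) = wordWt w := rfl

theorem exists_word_inclusion {I J : Set ℕ} (h : I ⊆ J) {d : ℕ} {w : Fin d → J}
    (hw : ((wordWt w).support : Set ℕ) ⊆ I) : ∃ w', w = Set.inclusion h ∘ w' :=
  ⟨fun s => ⟨w s, hw ((mem_support_wordWt w).2 ⟨s, rfl⟩)⟩, rfl⟩

/-- Restriction of tensor maps to a smaller set of letters, with values in the invariants. -/
theorem IsTensorMap.restrict {I J : Set ℕ} (hJ : J ⊆ I) {V' : Type*} [AddCommGroup V']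
    [Module ℂ V'] {e' : ℕ → ℕ → Module.End ℂ V'} {ι : V' →ₗ[ℂ] V} (hι : Function.Injective ι)
    (he : ∀ i ∈ J, ∀ j ∈ J, ∀ x, ι (e' i j x) = e i j (ι x)) {d : ℕ} {f : (Fin d → I) → V}
    (hf : IsTensorMap I e d f) {f' : (Fin d → J) → V'}
    (hf' : ∀ w, ι (f' w) = f (Set.inclusion hJ ∘ w)) : IsTensorMap J e' d f' := by
  intro k l w
  apply hι
  rw [he k k.2 l l.2, hf', map_sum]
  refine (hf (Set.inclusion hJ k) (Set.inclusion hJ l) _).trans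
    (Finset.sum_congr rfl fun s _ => ?_)
  have : (Set.inclusion hJ ∘ w) s = Set.inclusion hJ l ↔ w s = l :=
    (Set.inclusion_injective hJ).eq_iff
  by_cases hs : w s = l
  · rw [if_pos hs, if_pos (this.2 hs), hf', Function.comp_update]
  · rw [if_neg hs, if_neg fun h => hs (this.1 h), map_zero]

/-- The words in the basis of `Sym(U) ⊗ Q`: products of lowering operators applied to the value of
a tensor map. -/
def lowerWord {I : Set ℕ} (e : ℕ → ℕ → Module.End ℂ V) (l : List I) (v : V) : V :=
  l.foldr (fun i v => e i 0 v) v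

noncomputable def listWt {I : Set ℕ} (l : List I) : ℕ →₀ ℕ :=
  (l.map fun i => Finsupp.single (i : ℕ) 1).sum

theorem listWt_cons {I : Set ℕ} (i : I) (l : List I) :
    listWt (i :: l) = Finsupp.single (i : ℕ) 1 + listWt l := by simp [listWt]

theorem degree_listWt {I : Set ℕ} (l : List I) : (listWt l).degree = l.length := by
  induction l with
  | nil => simp [listWt]
  | cons i l ih => rw [listWt_cons, map_add, ih, Finsupp.degree_single, List.length_cons, add_comm]

theorem support_listWt_subset {I : Set ℕ} (l : List I) : ((listWt l).support : Set ℕ) ⊆ I := by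
  induction l with
  | nil => simp [listWt]
  | cons i l ih =>
    rw [listWt_cons]
    intro k hk
    rcases Finset.mem_union.1 (Finsupp.support_add hk) with hk | hk
    · rw [Finset.mem_singleton.1 (Finsupp.support_single_subset hk)]
      exact i.2
    · exact ih hk

theorem support_add_subset_iff {I : Set ℕ} {μ μ' : ℕ →₀ ℕ} :
    ((μ + μ').support : Set ℕ) ⊆ I ↔
      (μ.support : Set ℕ) ⊆ I ∧ (μ'.support : Set ℕ) ⊆ I := by
  constructor
  · intro h
    constructor <;> intro i hi <;> refine h ?_ <;>
    · rw [Finset.mem_coe, Finsupp.mem_support_iff] at hi ⊢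
      rw [Finsupp.add_apply]
      omega
  · rintro ⟨h, h'⟩ i hi
    rcases Finset.mem_union.1 (Finsupp.support_add hi) with hi | hi
    exacts [h hi, h' hi]

theorem exists_list_inclusion {I J : Set ℕ} (h : I ⊆ J) {l : List J}
    (hl : ((listWt l).support : Set ℕ) ⊆ I) : ∃ l' : List I, l = l'.map (Set.inclusion h) := by
  induction l with
  | nil => exact ⟨[], rfl⟩
  | cons i l ih =>
    rw [listWt_cons, support_add_subset_iff] at hl
    obtain ⟨l', rfl⟩ := ih hl.2
    exact ⟨⟨i, hl.1 (by simp)⟩ :: l', rfl⟩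

theorem IsWtRep.isWt_lowerWord (h : IsWtRep S (idxU S) e) (h0 : 0 ∈ S) (l : List (idxU S))
    {μ : ℕ →₀ ℕ} {v : V} (hv : IsWt (idxU S) e μ v) :
    IsWt (idxU S) e (listWt l + μ) (lowerWord e l v) := by
  induction l with
  | nil => simpa [listWt, lowerWord] using hv
  | cons i l ih =>
    refine h.wt_shift i.2.1 h0 (fun k hk => ?_) ih
    rw [if_neg (ne_of_mem_of_not_mem hk (zero_notMem_idxU S)), listWt_cons, add_assoc,
      Finsupp.add_apply, Finsupp.single_apply]
    simp only [eq_comm (a := k)]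
    omega

/-- This replaces a Poincaré–Birkhoff–Witt basis: repeated or dependent words do no harm, since all
that is used is a spanning family of weight vectors. -/
theorem span_lowerWord {I : Set ℕ} {X : Set V}
    (h : opClosure {g | ∃ i ∈ I, g = e i 0} X = ⊤) {κ : Type*} {b : κ → V}
    (hb : X ⊆ Set.range b) :
    Submodule.span ℂ (Set.range fun p : List I × κ => lowerWord e p.1 (b p.2)) = ⊤ := by
  rw [eq_top_iff, ← h]
  refine opClosure_le (fun x hx => ?_) ?_
  · obtain ⟨k, rfl⟩ := hb hx
    exact Submodule.subset_span ⟨([], k), rfl⟩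
  · rintro _ ⟨i, hi, rfl⟩ w hw
    refine (Submodule.span_le (p := (Submodule.span ℂ _).comap (e i 0))).2 ?_ hw
    rintro _ ⟨p, rfl⟩
    exact Submodule.subset_span ⟨(⟨i, hi⟩ :: p.1, p.2), rfl⟩

/-- The category `O` is preserved by invariants. -/
theorem IsO.of_glInv (h : IsO ν S e) (h0 : 0 ∈ T) (hT : T ⊆ S) {V' : Type*} [AddCommGroup V']
    [Module ℂ V'] {e' : ℕ → ℕ → Module.End ℂ V'} {ι : V' →ₗ[ℂ] V} (hι : Function.Injective ι)
    (hr : ∀ v, v ∈ glInv S T e ↔ ∃ x, ι x = v)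
    (he : ∀ i ∈ T, ∀ j ∈ T, ∀ x, ι (e' i j x) = e i j (ι x)) : IsO ν T e' := by
  have hU := idxU_mono hT
  have heU : ∀ i ∈ idxU T, ∀ j ∈ idxU T, ∀ x, ι (e' i j x) = e i j (ι x) :=
    fun i hi j hj => he i hi.1 j hj.1
  have hinv := h.isWtRep.glInv_eq (sdiff_subset_idxU (S := S) h0)
  -- `g` is an inverse of `ι` on the invariants, with arbitrary values elsewhere.
  choose! g hg using fun v => (hr v).1
  have hword : ∀ {d : ℕ} {f : (Fin d → idxU S) → V} (hf : IsTensorMap (idxU S) e d f)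
      (w : Fin d → idxU T), f (Set.inclusion hU ∘ w) ∈ glInv S T e := by
    intro d f hf w
    rw [hinv]
    refine (hf.isWt _).mem_wtSpan ?_ (support_wordWt_subset _)
    exact (support_wordWt_subset w).trans (idxU_subset T)
  have hres : ∀ {d : ℕ} {f : (Fin d → idxU S) → V}, IsTensorMap (idxU S) e d f →
      IsTensorMap (idxU T) e' d fun w => g (f (Set.inclusion hU ∘ w)) :=
    fun hf => hf.restrict hU hι heU fun w => hg _ (hword hf w)
  have hsub : ∀ {d : ℕ} {w : Fin d → idxU S}, ((wordWt w).support : Set ℕ) ⊆ T →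
      ((wordWt w).support : Set ℕ) ⊆ idxU T :=
    fun hw i hi => ⟨hw hi, (support_wordWt_subset _ hi).2⟩
  refine ⟨fun i hi j hj k hk l hl v => ?_, ?_, fun d f hf w => ?_, ?_⟩
  · apply hι
    rw [map_add, map_sub, he i hi j hj, he k hk l hl, he k hk l hl, he i hi j hj,
      h.gl i (hT hi) j (hT hj) k (hT hk) l (hT hl), apply_ite ι, apply_ite ι, map_zero,
      he i hi l hl, he k hk j hj]
  · rw [eq_top_iff]
    intro x _
    have h1 : ι x ∈ glInv S T e := (hr _).2 ⟨x, rfl⟩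
    rw [hinv] at h1
    have h2 := mem_span_tensor_of_mem_wtSpan h.span h1
    have h3 : ι x ∈ (tensorSpan (idxU T) e').map ι := by
      refine Submodule.span_le.2 ?_ h2
      rintro _ ⟨d, f, w, hf, hw, rfl⟩
      obtain ⟨w, rfl⟩ := exists_word_inclusion hU (hsub hw)
      exact ⟨g _, Submodule.subset_span ⟨d, _, w, hres hf, rfl⟩, hg _ (hword hf w)⟩
    obtain ⟨y, hy, hyx⟩ := h3
    rwa [← hι hyx]
  · apply hι
    rw [he 0 h0 0 h0, map_smul]
    have h1 : ι (f w) ∈ glInv S T e := (hr _).2 ⟨_, rfl⟩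
    have h2 : IsWt (idxU S) e (wordWt w) (ι (f w)) := by
      intro i hi
      by_cases hiT : i ∈ T
      · rw [← he i hiT i hiT, hf.isWt w i ⟨hiT, hi.2⟩, map_smul]
      · rw [h1 i ⟨hi.1, hiT⟩ i ⟨hi.1, hiT⟩, Finsupp.notMem_support_iff.1 fun hc =>
          hiT (support_wordWt_subset w hc).1, Nat.cast_zero, zero_smul]
    rw [h.deg_wt ((support_wordWt_subset w).trans hU) h2, degree_wordWt]
  · obtain ⟨k, d, f, hf, htop⟩ := h.fg
    refine ⟨k, d, fun a w => g (f a (Set.inclusion hU ∘ w)), fun a => hres (hf a), ?_⟩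
    rw [eq_top_iff]
    intro x _
    have h1 : ι x ∈ glInv S T e := (hr _).2 ⟨x, rfl⟩
    rw [hinv] at h1
    let κ := Σ a : Fin k, (Fin (d a) → idxU S)
    -- Weights are non-negative, so a lowering word whose total weight is supported on `T` involves
    -- only letters of `T`, both in the operators and in the generator. It can therefore be formed
    -- inside the invariants.
    have h2 := mem_span_of_mem_wtSpan (I := idxU S) (e := e) (κ := List (idxU S) × κ)
      (b := fun p => lowerWord e p.1 (f p.2.1 p.2.2))
      (μ := fun p => listWt p.1 + wordWt p.2.2)
      (fun p => support_add_subset_iff.2 ⟨support_listWt_subset _, support_wordWt_subset _⟩)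
      (fun p => h.isWtRep.isWt_lowerWord (hT h0) _ ((hf _).isWt _)) (x := ι x)
      (by
        rw [span_lowerWord htop (b := fun p : κ => f p.1 p.2)]
        · exact Submodule.mem_top
        · rintro _ ⟨a, w, rfl⟩
          exact ⟨⟨a, w⟩, rfl⟩) h1
    have h3 : ι x ∈ (opClosure {f | ∃ i ∈ idxU T, f = e' i 0}
        {v | ∃ a w, v = g (f a (Set.inclusion hU ∘ w))}).map ι := by
      refine Submodule.span_le.2 ?_ h2
      rintro _ ⟨⟨l, a, w⟩, hp, rfl⟩
      obtain ⟨hp1, hp2⟩ : ((listWt l).support : Set ℕ) ⊆ T ∧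
        ((wordWt w).support : Set ℕ) ⊆ T := support_add_subset_iff.1 hp
      obtain ⟨w, rfl⟩ := exists_word_inclusion hU (hsub hp2)
      obtain ⟨l, rfl⟩ := exists_list_inclusion hU (l := l)
        fun i hi => ⟨hp1 hi, (support_listWt_subset _ hi).2⟩
      clear hp hp1 hp2
      dsimp only
      induction l with
      | nil => exact ⟨_, subset_opClosure _ _ ⟨a, w, rfl⟩, hg _ (hword (hf a) w)⟩
      | cons i l ih =>
        obtain ⟨y, hy, hyl⟩ := ih
        refine ⟨e' i 0 y, opClosure_apply (by exact ⟨i, i.2, rfl⟩) hy, ?_⟩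
        rw [he i i.2.1 0 h0, hyl]
        rfl
    obtain ⟨y, hy, hyx⟩ := h3
    rwa [← hι hyx]

/-- In finite rank, the weights of bounded degree span a finite-dimensional space. -/
theorem IsO.finiteDimensional (h : IsO ν S e) (h0 : 0 ∈ S) (hS : S.Finite) (m : ℕ) :
    FiniteDimensional ℂ (wtSpan (idxU S) e {μ | μ.degree ≤ m}) := by
  obtain ⟨k, d, f, hf, htop⟩ := h.fg
  have : Finite (idxU S) := (hS.subset (idxU_subset S)).to_subtype
  let κ := Σ a : Fin k, (Fin (d a) → idxU S)
  let B : Set V := (fun p : List (idxU S) × κ => lowerWord e p.1 (f p.2.1 p.2.2)) ''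
    ({l | l.length ≤ m} ×ˢ Set.univ)
  have hB : B.Finite :=
    ((List.finite_length_le (idxU S) m).prod (Set.toFinite _)).image _
  have := FiniteDimensional.span_of_finite ℂ hB
  refine Submodule.finiteDimensional_of_le (S₂ := Submodule.span ℂ B) fun x hx => ?_
  have h2 := mem_span_of_mem_wtSpan (I := idxU S) (e := e) (κ := List (idxU S) × κ)
    (b := fun p => lowerWord e p.1 (f p.2.1 p.2.2))
    (μ := fun p => listWt p.1 + wordWt p.2.2)
    (fun p => support_add_subset_iff.2 ⟨support_listWt_subset _, support_wordWt_subset _⟩)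
    (fun p => h.isWtRep.isWt_lowerWord h0 _ ((hf _).isWt _)) (x := x)
    (by
      rw [span_lowerWord htop (b := fun p : κ => f p.1 p.2)]
      · exact Submodule.mem_top
      · rintro _ ⟨a, w, rfl⟩
        exact ⟨⟨a, w⟩, rfl⟩) hx
  refine Submodule.span_mono (Set.image_mono fun p hp => ?_) h2
  refine Set.mk_mem_prod ?_ (Set.mem_univ _)
  simp only [Set.mem_ofPred_eq, map_add, degree_listWt] at hp ⊢
  omega

/-- The module is generated by the part of bounded degree. -/
theorem IsO.exists_bound (h : IsO ν S e) :
    ∃ m : ℕ, opClosure {g | ∃ i ∈ idxU S, g = e i 0}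
      (wtSpan (idxU S) e {μ | μ.degree ≤ m}) = ⊤ := by
  obtain ⟨k, d, f, hf, htop⟩ := h.fg
  refine ⟨Finset.univ.sup d, ?_⟩
  rw [eq_top_iff, ← htop]
  refine opClosure_le ?_ fun g hg w hw => opClosure_apply hg hw
  rintro _ ⟨a, w, rfl⟩
  refine subset_opClosure _ _ (((hf a).isWt w).mem_wtSpan ?_ (support_wordWt_subset _))
  rw [Set.mem_ofPred_eq, degree_wordWt]
  exact Finset.le_sup (Finset.mem_univ a)

end Invariance

end ParabolicO

namespace ParabolicO

attribute [local instance 100] LieRing.ofAssociativeRing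

/-! ### The invariants functors -/

theorem LieMod.isIso_of_bijective {L : Type} [LieRing L] [LieAlgebra ℂ L] {M N : LieMod L}
    (f : M ⟶ N) (hf : Function.Bijective (show M →ₗ⁅ℂ,L⁆ N from f)) : IsIso f := by
  let e : M ≃ₗ⁅ℂ,L⁆ N :=
    { (show M →ₗ⁅ℂ,L⁆ N from f) with
      invFun := (Equiv.ofBijective _ hf).symm
      left_inv := (Equiv.ofBijective _ hf).left_inv
      right_inv := (Equiv.ofBijective _ hf).right_inv }
  refine ⟨(e.symm : N →ₗ⁅ℂ,L⁆ M), ?_, ?_⟩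
  · exact LieModuleHom.ext fun x => e.symm_apply_apply x
  · exact LieModuleHom.ext fun x => e.apply_symm_apply x

section Invariants

variable {L L' L'' : Type} [LieRing L] [LieAlgebra ℂ L] [LieRing L'] [LieAlgebra ℂ L']
  [LieRing L''] [LieAlgebra ℂ L'']

/-- The inclusion of the invariants. -/
def invariantsIncl (f : L' →ₗ⁅ℂ⁆ L) (K : Set L) (hK : ∀ a ∈ K, ∀ x, ⁅a, f x⁆ = 0) (M : LieMod L) :
    (invariants f K hK).obj M →ₗ[ℂ] M :=
  { toFun := fun v => v.1
    map_add' := fun _ _ => rfl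
    map_smul' := fun _ _ => rfl }

theorem invariantsIncl_injective (f : L' →ₗ⁅ℂ⁆ L) (K : Set L) (hK : ∀ a ∈ K, ∀ x, ⁅a, f x⁆ = 0)
    (M : LieMod L) : Function.Injective (invariantsIncl f K hK M) := Subtype.val_injective

theorem exists_invariantsIncl_iff (f : L' →ₗ⁅ℂ⁆ L) (K : Set L) (hK : ∀ a ∈ K, ∀ x, ⁅a, f x⁆ = 0)
    (M : LieMod L) (v : M) : (∃ x, invariantsIncl f K hK M x = v) ↔ ∀ a ∈ K, ⁅a, v⁆ = 0 :=
  ⟨fun ⟨x, hx⟩ => hx ▸ x.2, fun hv => ⟨⟨v, hv⟩, rfl⟩⟩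

theorem invariantsIncl_lie (f : L' →ₗ⁅ℂ⁆ L) (K : Set L) (hK : ∀ a ∈ K, ∀ x, ⁅a, f x⁆ = 0)
    (M : LieMod L) (a : L') (x : (invariants f K hK).obj M) :
    invariantsIncl f K hK M ⁅a, x⁆ = ⁅f a, invariantsIncl f K hK M x⁆ := rfl

theorem invariantsIncl_map (f : L' →ₗ⁅ℂ⁆ L) (K : Set L) (hK : ∀ a ∈ K, ∀ x, ⁅a, f x⁆ = 0)
    {M N : LieMod L} (φ : M ⟶ N) (x : (invariants f K hK).obj M) :
    invariantsIncl f K hK N ((show (invariants f K hK).obj M →ₗ⁅ℂ,L'⁆ (invariants f K hK).obj N from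
      (invariants f K hK).map φ) x) = (show M →ₗ⁅ℂ,L⁆ N from φ) (invariantsIncl f K hK M x) := rfl

variable {f : L'' →ₗ⁅ℂ⁆ L} {g : L' →ₗ⁅ℂ⁆ L} {e : L'' →ₗ⁅ℂ⁆ L'} (hfg : ∀ x, f x = g (e x))
  {K₁ K₂ : Set L} {K₃ : Set L'} (hK₁ : ∀ a ∈ K₁, ∀ x, ⁅a, f x⁆ = 0)
  (hK₂ : ∀ a ∈ K₂, ∀ x, ⁅a, g x⁆ = 0) (hK₃ : ∀ a ∈ K₃, ∀ x, ⁅a, e x⁆ = 0) (h₂ : K₂ ⊆ K₁)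
  (h₃ : ∀ a ∈ K₃, g a ∈ K₁) (M : LieMod L)

/-- The comparison map does not move vectors. -/
theorem invariantsIncl_comparison (x : (invariants f K₁ hK₁).obj M) :
    invariantsIncl g K₂ hK₂ M (invariantsIncl e K₃ hK₃ _
      ((show (invariants f K₁ hK₁).obj M →ₗ⁅ℂ,L''⁆
        (invariants e K₃ hK₃).obj ((invariants g K₂ hK₂).obj M) from
      (invariantsComparison hfg hK₁ hK₂ hK₃ h₂ h₃).app M) x)) = invariantsIncl f K₁ hK₁ M x := rfl

theorem invariantsComparison_injective : Function.Injective
    (show (invariants f K₁ hK₁).obj M →ₗ⁅ℂ,L''⁆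
      (invariants e K₃ hK₃).obj ((invariants g K₂ hK₂).obj M) from
      (invariantsComparison hfg hK₁ hK₂ hK₃ h₂ h₃).app M) := fun x y hxy => by
  apply invariantsIncl_injective f K₁ hK₁ M
  rw [← invariantsIncl_comparison hfg hK₁ hK₂ hK₃ h₂ h₃, hxy, invariantsIncl_comparison]

theorem isIso_invariantsComparison
    (h : ∀ y, ∀ a ∈ K₁, ⁅a, invariantsIncl g K₂ hK₂ M (invariantsIncl e K₃ hK₃ _ y)⁆ = 0) :
    IsIso ((invariantsComparison hfg hK₁ hK₂ hK₃ h₂ h₃).app M) :=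
  LieMod.isIso_of_bijective _ ⟨invariantsComparison_injective hfg hK₁ hK₂ hK₃ h₂ h₃ M,
    fun y => ⟨⟨y.1.1, h y⟩, rfl⟩⟩

end Invariants

section Functors

variable {S T : Set ℕ}

/-- The inclusion of the invariants. -/
noncomputable abbrev invIncl (h : T ⊆ S) (M : LieMod (gl S)) : (invFunctor h).obj M →ₗ[ℂ] M :=
  invariantsIncl (LieSubalgebra.inclusion (gl_mono h)) (glPerp T S) (glPerp_commute h) M

theorem invIncl_injective (h : T ⊆ S) (M : LieMod (gl S)) :
    Function.Injective (invIncl h M) := invariantsIncl_injective _ _ _ M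

theorem mem_invSub_iff (M : LieMod (gl S)) (v : M) :
    (∀ a ∈ glPerp T S, ⁅a, v⁆ = 0) ↔ v ∈ glInv S T M.e := by
  constructor
  · intro hv i hi j hj
    refine hv (glE S i j) ?_
    change (glE S i j : Module.End ℂ CInf) ∈ gl (S \ T)
    rw [coe_glE hi.1 hj.1]
    exact E_mem hi hj
  · intro hv a ha
    have key : ∀ A : gl (S \ T), ⁅LieSubalgebra.inclusion (gl_mono Set.sdiff_subset) A, v⁆ = 0 := by
      intro A
      induction A using gl_induction with
      | hE i hi j hj =>
        rw [M.e_of_coe hi.1 hj.1 (A := LieSubalgebra.inclusion _ (glE (S \ T) i j))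
          (coe_glE hi hj)]
        exact hv i hi j hj
      | h0 => rw [map_zero, zero_lie]
      | hadd A B h1 h2 => rw [map_add, add_lie, h1, h2, add_zero]
      | hsmul c A h1 => rw [map_smul, smul_lie, h1, smul_zero]
    exact key ⟨a, ha⟩

theorem mem_glInv_iff (h : T ⊆ S) (M : LieMod (gl S)) (v : M) :
    v ∈ glInv S T M.e ↔ ∃ x, invIncl h M x = v := by
  rw [← mem_invSub_iff M v]
  exact (exists_invariantsIncl_iff _ _ _ M v).symm

theorem invIncl_e (h : T ⊆ S) (M : LieMod (gl S)) {i j : ℕ} (hi : i ∈ T) (hj : j ∈ T)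
    (x : (invFunctor h).obj M) :
    invIncl h M (((invFunctor h).obj M).e i j x) = M.e i j (invIncl h M x) :=
  M.e_of_coe (h hi) (h hj) (A := LieSubalgebra.inclusion (gl_mono h) (glE T i j))
    (coe_glE hi hj) _

theorem catO_invFunctor (h0 : 0 ∈ T) (h : T ⊆ S) {ν : ℂ} {M : LieMod (gl S)}
    (hM : catO ν S M) : catO ν T ((invFunctor h).obj M) := by
  rw [catO_iff _ h0]
  exact ((catO_iff M (h h0)).1 hM).of_glInv h0 h (invIncl_injective h M) (mem_glInv_iff h M)
    fun i hi j hj x => invIncl_e h M hi hj x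

theorem zero_mem_upTo (n : ℕ) : 0 ∈ upTo (n + 1) := Nat.succ_pos n

theorem resPreserves (ν : ℂ) : ResPreserves ν := fun n _ hM =>
  catO_invFunctor (zero_mem_upTo n) _ hM

theorem gammaPreserves (ν : ℂ) : GammaPreserves ν := fun n _ hM =>
  catO_invFunctor (zero_mem_upTo n) _ hM

/-- Invariance under `gl(S' \ T)` and under `gl(S \ S')` says nothing directly about the units with
one index in each set. It covers the diagonal units, and these suffice. -/
theorem isIso_invComparison {S' : Set ℕ} (h0 : 0 ∈ T) (h : T ⊆ S') (h' : S' ⊆ S)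
    {M : LieMod (gl S)} (hM : IsWtRep S (idxU S) M.e) : IsIso ((invComparison h h').app M) := by
  refine isIso_invariantsComparison _ _ _ _ _ _ M fun y => (mem_invSub_iff M _).2 ?_
  let N := (invFunctor h').obj M
  have h1 : invIncl h' M (invIncl h N y) ∈ glInv S S' M.e := (mem_glInv_iff h' M _).2 ⟨_, rfl⟩
  have h2 : invIncl h N y ∈ glInv S' T N.e := (mem_glInv_iff h N _).2 ⟨_, rfl⟩
  refine hM.mem_glInv_of_diag (sdiff_subset_idxU h0) fun i hi => ?_
  by_cases hiS : i ∈ S'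
  · exact (invIncl_e h' M hiS hiS (invIncl h N y)).symm.trans
      (by rw [h2 i ⟨hiS, hi.2⟩ i ⟨hiS, hi.2⟩, map_zero])
  · exact h1 i ⟨hi.1, hiS⟩ i ⟨hi.1, hiS⟩

theorem gammaCompatible (ν : ℂ) : GammaCompatible ν := fun n M hM =>
  isIso_invComparison (zero_mem_upTo n) _ _
    ((catO_iff M (Set.mem_univ 0)).1 hM).isWtRep

end Functors

/-! ### Lengths -/

section Length

variable {S : Set ℕ}

theorem IsStable.of_map {T : Set ℕ} {V V' : Type*} [AddCommGroup V] [Module ℂ V] [AddCommGroup V']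
    [Module ℂ V'] {e : ℕ → ℕ → Module.End ℂ V} {e' : ℕ → ℕ → Module.End ℂ V'} {ι : V' →ₗ[ℂ] V}
    (he : ∀ i ∈ T, ∀ j ∈ T, ∀ x, ι (e' i j x) = e i j (ι x)) {W : Submodule ℂ V'}
    (hW : IsStable T e' W) : IsStable T e (W.map ι) := by
  rintro i hi j hj _ ⟨x, hx, rfl⟩
  exact ⟨e' i j x, hW i hi j hj x hx, he i hi j hj x⟩

/-- The length does not grow when passing to invariants; moreover it drops when the invariants
generate a proper submodule. -/
theorem length_le_height {T : Set ℕ} (h0 : 0 ∈ T) (hT : T ⊆ S) {V : Type*} [AddCommGroup V]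
    [Module ℂ V] {e : ℕ → ℕ → Module.End ℂ V} (hM : IsWtRep S (idxU S) e) {N : LieMod (gl T)}
    {ι : N →ₗ[ℂ] V} (hι : Function.Injective ι) (hr : ∀ x, ι x ∈ glInv S T e)
    (he : ∀ i ∈ T, ∀ j ∈ T, ∀ x, ι (N.e i j x) = e i j (ι x)) :
    ∃ f : LieSubmodule ℂ (gl T) N → {W : Submodule ℂ V // IsStable S e W}, StrictMono f ∧
      ∀ W, (f W).1 = IsWtRep.lower S T e ((W : Submodule ℂ N).map ι) := by
  have hle : ∀ W : Submodule ℂ N, W.map ι ≤ glInv S T e := by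
    rintro W _ ⟨x, -, rfl⟩
    exact hr x
  have hst : ∀ W : LieSubmodule ℂ (gl T) N, IsStable T e ((W : Submodule ℂ N).map ι) :=
    fun W => (N.isStable_submodule W).of_map he
  refine ⟨fun W => ⟨_, hM.isStable_lower hT (sdiff_subset_idxU h0) (hle W) (hst W)⟩, ?_,
    fun _ => rfl⟩
  -- Injectivity: a submodule is recovered from what it generates by taking invariants.
  refine Monotone.strictMono_of_injective (fun W W' hW => ?_) fun W W' hW => ?_
  · exact IsWtRep.lower_mono S T e (Submodule.map_mono hW)
  · have h1 := congrArg (· ⊓ glInv S T e) (congrArg Subtype.val hW)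
    dsimp only at h1
    rw [hM.lower_inf_glInv hT (sdiff_subset_idxU h0) (hle W),
      hM.lower_inf_glInv hT (sdiff_subset_idxU h0) (hle W')] at h1
    exact LieSubmodule.toSubmodule_injective (Submodule.map_injective_of_injective hι h1)

/-- The lattice of stable subspaces is the lattice of submodules. -/
noncomputable def LieMod.stableOrderIso (M : LieMod (gl S)) :
    {W : Submodule ℂ M // IsStable S M.e W} ≃o LieSubmodule ℂ (gl S) M where
  toFun W := M.submoduleOfStable W.1 W.2
  invFun W := ⟨W, M.isStable_submodule W⟩
  left_inv _ := rfl
  right_inv _ := rfl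
  map_rel_iff' := Iff.rfl

theorem length_invFunctor_le {T : Set ℕ} (h0 : 0 ∈ T) (hT : T ⊆ S) {M : LieMod (gl S)}
    (hM : IsWtRep S (idxU S) M.e) : ((invFunctor hT).obj M).length ≤ M.length := by
  obtain ⟨f, hf, -⟩ := length_le_height h0 hT hM (invIncl_injective hT M)
    (fun x => (mem_glInv_iff hT M _).2 ⟨x, rfl⟩) fun i hi j hj x => invIncl_e hT M hi hj x
  exact (Order.height_le_height_apply_of_strictMono (fun W => M.stableOrderIso (f W))
    (M.stableOrderIso.strictMono.comp hf) ⊤).trans (Order.height_mono le_top)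

end Length

end ParabolicO

namespace ParabolicO

/-! ### A Casimir operator -/

section Casimir

variable {V : Type*} [AddCommGroup V] [Module ℂ V] {ν : ℂ} {S : Set ℕ}
  {e : ℕ → ℕ → Module.End ℂ V}

/-- The operator `ν - E_{00}`, which acts by the degree. -/
def degOp (ν : ℂ) (e : ℕ → ℕ → Module.End ℂ V) : Module.End ℂ V := ν • 1 - e 0 0

/-- A quadratic operator that commutes with the action; `T` is the set of non-zero indices. -/
noncomputable def casimir (ν : ℂ) (T : Finset ℕ) (e : ℕ → ℕ → Module.End ℂ V) :
    Module.End ℂ V :=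
  ∑ i ∈ T, e i 0 * e 0 i + (2⁻¹ : ℂ) • ∑ i ∈ T, ∑ j ∈ T, (e i j * e j i - e i i) +
    ((2⁻¹ : ℂ) • (degOp ν e * degOp ν e - degOp ν e) - ν • degOp ν e)

theorem IsGlRep.mul (h : IsGlRep S e) {i j k l : ℕ} (hi : i ∈ S) (hj : j ∈ S) (hk : k ∈ S)
    (hl : l ∈ S) : e i j * e k l =
      e k l * e i j + ((if j = k then e i l else 0) - if i = l then e k j else 0) := by
  ext v
  have := h i hi j hj k hk l hl v
  rw [Module.End.mul_apply, this, LinearMap.add_apply, Module.End.mul_apply, LinearMap.sub_apply]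
  congr 2 <;> split_ifs <;> rfl

/-- With `e 0 0 = ν - degOp`, the operator is half of the quadratic Casimir element of `gl({0} ∪
T)`, plus a multiple of the sum of all `e i i` and a scalar. Commutation with the lowering operators
is all that is used, and it is computed term by term. -/
theorem casimir_comm (h : IsGlRep S e) (h0 : 0 ∈ S) {T : Finset ℕ} (hT : (T : Set ℕ) ⊆ S)
    (h0T : 0 ∉ T) {k : ℕ} (hk : k ∈ T) : Commute (casimir ν T e) (e k 0) := by
  have hkS : k ∈ S := hT hk
  have hne : ∀ {i}, i ∈ T → i ≠ 0 := fun hi => ne_of_mem_of_not_mem hi h0T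
  have hA : (∑ i ∈ T, e i 0 * e 0 i) * e k 0 =
      e k 0 * (∑ i ∈ T, e i 0 * e 0 i) + e k 0 * e 0 0 - ∑ i ∈ T, e i 0 * e k i := by
    have h1 : ∀ i ∈ T, e i 0 * e 0 i * e k 0 =
        e k 0 * (e i 0 * e 0 i) + (if i = k then e k 0 * e 0 0 else 0) - e i 0 * e k i := by
      intro i hi
      have h2 := h.mul h0 (hT hi) hkS h0
      have h3 := h.mul (hT hi) h0 hkS h0
      rw [if_pos rfl] at h2
      rw [if_neg (hne hk).symm, if_neg (hne hi), sub_zero, add_zero] at h3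
      rw [mul_assoc, h2, mul_add, ← mul_assoc, h3, mul_assoc, mul_sub, add_sub_assoc]
      split_ifs with h4
      · rw [h4]
      · rw [mul_zero]
    rw [Finset.sum_mul, Finset.sum_congr rfl h1, Finset.sum_sub_distrib, Finset.sum_add_distrib,
      ← Finset.mul_sum, Finset.sum_ite_eq' T k, if_pos hk]
  have hC : (∑ i ∈ T, ∑ j ∈ T, (e i j * e j i - e i i)) * e k 0 =
      e k 0 * (∑ i ∈ T, ∑ j ∈ T, (e i j * e j i - e i i)) + (2 : ℂ) • ∑ i ∈ T, e i 0 * e k i := by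
    have h1 : ∀ i ∈ T, ∀ j ∈ T, (e i j * e j i - e i i) * e k 0 =
        e k 0 * (e i j * e j i - e i i) + (if j = k then e i 0 * e k i else 0) +
          (if i = k then e j 0 * e k j else 0) := by
      intro i hi j hj
      have h2 := h.mul (hT hj) (hT hi) hkS h0
      have h3 := h.mul (hT hi) (hT hj) hkS h0
      have h4 := h.mul (hT hi) (hT hi) hkS h0
      have h5 := h.mul (hT hi) (hT hj) (hT hj) h0
      rw [if_neg (hne hj), sub_zero] at h2
      rw [if_neg (hne hi), sub_zero] at h3 h4
      rw [if_pos rfl, if_neg (hne hi), sub_zero] at h5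
      rw [sub_mul, mul_assoc, h2, h4, mul_add, ← mul_assoc, h3, add_mul, mul_assoc, mul_sub]
      have h6 : (if j = k then e i 0 else 0) * e j i = if j = k then e i 0 * e k i else 0 := by
        split_ifs with h7
        · rw [h7]
        · rw [zero_mul]
      have h8 : e i j * (if i = k then e j 0 else 0) =
          (if i = k then e j 0 * e k j else 0) + if i = k then e i 0 else 0 := by
        split_ifs with h7
        · rw [h5, h7]
        · rw [mul_zero, add_zero]
      rw [h6, h8]
      abel
    have h2 : ∀ i ∈ T, (∑ j ∈ T, (e i j * e j i - e i i)) * e k 0 =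
        e k 0 * (∑ j ∈ T, (e i j * e j i - e i i)) + e i 0 * e k i +
          if i = k then ∑ j ∈ T, e j 0 * e k j else 0 := by
      intro i hi
      rw [Finset.sum_mul, Finset.sum_congr rfl (h1 i hi), Finset.sum_add_distrib,
        Finset.sum_add_distrib, ← Finset.mul_sum, Finset.sum_ite_eq' T k, if_pos hk]
      congr 1
      split_ifs
      · rfl
      · exact Finset.sum_const_zero
    rw [Finset.sum_mul, Finset.sum_congr rfl h2, Finset.sum_add_distrib, Finset.sum_add_distrib,
      ← Finset.mul_sum, Finset.sum_ite_eq' T k, if_pos hk, two_smul, add_assoc]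
  have hD : degOp ν e * e k 0 = e k 0 * degOp ν e + e k 0 := by
    have h1 := h.mul h0 h0 hkS h0
    rw [if_neg (hne hk).symm, if_pos rfl, zero_sub] at h1
    rw [degOp, sub_mul, mul_sub, h1, smul_mul_assoc, mul_smul_comm, one_mul, mul_one]
    abel
  have hDD : degOp ν e * degOp ν e * e k 0 =
      e k 0 * (degOp ν e * degOp ν e) + (2 : ℂ) • (e k 0 * degOp ν e) + e k 0 := by
    rw [mul_assoc, hD, mul_add, ← mul_assoc, hD, add_mul, mul_assoc, two_smul]
    abel
  have hE : e k 0 * e 0 0 = ν • e k 0 - e k 0 * degOp ν e := by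
    rw [degOp, mul_sub, mul_smul_comm, mul_one]
    abel
  rw [Commute, SemiconjBy, casimir]
  simp only [add_mul, sub_mul, smul_mul_assoc, mul_add, mul_sub, mul_smul_comm]
  rw [hA, hC, hDD, hD, hE]
  module

/-- The two shifts cancel, so the weight is unchanged; the intermediate set collects the weights
shifted once. -/
theorem IsWtRep.apply_apply_mem {I : Set ℕ} (h : IsWtRep S I e) {i j : ℕ} (hi : i ∈ S) (hj : j ∈ S)
    {A : Set (ℕ →₀ ℕ)} {v : V} (hv : v ∈ wtSpan I e A) : e i j (e j i v) ∈ wtSpan I e A := by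
  refine h.apply_mem_wtSpan hi hj (A := {μ' | ∃ μ ∈ A, (μ.support : Set ℕ) ⊆ I ∧
    ∀ k ∈ I, μ' k + (if k = i then 1 else 0) = μ k + if k = j then 1 else 0}) ?_
    (h.apply_mem_wtSpan hj hi ?_ hv)
  · rintro μ' ⟨μ, hμ, h1, h2⟩ μ'' - h3 h4
    rwa [ext_of_support_subset h3 h1 fun k hk => by have := h2 k hk; have := h4 k hk; omega]
  · exact fun μ hμ μ' h1 _ h2 => ⟨μ, hμ, h1, h2⟩

theorem casimir_mem_wtSpan {I : Set ℕ} (h : IsWtRep S I e) (h0 : 0 ∈ S) {T : Finset ℕ}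
    (hT : (T : Set ℕ) ⊆ S) (hdeg : ∀ A, ∀ v ∈ wtSpan I e A, e 0 0 v ∈ wtSpan I e A)
    (hdiag : ∀ A, ∀ i ∈ T, ∀ v ∈ wtSpan I e A, e i i v ∈ wtSpan I e A)
    {A : Set (ℕ →₀ ℕ)} {v : V} (hv : v ∈ wtSpan I e A) : casimir ν T e v ∈ wtSpan I e A := by
  have hD : ∀ v ∈ wtSpan I e A, degOp ν e v ∈ wtSpan I e A := fun v hv =>
    Submodule.sub_mem _ (Submodule.smul_mem _ ν hv) (hdeg A v hv)
  refine Submodule.add_mem _ (Submodule.add_mem _ ?_ (Submodule.smul_mem _ _ ?_))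
    (Submodule.sub_mem _ (Submodule.smul_mem _ _ (Submodule.sub_mem _ (hD _ (hD v hv)) (hD v hv)))
      (Submodule.smul_mem _ _ (hD v hv)))
  · rw [LinearMap.sum_apply]
    exact Submodule.sum_mem _ fun i hi => h.apply_apply_mem (hT hi) h0 hv
  · rw [LinearMap.sum_apply]
    refine Submodule.sum_mem _ fun i hi => ?_
    rw [LinearMap.sum_apply]
    exact Submodule.sum_mem _ fun j hj => Submodule.sub_mem _
      (h.apply_apply_mem (hT hi) (hT hj) hv) (hdiag A i hi v hv)

theorem wtSpan_diag {I : Set ℕ} (A : Set (ℕ →₀ ℕ)) {i : ℕ} (hi : i ∈ I) {v : V}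
    (hv : v ∈ wtSpan I e A) : e i i v ∈ wtSpan I e A := by
  refine (wtSpan_induction (W := (wtSpan I e A).comap (e i i)) fun μ hμ hI v hv => ?_) hv
  rw [Submodule.mem_comap, hv i hi]
  exact Submodule.smul_mem _ _ (hv.mem_wtSpan hμ hI)

theorem IsO.wtSpan_zero (h : IsO ν S e) (A : Set (ℕ →₀ ℕ)) {v : V}
    (hv : v ∈ wtSpan (idxU S) e A) : e 0 0 v ∈ wtSpan (idxU S) e A := by
  refine (wtSpan_induction (W := (wtSpan (idxU S) e A).comap (e 0 0)) fun μ hμ hI v hv => ?_) hv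
  rw [Submodule.mem_comap, h.deg_wt hI hv]
  exact Submodule.smul_mem _ _ (hv.mem_wtSpan hμ hI)

/-- In finite rank the Casimir operator satisfies a polynomial equation. -/
theorem IsO.exists_polynomial (h : IsO ν S e) (h0 : 0 ∈ S) {T : Finset ℕ}
    (hT : (T : Set ℕ) = idxU S) : ∃ P : Polynomial ℂ, P ≠ 0 ∧
      Polynomial.aeval (casimir ν T e) P = 0 := by
  have hS : S.Finite := by
    refine (T.finite_toSet.insert 0).subset fun i hi => ?_
    by_cases h : i = 0
    · exact Or.inl h
    · exact Or.inr (hT ▸ ⟨hi, h⟩)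
  have hTS : (T : Set ℕ) ⊆ S := hT ▸ idxU_subset S
  have h0T : 0 ∉ T := fun h => zero_notMem_idxU S (hT ▸ h)
  obtain ⟨m, hm⟩ := h.exists_bound
  have := h.finiteDimensional h0 hS m
  set F := wtSpan (idxU S) e {μ | μ.degree ≤ m}
  set Ω := casimir ν T e
  -- The Casimir operator preserves all weights, so it acts on the finite-dimensional part of degree
  -- at most `m`, and the polynomial is the minimal polynomial there.
  have hF : ∀ v ∈ F, Ω v ∈ F := fun v hv => casimir_mem_wtSpan h.isWtRep h0 hTS
    (fun A v hv => h.wtSpan_zero A hv)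
    (fun A i hi v hv => wtSpan_diag A (hT ▸ hi) hv) hv
  let Ω' : Module.End ℂ F := Ω.restrict hF
  refine ⟨minpoly ℂ Ω', minpoly.ne_zero (Algebra.IsIntegral.isIntegral Ω'), ?_⟩
  have h1 : ∀ (P : Polynomial ℂ) (v : F), Polynomial.aeval Ω P v = Polynomial.aeval Ω' P v := by
    intro P
    induction P using Polynomial.induction_on' with
    | add p q hp hq => intro v; simp [hp, hq]
    | monomial n c =>
      intro v
      rw [Polynomial.aeval_monomial, Polynomial.aeval_monomial]
      have : ∀ v : F, (Ω ^ n) v = ((Ω' ^ n) v : F) := by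
        induction n with
        | zero => simp
        | succ n ih =>
          intro v
          rw [pow_succ, pow_succ, Module.End.mul_apply, Module.End.mul_apply, ← ih]
          rfl
      rw [Module.End.mul_apply, Module.End.mul_apply, this]
      simp [Module.algebraMap_end_apply]
  have h2 : ∀ k ∈ T, ∀ P : Polynomial ℂ, Commute (Polynomial.aeval Ω P) (e k 0) := by
    intro k hk P
    induction P using Polynomial.induction_on' with
    | add p q hp hq => rw [map_add]; exact hp.add_left hq
    | monomial n c =>
      rw [Polynomial.aeval_monomial]
      exact Commute.mul_left (Algebra.commutes c (e k 0))
        ((casimir_comm h.gl h0 hTS h0T hk).pow_left n)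
  -- The kernel contains the generating part and is stable under the lowering operators, as these
  -- commute with the Casimir operator.
  have h3 : (⊤ : Submodule ℂ V) ≤ LinearMap.ker (Polynomial.aeval Ω (minpoly ℂ Ω')) := by
    rw [← hm]
    refine opClosure_le (fun v hv => ?_) ?_
    · rw [SetLike.mem_coe, LinearMap.mem_ker]
      exact (h1 _ ⟨v, hv⟩).trans (by rw [minpoly.aeval]; rfl)
    · rintro _ ⟨k, hk, rfl⟩ v hv
      rw [LinearMap.mem_ker] at hv ⊢
      have := congrArg (fun g : Module.End ℂ V => g v)
        (h2 k (Finset.mem_coe.1 (hT ▸ hk)) (minpoly ℂ Ω')).eq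
      simp only [Module.End.mul_apply] at this
      rw [this, hv, map_zero]
  ext v
  exact h3 (Submodule.mem_top (x := v))

end Casimir

end ParabolicO

namespace ParabolicO

/-! ### Eigenvalues of the Casimir operator on vectors singular modulo a submodule. -/

section Eigenvalue

variable {V : Type*} [AddCommGroup V] [Module ℂ V] {ν : ℂ} {S : Set ℕ}
  {e : ℕ → ℕ → Module.End ℂ V}

/-- The contribution of the indices `i` and `j` to the eigenvalues of the Casimir operator. -/
def eigenPart (μ : ℕ →₀ ℕ) (i j : ℕ) : ℝ :=
  if i = j then (μ i : ℝ) * μ i - μ i else -(μ (max i j) : ℝ)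

theorem neg_le_eigenPart (μ : ℕ →₀ ℕ) (i j : ℕ) : -((μ i : ℝ) + μ j) ≤ eigenPart μ i j := by
  have hi : (0 : ℝ) ≤ μ i := Nat.cast_nonneg _
  have hj : (0 : ℝ) ≤ μ j := Nat.cast_nonneg _
  rw [eigenPart]
  split_ifs with h
  · nlinarith
  · rcases le_total i j with h1 | h1
    · rw [max_eq_right h1]; linarith
    · rw [max_eq_left h1]; linarith

/-- The eigenvalue of the Casimir operator on singular vectors. -/
noncomputable def eigenvalue (ν : ℂ) (T : Finset ℕ) (μ : ℕ →₀ ℕ) : ℂ :=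
  2⁻¹ * ∑ i ∈ T, ∑ j ∈ T, (eigenPart μ i j : ℂ) +
    (2⁻¹ * ((μ.degree : ℂ) * μ.degree - μ.degree) - ν * μ.degree)

/-- Modulo `N`, the operators `e 0 i` and `e i j` with `i < j` kill `v`. Hence `e i j * e j i - e i
i` acts by `-μ j` for `i < j`, after commuting, and by `-μ i` for `i > j`, where the product itself
vanishes. Both are minus the weight at the larger index. -/
theorem casimir_sub_eigenvalue_mem (h : IsO ν S e) {T : Finset ℕ} (hT : (T : Set ℕ) = idxU S)
    {N : Submodule ℂ V} (h0 : 0 ∈ S) (hN : IsStable S e N) {μ : ℕ →₀ ℕ}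
    (hμ : (μ.support : Set ℕ) ⊆ idxU S) {v : V} (hv : IsWt (idxU S) e μ v)
    (h1 : ∀ i ∈ T, e 0 i v ∈ N) (h2 : ∀ i ∈ T, ∀ j ∈ T, i < j → e i j v ∈ N) :
    casimir ν T e v - eigenvalue ν T μ • v ∈ N := by
  have hTS : ∀ {i}, i ∈ T → i ∈ S := fun hi => idxU_subset S (hT ▸ Finset.mem_coe.2 hi)
  have hwt : ∀ {i}, i ∈ T → e i i v = (μ i : ℂ) • v := fun hi => hv _ (hT ▸ Finset.mem_coe.2 hi)
  have hD : degOp ν e v = (μ.degree : ℂ) • v := by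
    rw [degOp, LinearMap.sub_apply, h.deg_wt hμ hv, LinearMap.smul_apply, Module.End.one_apply]
    module
  have hq : ∀ i ∈ T, ∀ j ∈ T, e i j (e j i v) - e i i v - (eigenPart μ i j : ℂ) • v ∈ N := by
    intro i hi j hj
    rw [eigenPart]
    rcases lt_trichotomy i j with hij | hij | hij
    · rw [if_neg hij.ne, max_eq_right hij.le, h.gl i (hTS hi) j (hTS hj) j (hTS hj) i (hTS hi),
        if_pos rfl, if_pos rfl, hwt hj]
      have := hN j (hTS hj) i (hTS hi) _ (h2 i hi j hj hij)
      convert this using 1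
      push_cast
      module
    · subst hij
      rw [if_pos rfl, hwt hi, map_smul, hwt hi]
      convert N.zero_mem using 1
      push_cast
      module
    · rw [if_neg hij.ne', max_eq_left hij.le, hwt hi]
      have := hN i (hTS hi) j (hTS hj) _ (h2 j hj i hi hij)
      convert this using 1
      push_cast
      module
  have hDD : (degOp ν e * degOp ν e - degOp ν e) v =
      ((μ.degree : ℂ) * μ.degree - μ.degree) • v := by
    rw [LinearMap.sub_apply, Module.End.mul_apply, hD, map_smul, hD]
    module
  have h3 : ∑ i ∈ T, e i 0 (e 0 i v) ∈ N :=
    Submodule.sum_mem _ fun i hi => hN i (hTS hi) 0 h0 _ (h1 i hi)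
  have h4 : ∑ i ∈ T, ∑ j ∈ T, (e i j (e j i v) - e i i v - (eigenPart μ i j : ℂ) • v) ∈ N :=
    Submodule.sum_mem _ fun i hi => Submodule.sum_mem _ fun j hj => hq i hi j hj
  convert Submodule.add_mem _ h3 (Submodule.smul_mem _ (2⁻¹ : ℂ) h4) using 1
  rw [casimir, LinearMap.add_apply, LinearMap.add_apply, LinearMap.sub_apply,
    LinearMap.smul_apply, LinearMap.smul_apply, LinearMap.smul_apply, hDD, hD, eigenvalue]
  simp only [LinearMap.sum_apply, Module.End.mul_apply, LinearMap.sub_apply,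
    Finset.sum_sub_distrib, ← Finset.sum_smul]
  module

/-- For a fixed `T` the quadratic growth comes from `degOp`: the sum over `T` is at least `-2 *
T.card` times the degree, and the `ν`-term is linear in the degree. -/
theorem le_re_eigenvalue {ν : ℂ} {T : Finset ℕ} {μ : ℕ →₀ ℕ} (hμ : μ.support ⊆ T) :
    2⁻¹ * (μ.degree : ℝ) * μ.degree - (T.card + 2⁻¹ + ‖ν‖) * μ.degree ≤
      ‖eigenvalue ν T μ‖ := by
  have hd : ∑ i ∈ T, (μ i : ℝ) = μ.degree := by
    rw [Finsupp.degree_apply]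
    push_cast
    exact (Finset.sum_subset hμ fun i _ hi => by
      rw [Finsupp.notMem_support_iff.1 hi, Nat.cast_zero]).symm
  have h1 : -(2 * T.card * (μ.degree : ℝ)) ≤ ∑ i ∈ T, ∑ j ∈ T, eigenPart μ i j := by
    refine le_trans (le_of_eq ?_) (Finset.sum_le_sum fun i _ =>
      Finset.sum_le_sum fun j _ => neg_le_eigenPart μ i j)
    simp only [Finset.sum_neg_distrib, Finset.sum_add_distrib, Finset.sum_const, hd,
      nsmul_eq_mul, ← Finset.mul_sum]
    ring
  have h2 : (eigenvalue ν T μ).re = 2⁻¹ * ∑ i ∈ T, ∑ j ∈ T, eigenPart μ i j +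
      (2⁻¹ * ((μ.degree : ℝ) * μ.degree - μ.degree) - ν.re * μ.degree) := by
    rw [eigenvalue]
    norm_cast
    simp
  have h3 : ν.re * μ.degree ≤ ‖ν‖ * μ.degree :=
    mul_le_mul_of_nonneg_right (Complex.re_le_norm ν) (Nat.cast_nonneg _)
  refine le_trans ?_ (Complex.re_le_norm _)
  rw [h2]
  linarith

/-- In finite rank, the degrees of the singular vectors of the subquotients are bounded. -/
theorem IsO.exists_singular_bound (h : IsO ν S e) (h0 : 0 ∈ S) {T : Finset ℕ}
    (hT : (T : Set ℕ) = idxU S) : ∃ D : ℕ, ∀ N : Submodule ℂ V, IsStable S e N →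
      ∀ (μ : ℕ →₀ ℕ) (v : V), (μ.support : Set ℕ) ⊆ idxU S → IsWt (idxU S) e μ v → v ∉ N →
      (∀ i ∈ T, e 0 i v ∈ N) → (∀ i ∈ T, ∀ j ∈ T, i < j → e i j v ∈ N) → μ.degree ≤ D := by
  obtain ⟨P, hP0, hP⟩ := h.exists_polynomial h0 hT
  obtain ⟨R, hR⟩ := (P.roots.toFinset.image fun z => ‖z‖).bddAbove
  -- With `K = T.card + 2⁻¹ + ‖ν‖`, a degree `x > 2 * K + 2 * |R| + 1` gives `x * (x / 2 - K) >
  -- |R|`, which exceeds the norm of every root of `P`.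
  refine ⟨⌈2 * (T.card + 2⁻¹ + ‖ν‖) + 2 * |R|⌉₊ + 1, fun N hN μ v hμ hv hvN h1 h2 => ?_⟩
  set c := eigenvalue ν T μ
  have hΩ : casimir ν T e v - c • v ∈ N := casimir_sub_eigenvalue_mem h hT h0 hN hμ hv h1 h2
  have hTS : ∀ {i}, i ∈ T → i ∈ S := fun hi => idxU_subset S (hT ▸ Finset.mem_coe.2 hi)
  have hΩN : ∀ w ∈ N, casimir ν T e w ∈ N := by
    intro w hw
    have hD : ∀ w ∈ N, degOp ν e w ∈ N := fun w hw =>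
      Submodule.sub_mem _ (Submodule.smul_mem _ ν hw) (hN 0 h0 0 h0 w hw)
    refine Submodule.add_mem _ (Submodule.add_mem _ ?_ (Submodule.smul_mem _ _ ?_))
      (Submodule.sub_mem _ (Submodule.smul_mem _ _ (Submodule.sub_mem _ (hD _ (hD w hw)) (hD w hw)))
        (Submodule.smul_mem _ _ (hD w hw)))
    · rw [LinearMap.sum_apply]
      exact Submodule.sum_mem _ fun i hi => hN i (hTS hi) 0 h0 _ (hN 0 h0 i (hTS hi) w hw)
    · rw [LinearMap.sum_apply]
      refine Submodule.sum_mem _ fun i hi => ?_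
      rw [LinearMap.sum_apply]
      exact Submodule.sum_mem _ fun j hj => Submodule.sub_mem _
        (hN i (hTS hi) j (hTS hj) _ (hN j (hTS hj) i (hTS hi) w hw))
        (hN i (hTS hi) i (hTS hi) w hw)
  have hpow : ∀ n, (casimir ν T e ^ n) v - c ^ n • v ∈ N := by
    intro n
    induction n with
    | zero => simp
    | succ n ih =>
      convert Submodule.add_mem _ (hΩN _ ih) (Submodule.smul_mem _ (c ^ n) hΩ) using 1
      rw [pow_succ', Module.End.mul_apply, map_sub, map_smul]
      module
  have heval : ∀ Q : Polynomial ℂ, Polynomial.aeval (casimir ν T e) Q v - Q.eval c • v ∈ N := by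
    intro Q
    induction Q using Polynomial.induction_on' with
    | add p q hp hq =>
      convert Submodule.add_mem _ hp hq using 1
      rw [map_add, LinearMap.add_apply, Polynomial.eval_add]
      module
    | monomial n a =>
      convert Submodule.smul_mem _ a (hpow n) using 1
      rw [Polynomial.aeval_monomial, Polynomial.eval_monomial, Module.End.mul_apply,
        Module.algebraMap_end_apply]
      module
  -- Modulo `N` the zero operator `P(Ω)` acts on `v` by `P(c)`, and `v` is non-zero there.
  have hc : P.eval c = 0 := by
    by_contra hc
    have := heval P
    rw [hP, LinearMap.zero_apply, zero_sub, Submodule.neg_mem_iff] at this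
    exact hvN ((Submodule.smul_mem_iff _ hc).1 this)
  have hcR : ‖c‖ ≤ R := hR (by
    rw [Finset.mem_coe, Finset.mem_image]
    exact ⟨c, Multiset.mem_toFinset.2 ((Polynomial.mem_roots hP0).2 hc), rfl⟩)
  have h3 : 2⁻¹ * (μ.degree : ℝ) * μ.degree - (T.card + 2⁻¹ + ‖ν‖) * μ.degree ≤ |R| :=
    ((le_re_eigenvalue fun i hi => Finset.mem_coe.1 (hT ▸ hμ hi)).trans hcR).trans (le_abs_self R)
  by_contra! hlt
  have h4 : 2 * (T.card + 2⁻¹ + ‖ν‖) + 2 * |R| + 1 < (μ.degree : ℝ) := by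
    have h5 := Nat.le_ceil (2 * (T.card + 2⁻¹ + ‖ν‖) + 2 * |R|)
    have h6 : ((⌈2 * (T.card + 2⁻¹ + ‖ν‖) + 2 * |R|⌉₊ + 1 : ℕ) : ℝ) < μ.degree := by
      exact_mod_cast hlt
    push_cast at h6
    linarith
  have hK : (0 : ℝ) ≤ T.card + 2⁻¹ + ‖ν‖ := by positivity
  have hR0 := abs_nonneg R
  generalize (T.card + 2⁻¹ + ‖ν‖ : ℝ) = K at *
  generalize (μ.degree : ℝ) = x at *
  generalize |R| = r at *
  nlinarith [mul_nonneg hR0 (by linarith : (0 : ℝ) ≤ x - 1)]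

end Eigenvalue

end ParabolicO

namespace ParabolicO

attribute [local instance 100] LieRing.ofAssociativeRing

/-! ### Finiteness of the length -/

section FiniteLength

variable {V : Type*} [AddCommGroup V] [Module ℂ V] {ν : ℂ} {S : Set ℕ}
  {e : ℕ → ℕ → Module.End ℂ V}

theorem ne_zero_of_mem_idxU {i : ℕ} (hi : i ∈ idxU S) : i ≠ 0 := hi.2

theorem lowerWord_map (l : List (idxU S)) {g : Module.End ℂ V}
    (hg : ∀ j ∈ l, ∀ v, g (e j 0 v) = e j 0 (g v)) (v : V) :
    g (lowerWord e l v) = lowerWord e l (g v) := by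
  induction l with
  | nil => rfl
  | cons j l ih =>
    change g (e j 0 (lowerWord e l v)) = e j 0 (lowerWord e l (g v))
    rw [hg j List.mem_cons_self, ih fun k hk => hg k (List.mem_cons_of_mem j hk)]

theorem IsGlRep.lower_comm (h : IsGlRep S e) (h0 : 0 ∈ S) {i j : ℕ} (hi : i ∈ idxU S)
    (hj : j ∈ idxU S) (v : V) : e i 0 (e j 0 v) = e j 0 (e i 0 v) := by
  rw [h i hi.1 0 h0 j hj.1 0 h0, if_neg (ne_zero_of_mem_idxU hj).symm,
    if_neg (ne_zero_of_mem_idxU hi), sub_zero, add_zero]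

/-- The lowering operators commute, so all factors `e i 0` can be collected next to `v`. -/
theorem lowerWord_eq_filter (h : IsGlRep S e) (h0 : 0 ∈ S) {i : ℕ} (hi : i ∈ idxU S)
    (l : List (idxU S)) (v : V) : ∃ l' : List (idxU S), ∃ n, (∀ j ∈ l', (j : ℕ) ≠ i) ∧
      l'.length + n = l.length ∧ lowerWord e l v = lowerWord e l' ((e i 0 ^ n) v) := by
  induction l with
  | nil => exact ⟨[], 0, by simp, rfl, rfl⟩
  | cons j l ih =>
    obtain ⟨l', n, h1, h2, h3⟩ := ih
    by_cases hj : (j : ℕ) = i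
    · refine ⟨l', n + 1, h1, by rw [List.length_cons, ← h2, add_assoc], ?_⟩
      change e j 0 (lowerWord e l v) = _
      rw [h3, hj, lowerWord_map _ fun k _ v => h.lower_comm h0 hi k.2 v, pow_succ',
        Module.End.mul_apply]
    · refine ⟨j :: l', n, ?_, by rw [List.length_cons, List.length_cons, ← h2]; omega, ?_⟩
      · intro k hk
        rcases List.mem_cons.1 hk with rfl | hk
        · exact hj
        · exact h1 k hk
      · exact congrArg (e j 0) h3

theorem IsGlRep.apply_lower_pow (h : IsGlRep S e) (h0 : 0 ∈ S) {i j : ℕ} (hi : i ∈ idxU S)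
    (hj : j ∈ idxU S) (n : ℕ) (v : V) : e i j ((e j 0 ^ (n + 1)) v) =
      (e j 0 ^ (n + 1)) (e i j v) + ((n + 1 : ℕ) : ℂ) • e i 0 ((e j 0 ^ n) v) := by
  have h1 : ∀ v, e i j (e j 0 v) = e j 0 (e i j v) + e i 0 v := fun v => by
    rw [h i hi.1 j hj.1 j hj.1 0 h0, if_pos rfl,
      if_neg (ne_zero_of_mem_idxU hi), sub_zero]
  induction n with
  | zero => simp [h1]
  | succ n ih =>
    rw [pow_succ' _ (n + 1), Module.End.mul_apply, Module.End.mul_apply, h1, ih, map_add, map_smul,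
      h.lower_comm h0 hj hi, ← Module.End.mul_apply (e j 0) (e j 0 ^ n), ← pow_succ']
    push_cast
    module

/-- A subspace stable under `gl(U)` that contains all vectors of degree `m + k` in the weight
spaces with `μ j ≥ k` contains all vectors of degree `m + k`. -/
theorem wtSpan_degree_le (h : IsWtRep S (idxU S) e) (h0 : 0 ∈ S) {j : ℕ} (hj : j ∈ idxU S) {m k : ℕ}
    (hm : opClosure {g | ∃ i ∈ idxU S, g = e i 0} (wtSpan (idxU S) e {μ | μ.degree ≤ m}) = ⊤)
    {C : Submodule ℂ V} (hC : IsStable (idxU S) e C)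
    (hk : wtSpan (idxU S) e {μ | μ.degree = m + k ∧ k ≤ μ j} ≤ C) :
    wtSpan (idxU S) e {μ | μ.degree = m + k} ≤ C := by
  have hpow : ∀ n p, ∀ q ∈ wtSpan (idxU S) e {μ | μ.degree = p},
      (e j 0 ^ n) q ∈ wtSpan (idxU S) e {μ | μ.degree = p + n ∧ n ≤ μ j} := by
    intro n p q hq
    induction n with
    | zero => simpa using hq
    | succ n ih =>
      rw [pow_succ', Module.End.mul_apply]
      refine h.apply_mem_wtSpan hj.1 h0 (fun μ hμ μ' h1 h2 h3 => ?_) ih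
      have h4 := degree_of_raise h1 h2 hj (zero_notMem_idxU S) h3
      have h5 := h3 j hj
      rw [if_neg (ne_zero_of_mem_idxU hj), if_pos rfl] at h5
      simp only [Set.mem_ofPred_eq] at hμ ⊢
      omega
  -- Induction on the number of lowering operators with index different from `j`: each of them is
  -- traded for one more factor `e j 0`.
  have key : ∀ (N : ℕ) (l : List (idxU S)), l.length = N → (∀ i ∈ l, (i : ℕ) ≠ j) → ∀ n p, p ≤ m →
      p + l.length + n = m + k → ∀ q ∈ wtSpan (idxU S) e {μ | μ.degree = p},
      lowerWord e l ((e j 0 ^ n) q) ∈ C := by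
    intro N
    induction N with
    | zero =>
      intro l hl _ n p hp hn q hq
      rw [List.length_eq_zero_iff] at hl
      subst hl
      rw [List.length_nil] at hn
      -- Only `e j 0` is left, and `n = m + k - p ≥ k` because `p ≤ m`.
      refine hk (wtSpan_mono ?_ (hpow n p q hq))
      rintro μ ⟨h1, h2⟩
      exact ⟨by omega, by omega⟩
    | succ N ih =>
      intro l hl hlj n p hp hn q hq
      obtain ⟨i, l, rfl⟩ := List.exists_cons_of_length_eq_add_one hl
      have hlj' : ∀ i' ∈ l, (i' : ℕ) ≠ j := fun i' hi' => hlj i' (List.mem_cons_of_mem i hi')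
      rw [List.length_cons] at hl hn
      have h1 := ih l (by omega) hlj' (n + 1) p hp (by omega) q hq
      have h2 := ih l (by omega) hlj' (n + 1) p hp (by omega) (e i j q)
        (h.apply_mem_wtSpan i.2.1 hj.1 (fun μ hμ μ' h1 h2 h3 =>
          (degree_of_move h1 h2 i.2 hj h3).trans hμ) hq)
      -- Applying `e i j` to the word with `n + 1` factors `e j 0` gives a word of the kind `h2`
      -- plus `n + 1` times the desired word, and `n + 1` is invertible.
      have h3 := hC i i.2 j hj _ h1
      rw [lowerWord_map l fun j' hj' v => ?_, h.gl.apply_lower_pow h0 i.2 hj] at h3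
      · change e i 0 (lowerWord e l _) ∈ C
        rw [lowerWord_map l fun j' _ v => h.gl.lower_comm h0 i.2 j'.2 v]
        have h4 : ∀ (l : List (idxU S)) (c : ℂ) (x y : V),
            lowerWord e l (x + c • y) = lowerWord e l x + c • lowerWord e l y := by
          intro l c x y
          induction l with
          | nil => rfl
          | cons i l ih =>
            change e i 0 (lowerWord e l _) = e i 0 (lowerWord e l _) + c • e i 0 (lowerWord e l _)
            rw [ih, map_add, map_smul]
        rw [h4] at h3
        exact (Submodule.smul_mem_iff _ (Nat.cast_ne_zero (R := ℂ).2 (Nat.succ_ne_zero n))).1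
          ((Submodule.add_mem_iff_right _ h2).1 h3)
      · rw [h.gl i i.2.1 j hj.1 j' j'.2.1 0 h0, if_neg (hlj' j' hj').symm,
          if_neg (ne_zero_of_mem_idxU i.2), sub_zero, add_zero]
  intro x hx
  let κ := {p : (ℕ →₀ ℕ) × V // p.1.degree ≤ m ∧ (p.1.support : Set ℕ) ⊆ idxU S ∧
    IsWt (idxU S) e p.1 p.2}
  have htop : opClosure {g | ∃ i ∈ idxU S, g = e i 0} (Set.range fun p : κ => p.1.2) = ⊤ := by
    rw [eq_top_iff, ← hm]
    refine opClosure_le ?_ fun g hg w hw => opClosure_apply hg hw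
    exact wtSpan_induction fun μ hμ hI v hv => subset_opClosure _ _ ⟨⟨(μ, v), hμ, hI, hv⟩, rfl⟩
  have h2 := mem_span_of_mem_wtSpan (I := idxU S) (e := e) (κ := List (idxU S) × κ)
    (b := fun p => lowerWord e p.1 p.2.1.2) (μ := fun p => listWt p.1 + p.2.1.1)
    (fun p => support_add_subset_iff.2 ⟨support_listWt_subset _, p.2.2.2.1⟩)
    (fun p => h.isWt_lowerWord h0 _ p.2.2.2.2) (x := x)
    (by rw [span_lowerWord htop subset_rfl]; exact Submodule.mem_top) hx
  refine Submodule.span_le.2 ?_ h2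
  rintro _ ⟨⟨l, ⟨μ, v⟩, hμ, hI, hv⟩, hp, rfl⟩
  obtain ⟨l', n, h3, h4, h5⟩ := lowerWord_eq_filter h.gl h0 hj l v
  have hp : (listWt l).degree + μ.degree = m + k := (map_add _ _ _).symm.trans hp
  rw [degree_listWt] at hp
  change lowerWord e l v ∈ C
  rw [h5]
  exact key _ l' rfl h3 n μ.degree hμ (by omega) v (hv.mem_wtSpan (by exact rfl) hI)

/-- A non-zero `gl(U)`-submodule of degree `m + k` has weights with `μ j ≥ k`. -/
theorem exists_wt_ge (h : IsWtRep S (idxU S) e) (h0 : 0 ∈ S) {j : ℕ} (hj : j ∈ idxU S) {m k : ℕ}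
    (hm : opClosure {g | ∃ i ∈ idxU S, g = e i 0} (wtSpan (idxU S) e {μ | μ.degree ≤ m}) = ⊤)
    {W C : Submodule ℂ V} (hW : IsStable (idxU S) e W) (hC : IsStable (idxU S) e C)
    (hWC : IsCompl W C) (hd : W ≤ wtSpan (idxU S) e {μ | μ.degree = m + k}) (hW0 : W ≠ ⊥) :
    ∃ μ : ℕ →₀ ℕ, (μ.support : Set ℕ) ⊆ idxU S ∧ μ.degree = m + k ∧ k ≤ μ j ∧
      ∃ v ∈ W, v ≠ 0 ∧ IsWt (idxU S) e μ v := by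
  by_contra! hcon
  refine hW0 (eq_bot_iff.2 ?_)
  rw [← hWC.inf_eq_bot]
  -- If `W` had no non-zero vector of such a weight, all vectors of these weights would lie in `C`,
  -- since the component in `W` of a weight vector is a weight vector. Then `C` contains everything
  -- of this degree, including `W`.
  refine le_inf le_rfl (hd.trans (wtSpan_degree_le h h0 hj hm hC ?_))
  refine wtSpan_induction fun μ hμ hI y hy => ?_
  obtain ⟨a, ha, c, hc, rfl⟩ := Submodule.mem_sup.1 (hWC.sup_eq_top ▸ Submodule.mem_top (x := y))
  have haw : IsWt (idxU S) e μ a := by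
    intro i hi
    have h1 : e i i a - (μ i : ℂ) • a ∈ W :=
      Submodule.sub_mem _ (hW i hi i hi a ha) (Submodule.smul_mem _ _ ha)
    have h2 : e i i a - (μ i : ℂ) • a = -(e i i c - (μ i : ℂ) • c) := by
      have := hy i hi
      rw [map_add, smul_add] at this
      rw [neg_sub, sub_eq_sub_iff_add_eq_add, this, add_comm]
    have h3 : e i i a - (μ i : ℂ) • a ∈ C := by
      rw [h2]
      exact Submodule.neg_mem _
        (Submodule.sub_mem _ (hC i hi i hi c hc) (Submodule.smul_mem _ _ hc))
    exact sub_eq_zero.1 ((Submodule.disjoint_def.1 hWC.disjoint) _ h1 h3)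
  by_cases ha0 : a = 0
  · rwa [ha0, zero_add]
  · exact absurd haw (hcon μ hI hμ.1 hμ.2 a ha ha0)

end FiniteLength

end ParabolicO

namespace ParabolicO

attribute [local instance 100] LieRing.ofAssociativeRing

/-! ### A bound for the degrees in which submodules of a `gl_∞`-module differ. -/

section FiniteLength

variable {S : Set ℕ}

theorem LieMod.exists_isCompl_of_isStable {T : Set ℕ} (hT : T ⊆ S) (M : LieMod (gl S))
    (h : tensorSpan T M.e = ⊤) {W : Submodule ℂ M} (hW : IsStable T M.e W) :
    ∃ W', IsStable T M.e W' ∧ IsCompl W W' := by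
  have h1 : tensorSpan T (resGl hT M).e = ⊤ := by
    rw [← h]
    exact tensorSpan_congr fun _ hi _ hj v => resGl_e hT M hi hj v
  obtain ⟨W', hW', hc⟩ := exists_isCompl_of_tensorSpan h1 (W := W) fun i hi j hj v hv => by
    rw [resGl_e hT M hi hj]
    exact hW i hi j hj v hv
  refine ⟨W', fun i hi j hj v hv => ?_, hc⟩
  rw [← resGl_e hT M hi hj]
  exact hW' i hi j hj v hv

theorem IsWtRep.isStable_wtSpan_degree {V : Type*} [AddCommGroup V] [Module ℂ V]
    {e : ℕ → ℕ → Module.End ℂ V} (h : IsWtRep S (idxU S) e) (d : ℕ) :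
    IsStable (idxU S) e (wtSpan (idxU S) e {μ | μ.degree = d}) := fun _ hi _ hj _ hv =>
  h.apply_mem_wtSpan hi.1 hj.1 (fun _ hμ _ h1 h2 h3 => (degree_of_move h1 h2 hi hj h3).trans hμ) hv

/-- A weight vector of minimal degree in a subquotient can be replaced by one with at most `m`
boxes outside the `j`-th coordinate. -/
theorem exists_wt_large {ν : ℂ} {M : LieMod (gl S)} (h : IsO ν S M.e) (h0 : 0 ∈ S) {j m k : ℕ}
    (hj : j ∈ idxU S)
    (hm : opClosure {g | ∃ i ∈ idxU S, g = M.e i 0} (wtSpan (idxU S) M.e {μ | μ.degree ≤ m}) = ⊤)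
    {W W' : Submodule ℂ M} (hW : IsStable S M.e W) (hW' : IsStable S M.e W') {μ : ℕ →₀ ℕ} {v : M}
    (hμ : (μ.support : Set ℕ) ⊆ idxU S) (hd : μ.degree = m + k) (hv : IsWt (idxU S) M.e μ v)
    (hvW : v ∈ W) (hvW' : v ∉ W') :
    ∃ μ : ℕ →₀ ℕ, (μ.support : Set ℕ) ⊆ idxU S ∧ μ.degree = m + k ∧ k ≤ μ j ∧
      ∃ v ∈ W, v ∉ W' ∧ IsWt (idxU S) M.e μ v := by
  have hr := h.isWtRep
  set D := wtSpan (idxU S) M.e {μ | μ.degree = m + k}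
  have hDs : IsStable (idxU S) M.e D := hr.isStable_wtSpan_degree _
  have h1 := (hW.mono (idxU_subset S)).inf hDs
  have h2 := (hW'.mono (idxU_subset S)).inf h1
  -- By semisimplicity over `gl(U)`, the subspace `W ⊓ D ⊓ C` represents the degree `m + k` part of
  -- `W` modulo `W'`; a second complement is needed to apply `exists_wt_ge` to it.
  obtain ⟨C, hC, hcC⟩ := M.exists_isCompl_of_isStable (idxU_subset S) h.span h2
  have h3 := h1.inf hC
  obtain ⟨C', hC', hcC'⟩ := M.exists_isCompl_of_isStable (idxU_subset S) h.span h3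
  have hne : W ⊓ D ⊓ C ≠ ⊥ := by
    intro hbot
    have hvD : v ∈ D := hv.mem_wtSpan hd hμ
    obtain ⟨a, ha, c, hc, hac⟩ :=
      Submodule.mem_sup.1 (hcC.sup_eq_top ▸ Submodule.mem_top (x := v))
    have hcW : c ∈ W ⊓ D := by
      rw [show c = v - a by rw [← hac, add_sub_cancel_left]]
      exact Submodule.sub_mem _ ⟨hvW, hvD⟩ ha.2
    have hc0 : c = 0 := (Submodule.mem_bot ℂ).1 (hbot ▸ ⟨hcW, hc⟩)
    rw [hc0, add_zero] at hac
    exact hvW' (hac ▸ ha.1)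
  obtain ⟨μ', h4, h5, h6, v', h7, h8, h9⟩ :=
    exists_wt_ge hr h0 hj hm h3 hC' hcC' (inf_le_left.trans inf_le_right) hne
  refine ⟨μ', h4, h5, h6, v', h7.1.1, fun hv' => h8 ?_, h9⟩
  exact (Submodule.disjoint_def.1 hcC.disjoint) _ ⟨hv', h7.1⟩ h7.2

/-- Among the weights on `T` of degree `d` that occur in `W` outside `W'`, take one minimizing the
sum of `i * μ i`. Then `e 0 i` lowers the degree below `d`, while `e i j` with `i < j` lowers this
sum, so both lead into `W'`. -/
theorem exists_singular {V : Type*} [AddCommGroup V] [Module ℂ V] {ν : ℂ}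
    {e : ℕ → ℕ → Module.End ℂ V} (h : IsO ν S e) (h0 : 0 ∈ S) {T : Finset ℕ}
    (hT : (T : Set ℕ) ⊆ idxU S) {W W' : Submodule ℂ V} (hW : IsStable S e W) {d : ℕ}
    (hd : ∀ μ : ℕ →₀ ℕ, (μ.support : Set ℕ) ⊆ idxU S → μ.degree < d → ∀ v ∈ W,
      IsWt (idxU S) e μ v → v ∈ W')
    (hex : ∃ μ : ℕ →₀ ℕ, μ.support ⊆ T ∧ μ.degree = d ∧ ∃ v ∈ W, v ∉ W' ∧ IsWt (idxU S) e μ v) :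
    ∃ μ : ℕ →₀ ℕ, μ.support ⊆ T ∧ μ.degree = d ∧ ∃ v ∈ W, v ∉ W' ∧ IsWt (idxU S) e μ v ∧
      (∀ i ∈ T, e 0 i v ∈ W') ∧ ∀ i ∈ T, ∀ j ∈ T, i < j → e i j v ∈ W' := by
  let c : (ℕ →₀ ℕ) → ℕ := fun μ => μ.sum fun i n => i * n
  have hc : ∀ μ μ', c (μ + μ') = c μ + c μ' := fun μ μ' =>
    Finsupp.sum_add_index' (fun _ => mul_zero _) fun _ _ _ => mul_add _ _ _
  have hc1 : ∀ i, c (Finsupp.single i 1) = i := fun i =>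
    (Finsupp.sum_single_index (mul_zero i)).trans (mul_one i)
  obtain ⟨μ, ⟨h1, h2, v, h3, h4, h5⟩, hmin⟩ := WellFounded.has_min
    (InvImage.wf c (Nat.lt_wfRel.wf)) _ hex
  refine ⟨μ, h1, h2, v, h3, h4, h5, fun i hi => ?_, fun i hi j hj hij => ?_⟩
  · by_cases hi0 : μ i = 0
    · rw [h.isWtRep.apply_eq_zero h0 (hT hi) (ne_zero_of_mem_idxU (hT hi)).symm h5 hi0]
      exact Submodule.zero_mem _
    · have hle : Finsupp.single i 1 ≤ μ := Finsupp.single_le_iff.2 (Nat.one_le_iff_ne_zero.2 hi0)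
      obtain ⟨μ', rfl⟩ := exists_add_of_le hle
      have h6 := (support_add_subset_iff.1 ((Finset.coe_subset.2 h1).trans hT)).2
      refine hd μ' h6 ?_ _ (hW 0 h0 i (hT hi).1 v h3)
        (h.isWtRep.wt_shift h0 (hT hi).1 (fun k hk => ?_) h5)
      · rw [map_add, Finsupp.degree_single] at h2
        omega
      · rw [if_neg (ne_zero_of_mem_idxU hk), Finsupp.add_apply, Finsupp.single_apply]
        simp only [eq_comm (a := i)]
        omega
  · by_cases hj0 : μ j = 0
    · rw [h.isWtRep.apply_eq_zero (hT hi).1 (hT hj) hij.ne h5 hj0]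
      exact Submodule.zero_mem _
    · have hle : Finsupp.single j 1 ≤ μ := Finsupp.single_le_iff.2 (Nat.one_le_iff_ne_zero.2 hj0)
      obtain ⟨μ', rfl⟩ := exists_add_of_le hle
      by_contra hcon
      have h6 := (support_add_subset_iff.1 (Finset.coe_subset.2 h1)).2
      refine hmin (Finsupp.single i 1 + μ') ⟨?_, ?_, _, hW i (hT hi).1 j (hT hj).1 v h3, hcon,
        h.isWtRep.wt_shift (hT hi).1 (hT hj).1 (fun k hk => ?_) h5⟩ ?_
      · refine Finset.coe_subset.1 (support_add_subset_iff.2 ⟨?_, h6⟩)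
        refine (Finset.coe_subset.2 Finsupp.support_single_subset).trans ?_
        simpa using hi
      · rw [map_add, Finsupp.degree_single] at h2 ⊢
        exact h2
      · rw [Finsupp.add_apply, Finsupp.add_apply, Finsupp.single_apply, Finsupp.single_apply]
        simp only [eq_comm (a := i), eq_comm (a := j)]
        omega
      · change c _ < c _
        rw [hc, hc, hc1, hc1]
        omega

/-- The degrees needed to distinguish the submodules of an object of `O` for `gl_∞`
are bounded. -/
theorem exists_degree_bound {ν : ℂ} {M : LieMod (gl Set.univ)} (hM : catO ν Set.univ M) :
    ∃ D : ℕ, ∀ W W' : Submodule ℂ M, IsStable Set.univ M.e W → IsStable Set.univ M.e W' →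
      ¬ W ≤ W' → ∃ μ : ℕ →₀ ℕ, (μ.support : Set ℕ) ⊆ idxU Set.univ ∧ μ.degree ≤ D ∧
        ∃ v ∈ W, v ∉ W' ∧ IsWt (idxU Set.univ) M.e μ v := by
  have h0 : (0 : ℕ) ∈ Set.univ := Set.mem_univ 0
  have h := (catO_iff M h0).1 hM
  have hr := h.isWtRep
  obtain ⟨m, hm⟩ := h.exists_bound
  have hI : ∀ {i}, i ∈ idxU Set.univ ↔ i ≠ 0 := fun {i} => ⟨fun hi => hi.2, fun hi => ⟨trivial, hi⟩⟩
  -- One index for the large part of the weight and `m` indices for the rest. The rank `m + 2` does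
  -- not depend on the degree, so a single Casimir bound `D` serves all pairs of submodules.
  let T := Finset.Icc 1 (m + 1)
  have hTI : (T : Set ℕ) ⊆ idxU Set.univ := fun i hi => hI.2 (by
    have := Finset.mem_Icc.1 (Finset.mem_coe.1 hi); omega)
  have hT : (T : Set ℕ) = idxU (upTo (m + 2)) := by
    ext i
    simp only [T, Finset.coe_Icc, Set.mem_Icc, idxU, upTo, Set.mem_sdiff, Set.mem_singleton_iff,
      Set.mem_ofPred_eq]
    omega
  have hsub : upTo (m + 2) ⊆ Set.univ := Set.subset_univ _
  let N := (invFunctor hsub).obj M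
  have hN : IsO ν (upTo (m + 2)) N.e :=
    (catO_iff N (zero_mem_upTo _)).1 (catO_invFunctor (zero_mem_upTo _) hsub hM)
  obtain ⟨D, hD⟩ := hN.exists_singular_bound (zero_mem_upTo _) hT
  refine ⟨max D m, fun W W' hW hW' hne => ?_⟩
  by_contra! hcon
  have hex : ∃ d, ∃ μ : ℕ →₀ ℕ, (μ.support : Set ℕ) ⊆ idxU Set.univ ∧ μ.degree = d ∧
        ∃ v ∈ W, v ∉ W' ∧ IsWt (idxU Set.univ) M.e μ v := by
    obtain ⟨μ, -, h1, v, h2⟩ := exists_wt_of_not_le (hW.diag (idxU_subset _)) (A := Set.univ)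
      (le_top.trans hr.top.ge) hne
    exact ⟨_, μ, h1, rfl, v, h2⟩
  classical
  -- The least degree in which `W` is not contained in `W'`. It is assumed to exceed `m` as well as
  -- `D`, so that it can be written as `m + k`.
  let d := Nat.find hex
  obtain ⟨μ, h1, h2, v, h3, h4, h5⟩ := Nat.find_spec hex
  have hdD : max D m < d := by
    by_contra! hle
    exact hcon μ h1 (h2.trans_le hle) v h3 h4 h5
  obtain ⟨k, hk⟩ := Nat.exists_eq_add_of_le ((le_max_right D m).trans hdD.le)
  obtain ⟨μ₁, h6, h7, h8, v₁, h9, h10, h11⟩ := exists_wt_large h h0 (j := 1) (hI.2 one_ne_zero) hm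
    hW hW' h1 (h2.trans hk) h5 h3 h4
  have hT' : ((Finset.Icc 2 (m + 1) : Finset ℕ) : Set ℕ) ⊆ idxU Set.univ := fun i hi =>
    hTI (Finset.coe_subset.2 (Finset.Icc_subset_Icc_left one_le_two) hi)
  -- At most `m` units lie outside the index `1`; they are moved into the `m` indices `2, …, m + 1`.
  obtain ⟨μ₂, h12, h13, -, h14, v₂, h15, h16, h17⟩ := hr.exists_moved hT'
    (fun i _ j _ v hv => hW j trivial i trivial v hv)
    (fun i _ j _ v hv => hW' i trivial j trivial v hv) (J := {1}) (by simp) μ₁ h6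
    (by
      have h18 : (μ₁.filter fun i => ¬ i ∈ ({1} : Finset ℕ)).degree + μ₁ 1 = μ₁.degree := by
        conv_rhs => rw [← Finsupp.filter_add_filter_not μ₁ (fun i => i ∈ ({1} : Finset ℕ))]
        rw [map_add, add_comm]
        congr 1
        have : μ₁.filter (fun i => i ∈ ({1} : Finset ℕ)) = Finsupp.single 1 (μ₁ 1) := by
          ext i
          rw [Finsupp.filter_apply, Finsupp.single_apply]
          by_cases hi : i = 1
          · simp [hi]
          · simp [hi, Ne.symm hi]
        rw [this, Finsupp.degree_single]
      rw [Nat.card_Icc]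
      omega) h11 h9 h10
  obtain ⟨μ₃, g1, g2, v₃, g3, g4, g5, g6, g7⟩ := exists_singular h h0 hTI hW (W' := W') (d := d)
    (fun μ h1 h2 v h3 h5 => by
      by_contra h4
      exact Nat.find_min hex h2 ⟨μ, h1, rfl, v, h3, h4, h5⟩)
    ⟨μ₂, h12.trans (fun i hi => by
      simp only [T, Finset.mem_union, Finset.mem_Icc, Finset.mem_singleton] at hi ⊢
      omega), h14.trans (h7.trans hk.symm), v₂, h15, h16, h17⟩
  have hTT : (T : Set ℕ) ⊆ upTo (m + 2) := hT ▸ idxU_subset _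
  have g8 : v₃ ∈ glInv Set.univ (upTo (m + 2)) M.e := by
    rw [hr.glInv_eq (sdiff_subset_idxU (zero_mem_upTo _))]
    exact g5.mem_wtSpan ((Finset.coe_subset.2 g1).trans hTT) ((Finset.coe_subset.2 g1).trans hTI)
  obtain ⟨x, rfl⟩ := (mem_glInv_iff hsub M v₃).1 g8
  have hTm : ∀ {i}, i ∈ T → i ∈ upTo (m + 2) := fun hi => hTT (Finset.mem_coe.2 hi)
  -- The singular vector is supported on `T`, so it is an invariant, and the bound for the
  -- `gl_{m+2}`-module of invariants applies to it.
  have g9 := hD (W'.comap (invIncl hsub M)) (fun i hi j hj y hy => by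
      rw [Submodule.mem_comap, invIncl_e hsub M hi hj]
      exact hW' i trivial j trivial _ hy) μ₃ x (hT ▸ Finset.coe_subset.2 g1)
    (fun i hi => invIncl_injective hsub M (by
      rw [invIncl_e hsub M hi.1 hi.1, map_smul]
      exact g5 i ⟨trivial, hi.2⟩)) g4
    (fun i hi => by
      rw [Submodule.mem_comap, invIncl_e hsub M (zero_mem_upTo _) (hTm hi)]
      exact g6 i hi)
    (fun i hi j hj hij => by
      rw [Submodule.mem_comap, invIncl_e hsub M (hTm hi) (hTm hj)]
      exact g7 i hi j hj hij)
  have := le_max_left D m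
  omega

end FiniteLength

end ParabolicO

namespace ParabolicO

attribute [local instance 100] LieRing.ofAssociativeRing

/-! ### Finite length, and stabilization of the lengths of the invariants. -/

section FiniteLength

theorem LieMod.length_le_of_injective {L : Type} [LieRing L] [LieAlgebra ℂ L] {A B : LieMod L}
    (f : A →ₗ⁅ℂ,L⁆ B) (hf : Function.Injective f) : A.length ≤ B.length :=
  (Order.height_le_height_apply_of_strictMono (LieSubmodule.map f)
    (Monotone.strictMono_of_injective (fun _ _ h => LieSubmodule.map_mono h)
      (LieSubmodule.map_injective_of_injective hf)) ⊤).trans (Order.height_mono le_top)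

/-- Comparable distinct submodules differ by a weight vector of degree at most `D`, which can be
moved to the indices `1, …, D`. So the dimension of the intersection with the finite-dimensional
space `F` of such vectors is strictly increasing in the submodule. -/
theorem length_lt_top {ν : ℂ} {M : LieMod (gl Set.univ)} (hM : catO ν Set.univ M) :
    M.length < ⊤ := by
  obtain ⟨D, hD⟩ := exists_degree_bound hM
  have hr := ((catO_iff M (Set.mem_univ 0)).1 hM).isWtRep
  have hsub : upTo (D + 1) ⊆ Set.univ := Set.subset_univ _
  let N := (invFunctor hsub).obj M
  have hN : IsO ν (upTo (D + 1)) N.e :=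
    (catO_iff N (zero_mem_upTo _)).1 (catO_invFunctor (zero_mem_upTo _) hsub hM)
  have hfin := hN.finiteDimensional (zero_mem_upTo _) (Set.finite_lt_nat (D + 1)) D
  let F : Submodule ℂ M :=
    (wtSpan (idxU (upTo (D + 1))) N.e {μ | μ.degree ≤ D}).map (invIncl hsub M)
  have hF : FiniteDimensional ℂ F := inferInstanceAs (FiniteDimensional ℂ (Submodule.map _ _))
  have hlt : ∀ W W' : LieSubmodule ℂ (gl Set.univ) M, W' < W →
      (W' : Submodule ℂ M) ⊓ F < (W : Submodule ℂ M) ⊓ F := by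
    intro W W' hlt
    refine lt_of_le_of_ne (inf_le_inf_right _ hlt.le) fun heq => ?_
    obtain ⟨μ, h1, h2, v, h3, h4, h5⟩ := hD W W' (M.isStable_submodule W) (M.isStable_submodule W')
      hlt.not_ge
    have hT : ((Finset.Icc 1 D : Finset ℕ) : Set ℕ) ⊆ idxU (upTo (D + 1)) := by
      intro i hi
      simp only [Finset.coe_Icc, Set.mem_Icc, idxU, upTo, Set.mem_sdiff, Set.mem_singleton_iff,
        Set.mem_ofPred_eq] at hi ⊢
      omega
    obtain ⟨μ', h6, h7, -, h8, v', h9, h10, h11⟩ := hr.exists_moved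
      (hT.trans (idxU_mono hsub))
      (fun i _ j _ v hv => M.isStable_submodule W j trivial i trivial v hv)
      (fun i _ j _ v hv => M.isStable_submodule W' i trivial j trivial v hv) (J := ∅) (by simp) μ h1
      (by
        rw [Finsupp.filter_eq_self_iff _ _ |>.2 fun i _ => Finset.notMem_empty i]
        simpa using h2) h5 h3 h4
    rw [Finset.union_empty] at h6
    have h12 := (Finset.coe_subset.2 h6).trans hT
    have h13 : v' ∈ glInv Set.univ (upTo (D + 1)) M.e := by
      rw [hr.glInv_eq (sdiff_subset_idxU (zero_mem_upTo _))]
      exact h11.mem_wtSpan (h12.trans (idxU_subset _)) h7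
    obtain ⟨x, rfl⟩ := (mem_glInv_iff hsub M v').1 h13
    have h14 : invIncl hsub M x ∈ F := by
      refine ⟨x, IsWt.mem_wtSpan (μ := μ') (fun i hi => invIncl_injective hsub M ?_) ?_ h12, rfl⟩
      · rw [invIncl_e hsub M hi.1 hi.1, map_smul]
        exact h11 i ⟨trivial, hi.2⟩
      · exact h8.trans_le h2
    have h15 : invIncl hsub M x ∈ (W' : Submodule ℂ M) ⊓ F := heq ▸ ⟨h9, h14⟩
    exact h10 h15.1
  have hmono : StrictMono fun W : LieSubmodule ℂ (gl Set.univ) M =>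
      Module.finrank ℂ ((W : Submodule ℂ M) ⊓ F : Submodule ℂ M) := fun W' W h => by
    have : FiniteDimensional ℂ ((W : Submodule ℂ M) ⊓ F : Submodule ℂ M) :=
      Submodule.finiteDimensional_of_le inf_le_right
    exact Submodule.finrank_lt_finrank_of_lt (hlt W W' h)
  refine (Order.height_le_height_apply_of_strictMono _ hmono ⊤).trans_lt ?_
  rw [Order.height_nat]
  exact ENat.natCast_lt_top _

theorem eventually_eq_of_monotone {a : ℕ → ℕ∞} (h : Monotone a) {B : ℕ∞} (hB : B < ⊤)
    (hle : ∀ n, a n ≤ B) : ∃ l : ℕ, ∀ᶠ n in Filter.atTop, a n = l := by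
  obtain ⟨B, rfl⟩ := ENat.ne_top_iff_exists.1 hB.ne
  have hb : ∀ n, ∃ b : ℕ, (b : ℕ∞) = a n := fun n =>
    ENat.ne_top_iff_exists.1 ((hle n).trans_lt hB).ne
  choose b hb using hb
  have hbdd : BddAbove (Set.range b) := ⟨B, by
    rintro _ ⟨n, rfl⟩
    exact ENat.natCast_le_natCast.1 ((hb n).trans_le (hle n))⟩
  obtain ⟨n₀, hn₀⟩ := Nat.sSup_mem (Set.range_nonempty b) hbdd
  refine ⟨b n₀, Filter.eventually_atTop.2 ⟨n₀, fun n hn => le_antisymm ?_ ?_⟩⟩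
  · rw [← hb, ENat.natCast_le_natCast, hn₀]
    exact le_csSup hbdd ⟨n, rfl⟩
  · rw [hb]
    exact h hn

theorem invComparison_injective {T S' S : Set ℕ} (h : T ⊆ S') (h' : S' ⊆ S) (M : LieMod (gl S)) :
    Function.Injective (show (invFunctor (h.trans h')).obj M →ₗ⁅ℂ,gl T⁆
      (invFunctor h).obj ((invFunctor h').obj M) from (invComparison h h').app M) :=
  invariantsComparison_injective _ _ _ _ _ _ M

theorem length_invFunctor_mono {T S' S : Set ℕ} (h0 : 0 ∈ T) (h : T ⊆ S') (h' : S' ⊆ S)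
    {M : LieMod (gl S)} (hN : IsWtRep S' (idxU S') ((invFunctor h').obj M).e) :
    ((invFunctor (h.trans h')).obj M).length ≤ ((invFunctor h').obj M).length :=
  (LieMod.length_le_of_injective (B := (invFunctor h).obj ((invFunctor h').obj M)) _
    (invComparison_injective h h' M)).trans (length_invFunctor_le h0 h hN)

/-- Each term is the space of invariants of the next one, so the lengths increase, and they are
bounded by the finite length of `M`. -/
theorem length_gamma_eventually {ν : ℂ} (M : LieMod (gl Set.univ)) (hM : catO ν Set.univ M) :
    ∃ l : ℕ, ∀ᶠ n in Filter.atTop, ((gammaMod (n + 1)).obj M).length = l := by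
  have hr := ((catO_iff M (Set.mem_univ 0)).1 hM).isWtRep
  refine eventually_eq_of_monotone (monotone_nat_of_le_succ fun n => ?_)
    (length_lt_top hM) fun n => length_invFunctor_le (zero_mem_upTo n) (Set.subset_univ _) hr
  have hN := ((catO_iff _ (zero_mem_upTo _)).1
    (catO_invFunctor (zero_mem_upTo (n + 1)) (Set.subset_univ _) hM)).isWtRep
  exact length_invFunctor_mono (zero_mem_upTo n) (upTo_mono (n + 1).le_succ) (Set.subset_univ _) hN

theorem restrictedLim_gammaLim {ν : ℂ} (hR : ResPreserves ν) (hG : GammaPreserves ν)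
    (hC : GammaCompatible ν) (M : OInf ν) : restrictedLim hR ((gammaLim hR hG hC).obj M) :=
  length_gamma_eventually M.obj M.property

end FiniteLength

end ParabolicO

namespace ParabolicO

attribute [local instance 100] LieRing.ofAssociativeRing

/-! ### Extension of equivariant maps from tensor powers -/

theorem sum_ite_prodMk {V V' κ : Type*} [AddCommMonoid V] [AddCommMonoid V'] (s : Finset κ)
    (p : κ → Prop) [DecidablePred p]
    (a : κ → V) (b : κ → V') : ∑ i ∈ s, (if p i then (a i, b i) else 0) =
      (∑ i ∈ s, if p i then a i else 0, ∑ i ∈ s, if p i then b i else 0) := by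
  refine Prod.ext ?_ ?_
  · rw [Prod.fst_sum]
    refine Finset.sum_congr rfl fun i _ => ?_
    split_ifs <;> rfl
  · rw [Prod.snd_sum]
    refine Finset.sum_congr rfl fun i _ => ?_
    split_ifs <;> rfl

section Extension

variable {V V' : Type*} [AddCommGroup V] [Module ℂ V] [AddCommGroup V'] [Module ℂ V'] {I : Set ℕ}

/-- The operators on a direct sum. -/
def prodOp (e : ℕ → ℕ → Module.End ℂ V) (e' : ℕ → ℕ → Module.End ℂ V') (i j : ℕ) :
    Module.End ℂ (V × V') := (e i j).prodMap (e' i j)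

variable {e : ℕ → ℕ → Module.End ℂ V} {e' : ℕ → ℕ → Module.End ℂ V'}

theorem isWt_prodOp {μ : ℕ →₀ ℕ} {x : V × V'} :
    IsWt I (prodOp e e') μ x ↔ IsWt I e μ x.1 ∧ IsWt I e' μ x.2 :=
  ⟨fun h => ⟨fun i hi => congrArg Prod.fst (h i hi), fun i hi => congrArg Prod.snd (h i hi)⟩,
    fun h i hi => Prod.ext (h.1 i hi) (h.2 i hi)⟩

theorem isWtRep_prodOp {S : Set ℕ} (h : IsWtRep S I e) (h' : IsWtRep S I e') :
    IsWtRep S I (prodOp e e') := by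
  refine ⟨fun i hi j hj k hk l hl v => ?_, h.sub, ?_⟩
  · refine Prod.ext ((h.gl i hi j hj k hk l hl v.1).trans ?_)
      ((h'.gl i hi j hj k hk l hl v.2).trans ?_)
    · rw [Prod.fst_add, Prod.fst_sub, apply_ite Prod.fst, apply_ite Prod.fst]
      rfl
    · rw [Prod.snd_add, Prod.snd_sub, apply_ite Prod.snd, apply_ite Prod.snd]
      rfl
  · rw [eq_top_iff]
    rintro ⟨x, y⟩ -
    have h1 : wtSpan I e Set.univ ≤ (wtSpan I (prodOp e e') Set.univ).comap
        (LinearMap.inl ℂ V V') :=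
      wtSpan_induction fun μ hμ hI v hv =>
        (isWt_prodOp.2 ⟨hv, IsWt.zero μ⟩ : IsWt I (prodOp e e') μ (v, 0)).mem_wtSpan hμ hI
    have h2 : wtSpan I e' Set.univ ≤ (wtSpan I (prodOp e e') Set.univ).comap
        (LinearMap.inr ℂ V V') :=
      wtSpan_induction fun μ hμ hI v hv =>
        (isWt_prodOp.2 ⟨IsWt.zero μ, hv⟩ : IsWt I (prodOp e e') μ (0, v)).mem_wtSpan hμ hI
    have h4 : (LinearMap.inl ℂ V V') x ∈ wtSpan I (prodOp e e') Set.univ :=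
      h1 (h.top ▸ Submodule.mem_top : x ∈ _)
    have h5 : (LinearMap.inr ℂ V V') y ∈ wtSpan I (prodOp e e') Set.univ :=
      h2 (h'.top ▸ Submodule.mem_top : y ∈ _)
    have h3 := Submodule.add_mem _ h4 h5
    rwa [LinearMap.inl_apply, LinearMap.inr_apply, Prod.mk_add_mk, add_zero, zero_add] at h3

theorem isTensorMap_prodOp {d : ℕ} {f : (Fin d → I) → V} {f' : (Fin d → I) → V'}
    (hf : IsTensorMap I e d f) (hf' : IsTensorMap I e' d f') :
    IsTensorMap I (prodOp e e') d fun w => (f w, f' w) := fun k l w =>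
  (Prod.ext (hf k l w) (hf' k l w)).trans (sum_ite_prodMk _ _ _ _).symm

theorem isWtRep_tensorPow (I : Set ℕ) (d : ℕ) : IsWtRep I I ((taut I).tensorPow d).e :=
  ⟨LieMod.isGlRep _, subset_rfl, eq_top_iff.2
    ((tensorPow_top I d).ge.trans (wtSpan_mono (Set.subset_univ _)))⟩

/-- Between stable subspaces, a difference in degree `d` is visible on any `d` indices, by moving
weights. -/
theorem IsWtRep.exists_mem_of_not_le (h : IsWtRep I I e) {J : Finset ℕ} (hJ : (J : Set ℕ) ⊆ I)
    {d : ℕ} (hd : d ≤ J.card) {W W' : Submodule ℂ V} (hW : IsStable I e W) (hW' : IsStable I e W')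
    (hWd : W ≤ wtSpan I e {μ | μ.degree = d}) (hne : ¬ W ≤ W') :
    ∃ v ∈ W, v ∉ W' ∧ v ∈ wtSpan I e {μ | (μ.support : Set ℕ) ⊆ J} := by
  obtain ⟨μ, h1, h2, v, h3, h4, h5⟩ := exists_wt_of_not_le (hW.diag subset_rfl) hWd hne
  obtain ⟨μ', h6, h7, -, -, v', h8, h9, h10⟩ := h.exists_moved hJ
    (fun i hi j hj v hv => hW j (hJ hj) i hi v hv) (fun i hi j hj v hv => hW' i hi j (hJ hj) v hv)
    (J := ∅) (Finset.disjoint_empty_right J) μ h2 (by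
      rw [Finsupp.filter_eq_self_iff _ _ |>.2 fun i _ => Finset.notMem_empty i]
      exact (h1.trans_le hd : _)) h5 h3 h4
  rw [Finset.union_empty] at h6
  exact ⟨v', h8, h9, h10.mem_wtSpan (Finset.coe_subset.2 h6) h7⟩

/-- A tensor map on the words in a finite set `J` of indices, with values in the invariants, extends
to all words, if `J` is not too small. -/
theorem exists_tensorMap_extension {J : Finset ℕ} (hJ : (J : Set ℕ) ⊆ I) (h : IsWtRep I I e) {d : ℕ}
    (hd : d ≤ J.card) {f : (Fin d → (J : Set ℕ)) → V} (hf : IsTensorMap J e d f)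
    (hr : ∀ w, f w ∈ glInv I J e) :
    ∃ F : (Fin d → I) → V, IsTensorMap I e d F ∧ ∀ w, F (Set.inclusion hJ ∘ w) = f w := by
  let P := (taut I).tensorPow d
  let b : (Fin d → I) → P := tensorBasis I d
  have hb : IsTensorMap I P.e d b := isTensorMap_tensorBasis I d
  have hP := isWtRep_tensorPow I d
  let e₂ := prodOp P.e e
  have h₂ : IsWtRep I I e₂ := isWtRep_prodOp hP h
  let g : (Fin d → (J : Set ℕ)) → P × V := fun w => (b (Set.inclusion hJ ∘ w), f w)
  have hbJ : IsTensorMap J P.e d fun w => b (Set.inclusion hJ ∘ w) :=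
    hb.restrict hJ (V' := P) (e' := P.e) (ι := LinearMap.id)
      Function.injective_id (fun _ _ _ _ _ => rfl) fun _ => rfl
  have hg : IsTensorMap J e₂ d g := isTensorMap_prodOp hbJ hf
  -- `N` is the graph of the given map on the words in `J`. The submodule `G` it generates in the
  -- direct sum will be the graph of the extension.
  let N := Submodule.span ℂ (Set.range g)
  have hIJ : I \ (J : Set ℕ) ⊆ I := Set.sdiff_subset
  have hbinv : ∀ w : Fin d → (J : Set ℕ), b (Set.inclusion hJ ∘ w) ∈ glInv I J P.e := by
    intro w
    rw [hP.glInv_eq hIJ]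
    refine (hb.isWt _).mem_wtSpan ?_ (support_wordWt_subset _)
    rw [wordWt_inclusion hJ]
    exact support_wordWt_subset w
  have hN : N ≤ glInv I J e₂ := by
    refine Submodule.span_le.2 ?_
    rintro _ ⟨w, rfl⟩ i hi j hj
    exact Prod.ext (hbinv w i hi j hj) (hr w i hi j hj)
  have hNs : IsStable J e₂ N := by
    intro k hk l hl v hv
    induction hv using Submodule.span_induction with
    | mem v hv =>
      obtain ⟨w, rfl⟩ := hv
      rw [hg ⟨k, hk⟩ ⟨l, hl⟩ w]
      refine Submodule.sum_mem _ fun s _ => ?_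
      split_ifs
      · exact Submodule.subset_span ⟨_, rfl⟩
      · exact Submodule.zero_mem _
    | zero => rw [map_zero]; exact Submodule.zero_mem _
    | add x y _ _ hx hy => rw [map_add]; exact Submodule.add_mem _ hx hy
    | smul c x _ hx => rw [map_smul]; exact Submodule.smul_mem _ c hx
  let G := IsWtRep.lower I J e₂ N
  have hG : IsStable I e₂ G := h₂.isStable_lower hJ hIJ hN hNs
  have hGN : G ⊓ glInv I J e₂ = N := h₂.lower_inf_glInv hJ hIJ hN
  have hGd : G ≤ wtSpan I e₂ {μ | μ.degree = d} := by
    refine IsWtRep.lower_le hJ (Submodule.span_le.2 ?_) fun i hi j hj v hv =>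
      h₂.apply_mem_wtSpan hi hj (fun μ hμ μ' h1 h2 h3 =>
        (degree_of_move h1 h2 hi hj h3).trans hμ) hv
    rintro _ ⟨w, rfl⟩
    refine (hg.isWt w).mono subset_rfl |> fun h1 => IsWt.mem_wtSpan (μ := wordWt w) ?_
      (degree_wordWt w) ((support_wordWt_subset w).trans hJ)
    intro i hi
    by_cases hiJ : i ∈ J
    · exact h1 i hiJ
    · rw [hN (Submodule.subset_span ⟨w, rfl⟩) i ⟨hi, hiJ⟩ i ⟨hi, hiJ⟩,
        Finsupp.notMem_support_iff.1 fun hc => hiJ (support_wordWt_subset w hc), Nat.cast_zero,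
        zero_smul]
  -- If `G` met the second summand, it would do so in an invariant vector, as `d ≤ J.card`. Such a
  -- vector lies in `N`, and it vanishes because the words in `J` are linearly independent.
  have huniq : ∀ v, (0, v) ∈ G → v = 0 := by
    by_contra! hcon
    obtain ⟨v, hv, hv0⟩ := hcon
    let Z : Submodule ℂ (P × V) := G ⊓ LinearMap.ker (LinearMap.fst ℂ P V)
    have hZ : IsStable I e₂ Z := fun i hi j hj x hx =>
      ⟨hG i hi j hj x hx.1, (congrArg (P.e i j) hx.2).trans (map_zero _)⟩
    obtain ⟨x, h1, h2, h3⟩ := h₂.exists_mem_of_not_le hJ hd hZ (isStable_bot I e₂)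
      (inf_le_left.trans hGd)
      fun hle => hv0 (congrArg Prod.snd ((Submodule.mem_bot ℂ).1 (hle ⟨hv, rfl⟩)))
    rw [← h₂.glInv_eq hIJ] at h3
    have h4 : x ∈ N := hGN ▸ ⟨h1.1, h3⟩
    obtain ⟨c, hc⟩ := (Finsupp.mem_span_range_iff_exists_finsupp).1 h4
    have h5 : Finsupp.linearCombination ℂ (fun w => b (Set.inclusion hJ ∘ w)) c = 0 := by
      rw [← h1.2, ← hc, Finsupp.linearCombination_apply, Finsupp.sum, map_finsuppSum, Finsupp.sum]
      rfl
    have hli : LinearIndependent ℂ fun w : Fin d → (J : Set ℕ) => b (Set.inclusion hJ ∘ w) :=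
      (tensorBasis I d).linearIndependent.comp _ ((Set.inclusion_injective hJ).comp_left)
    rw [linearIndependent_iff.1 hli c h5, Finsupp.sum_zero_index] at hc
    exact h2 (hc ▸ Submodule.zero_mem _)
  -- A failure of surjectivity would be visible on weights supported on `J`, but those are spanned
  -- by the words in `J`, which are in the image.
  have hex : G.map (LinearMap.fst ℂ P V) = ⊤ := by
    by_contra hne
    have hQ : IsStable I P.e (G.map (LinearMap.fst ℂ P V)) := by
      rintro i hi j hj _ ⟨x, hx, rfl⟩
      exact ⟨_, hG i hi j hj x hx, rfl⟩
    obtain ⟨x, -, h2, h3⟩ := hP.exists_mem_of_not_le hJ hd (W := ⊤)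
      (fun _ _ _ _ _ _ => Submodule.mem_top) hQ
      (tensorPow_top I d).ge fun hle => hne (eq_top_iff.2 hle)
    have h4 := mem_span_of_mem_wtSpan (I := I) (e := P.e) (b := b) (μ := wordWt)
      support_wordWt_subset hb.isWt (x := x)
      (by rw [(tensorBasis I d).span_eq]; exact Submodule.mem_top) h3
    refine h2 (Submodule.span_le.2 ?_ h4)
    rintro _ ⟨w, hw, rfl⟩
    obtain ⟨w, rfl⟩ := exists_word_inclusion hJ hw
    exact ⟨g w, IsWtRep.le_lower _ _ _ _ (Submodule.subset_span ⟨w, rfl⟩), rfl⟩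
  have hF : ∀ w : Fin d → I, ∃ v, (b w, v) ∈ G := by
    intro w
    obtain ⟨⟨p, v⟩, hx, hxp⟩ := hex.ge (Submodule.mem_top (x := b w))
    exact ⟨v, by rwa [← hxp]⟩
  choose F hF using hF
  have hG' : ∀ {p : P} {v v' : V}, (p, v) ∈ G → (p, v') ∈ G → v = v' := by
    intro p v v' h1 h2
    have := Submodule.sub_mem _ h1 h2
    rw [Prod.mk_sub_mk, sub_self] at this
    exact sub_eq_zero.1 (huniq _ this)
  refine ⟨F, fun k l w => ?_, fun w => hG' (hF _)
    (IsWtRep.le_lower _ _ _ _ (Submodule.subset_span ⟨w, rfl⟩))⟩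
  have h1 : (P.e k l (b w), e k l (F w)) ∈ G := hG k k.2 l l.2 _ (hF w)
  rw [hb] at h1
  refine hG' h1 ?_
  have h2 : ∑ s,
      (if w s = l then (b (Function.update w s k), F (Function.update w s k)) else 0) ∈ G :=
    Submodule.sum_mem _ fun s _ => by
      split_ifs
      · exact hF _
      · exact Submodule.zero_mem _
  rwa [sum_ite_prodMk] at h2

end Extension

end ParabolicO

namespace ParabolicO

attribute [local instance 100] LieRing.ofAssociativeRing

/-! ### Full faithfulness -/

/-- A map out of an increasing union is given by compatible maps on its members. The members are
abstract spaces with injections, so compatibility is expressed through elements with equal images.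
-/
theorem exists_glued_map {A : ℕ → Type*} {M N : Type*} [∀ n, AddCommGroup (A n)]
    [∀ n, Module ℂ (A n)] [AddCommGroup M] [Module ℂ M] [AddCommGroup N] [Module ℂ N]
    (ι : ∀ n, A n →ₗ[ℂ] M) (g : ∀ n, A n →ₗ[ℂ] N) (hι : ∀ n, Function.Injective (ι n))
    (hs : ∀ n x, ∃ y, ι (n + 1) y = ι n x ∧ g (n + 1) y = g n x) (hM : ∀ v, ∃ n x, ι n x = v) :
    ∃ φ : M →ₗ[ℂ] N, ∀ n x, φ (ι n x) = g n x := by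
  have hs' : ∀ n k x, ∃ y, ι (n + k) y = ι n x ∧ g (n + k) y = g n x := by
    intro n k x
    induction k with
    | zero => exact ⟨x, rfl, rfl⟩
    | succ k ih =>
      obtain ⟨y, h1, h2⟩ := ih
      obtain ⟨z, h3, h4⟩ := hs _ y
      exact ⟨z, h3.trans h1, h4.trans h2⟩
  have hs'' : ∀ {n m}, n ≤ m → ∀ x, ∃ y, ι m y = ι n x ∧ g m y = g n x := by
    intro n m hnm x
    obtain ⟨k, rfl⟩ := Nat.exists_eq_add_of_le hnm
    exact hs' n k x
  choose n x hx using hM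
  have key : ∀ m y, g (n (ι m y)) (x (ι m y)) = g m y := by
    intro m y
    obtain ⟨a, h1, h2⟩ := hs'' (le_max_left (n (ι m y)) m) (x (ι m y))
    obtain ⟨b, h3, h4⟩ := hs'' (le_max_right (n (ι m y)) m) y
    rw [← h2, ← h4]
    congr 1
    exact hι _ (h1.trans ((hx _).trans h3.symm))
  refine ⟨{
    toFun := fun v => g (n v) (x v)
    map_add' := fun v w => ?_
    map_smul' := fun c v => ?_ },
    key⟩
  · obtain ⟨a, h1, h2⟩ := hs'' (le_max_left (n v) (n w)) (x v)
    obtain ⟨b, h3, h4⟩ := hs'' (le_max_right (n v) (n w)) (x w)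
    have := key _ (a + b)
    rw [map_add, map_add, h1, h3, hx, hx, h2, h4] at this
    exact this
  · have := key _ (c • x v)
    rw [map_smul, map_smul, hx] at this
    exact this

section Union

variable {V : Type*} [AddCommGroup V] [Module ℂ V] {e : ℕ → ℕ → Module.End ℂ V}

theorem glInv_mono (S : Set ℕ) {T T' : Set ℕ} (h : T ⊆ T') : glInv S T e ≤ glInv S T' e :=
  fun _ hv i hi j hj => hv i ⟨hi.1, fun hc => hi.2 (h hc)⟩ j ⟨hj.1, fun hc => hj.2 (h hc)⟩

/-- Weights have finite support, and a vector involves finitely many of them. -/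
theorem IsWtRep.exists_mem_glInv {S : Set ℕ} (h : IsWtRep S (idxU S) e) (v : V) :
    ∃ n, v ∈ glInv S (upTo (n + 1)) e := by
  have hv : v ∈ wtSpan (idxU S) e Set.univ := h.top ▸ Submodule.mem_top
  induction hv using Submodule.span_induction with
  | mem v hv =>
    obtain ⟨μ, -, hI, hv⟩ := hv
    refine ⟨μ.support.sup id, ?_⟩
    rw [h.glInv_eq (sdiff_subset_idxU (zero_mem_upTo _))]
    exact hv.mem_wtSpan (fun i hi => Nat.lt_succ_of_le (Finset.le_sup (f := id) hi)) hI
  | zero => exact ⟨0, Submodule.zero_mem _⟩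
  | add x y _ _ hx hy =>
    obtain ⟨n, hn⟩ := hx
    obtain ⟨m, hm⟩ := hy
    exact ⟨max n m, Submodule.add_mem _
      (glInv_mono S (upTo_mono (Nat.succ_le_succ (le_max_left n m))) hn)
      (glInv_mono S (upTo_mono (Nat.succ_le_succ (le_max_right n m))) hm)⟩
  | smul c x _ hx => exact hx.imp fun n hn => Submodule.smul_mem _ c hn

end Union

/-- Homomorphisms between invariants extend to homomorphisms, if they are compatible. -/
theorem exists_hom_of_gamma {M N : LieMod (gl Set.univ)}
    (hM : IsWtRep Set.univ (idxU Set.univ) M.e)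
    (g : ∀ n, (gammaMod (n + 1)).obj M →ₗ⁅ℂ,gl (upTo (n + 1))⁆ (gammaMod (n + 1)).obj N)
    (hg : ∀ n x y, invIncl (Set.subset_univ _) M x = invIncl (Set.subset_univ _) M y →
      invIncl (Set.subset_univ _) N (g n x) = invIncl (Set.subset_univ _) N (g (n + 1) y)) :
    ∃ φ : M →ₗ⁅ℂ,gl Set.univ⁆ N, ∀ n x, φ (invIncl (Set.subset_univ _) M x) =
      invIncl (Set.subset_univ _) N (g n x) := by
  have hex : ∀ n (x : (gammaMod (n + 1)).obj M) m, n ≤ m →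
      ∃ y : (gammaMod (m + 1)).obj M, invIncl (Set.subset_univ _) M y =
        invIncl (Set.subset_univ _) M x := fun n x m hnm =>
    (mem_glInv_iff _ M _).1 (glInv_mono _ (upTo_mono (Nat.succ_le_succ hnm))
      ((mem_glInv_iff _ M _).2 ⟨x, rfl⟩))
  obtain ⟨φ, hφ⟩ := exists_glued_map (A := fun n => (gammaMod (n + 1)).obj M)
    (fun n => invIncl (Set.subset_univ _) M)
    (fun n => (invIncl (Set.subset_univ _) N).comp (g n).toLinearMap)
    (fun n => invIncl_injective _ M)
    (fun n x => by
      obtain ⟨y, hy⟩ := hex n x (n + 1) n.le_succ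
      exact ⟨y, hy, (hg n x y hy.symm).symm⟩)
    (fun v => by
      obtain ⟨n, hn⟩ := hM.exists_mem_glInv v
      exact ⟨n, (mem_glInv_iff _ M v).1 hn⟩)
  refine ⟨LieMod.homOfE φ fun i _ j _ v => ?_, hφ⟩
  obtain ⟨n, hn⟩ := hM.exists_mem_glInv v
  obtain ⟨x, rfl⟩ := (mem_glInv_iff (Set.subset_univ _) M v).1 hn
  -- Equivariance for `e i j` is available only at levels beyond `i` and `j`.
  obtain ⟨y, hy⟩ := hex n x (max n (max i j)) (le_max_left _ _)
  have hi : i ∈ upTo (max n (max i j) + 1) :=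
    Nat.lt_succ_of_le ((le_max_left i j).trans (le_max_right _ _))
  have hj : j ∈ upTo (max n (max i j) + 1) :=
    Nat.lt_succ_of_le ((le_max_right i j).trans (le_max_right _ _))
  rw [← hy, ← invIncl_e _ M hi hj, hφ, hφ]
  change invIncl _ N (g _ _) = N.e i j (invIncl _ N (g _ y))
  rw [LieMod.hom_e, invIncl_e _ N hi hj]

section Comparison

variable {L L' L'' : Type} [LieRing L] [LieAlgebra ℂ L] [LieRing L'] [LieAlgebra ℂ L']
  [LieRing L''] [LieAlgebra ℂ L''] {f : L'' →ₗ⁅ℂ⁆ L} {g : L' →ₗ⁅ℂ⁆ L} {e : L'' →ₗ⁅ℂ⁆ L'}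

/-- All maps in the square except `k₁` and `k₂` leave vectors of `M` and `N` in place, so
commutativity says that `k₁` and `k₂` agree wherever both are defined. -/
theorem invariantsIncl_comm {hfg : ∀ x, f x = g (e x)} {K₁ K₂ : Set L} {K₃ : Set L'}
    {hK₁ : ∀ a ∈ K₁, ∀ x, ⁅a, f x⁆ = 0} {hK₂ : ∀ a ∈ K₂, ∀ x, ⁅a, g x⁆ = 0}
    {hK₃ : ∀ a ∈ K₃, ∀ x, ⁅a, e x⁆ = 0} {h₂ : K₂ ⊆ K₁} {h₃ : ∀ a ∈ K₃, g a ∈ K₁} {M N : LieMod L}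
    {k₁ : (invariants f K₁ hK₁).obj M →ₗ⁅ℂ,L''⁆ (invariants f K₁ hK₁).obj N}
    {k₂ : (invariants g K₂ hK₂).obj M →ₗ⁅ℂ,L'⁆ (invariants g K₂ hK₂).obj N}
    (h : (invariantsComparison hfg hK₁ hK₂ hK₃ h₂ h₃).app M ≫ (invariants e K₃ hK₃).map k₂ =
      CategoryStruct.comp (X := (invariants f K₁ hK₁).obj M) (Y := (invariants f K₁ hK₁).obj N) k₁
        ((invariantsComparison hfg hK₁ hK₂ hK₃ h₂ h₃).app N))
    {x : (invariants f K₁ hK₁).obj M} {y : (invariants g K₂ hK₂).obj M}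
    (hxy : invariantsIncl f K₁ hK₁ M x = invariantsIncl g K₂ hK₂ M y) :
    invariantsIncl f K₁ hK₁ N (k₁ x) = invariantsIncl g K₂ hK₂ N (k₂ y) := by
  let c := (show (invariants f K₁ hK₁).obj M →ₗ⁅ℂ,L''⁆
    (invariants e K₃ hK₃).obj ((invariants g K₂ hK₂).obj M) from
    (invariantsComparison hfg hK₁ hK₂ hK₃ h₂ h₃).app M)
  have h1 : invariantsIncl e K₃ hK₃ _ (c x) = y := invariantsIncl_injective g K₂ hK₂ M
    ((invariantsIncl_comparison hfg hK₁ hK₂ hK₃ h₂ h₃ M x).trans hxy)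
  have h2 := congrArg (fun φ : (invariants f K₁ hK₁).obj M →ₗ⁅ℂ,L''⁆
    (invariants e K₃ hK₃).obj ((invariants g K₂ hK₂).obj N) =>
    invariantsIncl g K₂ hK₂ N (invariantsIncl e K₃ hK₃ _ (φ x))) h
  exact (h2.symm.trans (congrArg (fun z => invariantsIncl g K₂ hK₂ N (k₂ z)) h1))

end Comparison

section FullyFaithful

variable {ν : ℂ} (hR : ResPreserves ν) (hG : GammaPreserves ν) (hC : GammaCompatible ν)

theorem hom_ext_of_gamma {M N : LieMod (gl Set.univ)} (hM : IsWtRep Set.univ (idxU Set.univ) M.e)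
    {f g : M ⟶ N} (h : ∀ n, (gammaMod (n + 1)).map f = (gammaMod (n + 1)).map g) : f = g := by
  refine LieModuleHom.ext fun v => ?_
  obtain ⟨n, hn⟩ := hM.exists_mem_glInv v
  obtain ⟨x, rfl⟩ := (mem_glInv_iff (Set.subset_univ _) M v).1 hn
  refine (invariantsIncl_map _ _ _ f x).symm.trans (Eq.trans ?_ (invariantsIncl_map _ _ _ g x))
  rw [show (invariants _ _ _).map f = (invariants _ _ _).map g from h n]

variable {hR hG hC}

/-- The components of a morphism between sequences of invariants. -/
noncomputable def gammaLimApp {M N : OInf ν}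
    (k : (gammaLim hR hG hC).obj M ⟶ (gammaLim hR hG hC).obj N) (n : ℕ) :
    (gammaMod (n + 1)).obj M.obj ⟶ (gammaMod (n + 1)).obj N.obj :=
  (show (gammaO hG n).obj M ⟶ (gammaO hG n).obj N from InvLim.Hom.app k n).hom

/-- The structure isomorphisms of the limit are inverses of the comparison maps; here the square is
rewritten in terms of the comparison maps, which act as the identity on vectors. -/
theorem gammaLimApp_comm {M N : OInf ν}
    (k : (gammaLim hR hG hC).obj M ⟶ (gammaLim hR hG hC).obj N) (n : ℕ) :
    CategoryStruct.comp (Y := (gammaMod (n + 1 + 1) ⋙ resMod (n + 1)).obj M.obj)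
      (Z := (gammaMod (n + 1 + 1) ⋙ resMod (n + 1)).obj N.obj)
      ((gammaComparison (n + 1)).app M.obj)
      ((resMod (n + 1)).map (X := (gammaMod (n + 1 + 1)).obj M.obj)
        (Y := (gammaMod (n + 1 + 1)).obj N.obj) (gammaLimApp k (n + 1))) =
      gammaLimApp k n ≫ (gammaComparison (n + 1)).app N.obj := by
  have := hC n M.obj M.property
  have := hC n N.obj N.property
  rw [← IsIso.eq_inv_comp, ← Category.assoc, ← IsIso.comp_inv_eq]
  exact congrArg (fun f : (resO hR n).obj ((gammaO hG (n + 1)).obj M) ⟶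
      (gammaO hG n).obj N => f.hom)
      (InvLim.Hom.comm k n)

theorem gammaLim_hom_ext {M N : OInf ν}
    {k k' : (gammaLim hR hG hC).obj M ⟶ (gammaLim hR hG hC).obj N}
    (h : ∀ n, gammaLimApp k n = gammaLimApp k' n) : k = k' :=
  InvLim.Hom.ext (funext fun n => ObjectProperty.hom_ext _ (h n))

theorem gammaLimApp_map {M N : OInf ν} (f : M ⟶ N) (n : ℕ) :
    gammaLimApp ((gammaLim hR hG hC).map f) n = (gammaMod (n + 1)).map f.hom := rfl

theorem faithful_gammaLim : (gammaLim hR hG hC).Faithful := by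
  refine ⟨fun {M N f g} h => ?_⟩
  refine ObjectProperty.hom_ext _
    (hom_ext_of_gamma ((catO_iff M.obj (Set.mem_univ 0)).1 M.property).isWtRep fun n => ?_)
  rw [← gammaLimApp_map (hR := hR) (hG := hG) (hC := hC), h, gammaLimApp_map]

theorem gammaLimApp_incl {M N : OInf ν}
    (k : (gammaLim hR hG hC).obj M ⟶ (gammaLim hR hG hC).obj N) (n : ℕ)
    (x : (gammaMod (n + 1)).obj M.obj) (y : (gammaMod (n + 1 + 1)).obj M.obj)
    (hxy : invIncl (Set.subset_univ _) M.obj x = invIncl (Set.subset_univ _) M.obj y) :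
    invIncl (Set.subset_univ _) N.obj ((show (gammaMod (n + 1)).obj M.obj →ₗ⁅ℂ,gl (upTo (n + 1))⁆
      (gammaMod (n + 1)).obj N.obj from gammaLimApp k n) x) =
    invIncl (Set.subset_univ _) N.obj ((show (gammaMod (n + 1 + 1)).obj M.obj
      →ₗ⁅ℂ,gl (upTo (n + 1 + 1))⁆ (gammaMod (n + 1 + 1)).obj N.obj from gammaLimApp k (n + 1)) y) :=
  invariantsIncl_comm (gammaLimApp_comm k n) hxy

theorem full_gammaLim : (gammaLim hR hG hC).Full := by
  refine ⟨fun {M N} k => ?_⟩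
  obtain ⟨φ, hφ⟩ := exists_hom_of_gamma ((catO_iff M.obj (Set.mem_univ 0)).1 M.property).isWtRep
    (fun n => gammaLimApp k n) (gammaLimApp_incl k)
  refine ⟨ObjectProperty.homMk φ, gammaLim_hom_ext fun n => ?_⟩
  refine LieModuleHom.ext fun x => invIncl_injective (Set.subset_univ _) N.obj ?_
  exact (invariantsIncl_map _ _ _ (show M.obj ⟶ N.obj from φ) x).trans (hφ n x)

end FullyFaithful

end ParabolicO

namespace ParabolicO

attribute [local instance 100] LieRing.ofAssociativeRing

/-! ### Unions of sequences of modules -/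

theorem exists_linear_union {A : ℕ → Type} [∀ n, AddCommGroup (A n)] [∀ n, Module ℂ (A n)]
    (s : ∀ n, A n →ₗ[ℂ] A (n + 1)) (hs : ∀ n, Function.Injective (s n)) :
    ∃ (V : Type) (_ : AddCommGroup V) (_ : Module ℂ V) (ι : ∀ n, A n →ₗ[ℂ] V),
      (∀ n, Function.Injective (ι n)) ∧ (∀ n x, ι (n + 1) (s n x) = ι n x) ∧
        ∀ v, ∃ n x, ι n x = v := by
  -- The transition maps are the composites of consecutive steps; `V` is their direct limit.
  let f : ∀ n m, n ≤ m → A n →ₗ[ℂ] A m := fun n m h =>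
    Nat.leRec (motive := fun m _ => A n →ₗ[ℂ] A m) LinearMap.id (fun m _ g => (s m).comp g) h
  have hf0 : ∀ n, f n n le_rfl = LinearMap.id := fun n => Nat.leRec_self _ _
  have hf1 : ∀ n m (h : n ≤ m), f n (m + 1) (h.trans m.le_succ) = (s m).comp (f n m h) :=
    fun n m h => Nat.leRec_succ _ _ h
  have : DirectedSystem A fun n m h => f n m h := by
    refine ⟨fun n x => by rw [hf0]; rfl, fun k j i hij hjk x => ?_⟩
    induction k, hjk using Nat.le_induction with
    | base => rw [hf0]; rfl
    | succ k hjk ih => rw [hf1 j k hjk, hf1 i k (hij.trans hjk), LinearMap.comp_apply, ih]; rfl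
  have hinj : ∀ n m h, Function.Injective (f n m h) := by
    intro n m h
    induction m, h using Nat.le_induction with
    | base => rw [hf0]; exact Function.injective_id
    | succ m h ih => rw [hf1 n m h]; exact (hs m).comp ih
  refine ⟨Module.DirectLimit A f, inferInstance, inferInstance, Module.DirectLimit.of ℂ ℕ A f,
    fun n => ?_, fun n x => ?_, Module.DirectLimit.exists_of⟩
  · rw [injective_iff_map_eq_zero]
    intro x hx
    obtain ⟨m, hm, h⟩ := Module.DirectLimit.of.zero_exact hx
    exact hinj n m hm (h.trans (map_zero _).symm)
  · have := hf1 n n le_rfl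
    rw [hf0, LinearMap.comp_id] at this
    rw [← this]
    exact Module.DirectLimit.of_f

theorem exists_mem_gl_upTo {a : Module.End ℂ CInf} (ha : a ∈ gl Set.univ) :
    ∃ n, a ∈ gl (upTo (n + 1)) := by
  change a ∈ Submodule.span ℂ _ at ha
  induction ha using Submodule.span_induction with
  | mem a ha =>
    obtain ⟨i, -, j, -, rfl⟩ := ha
    exact ⟨max i j, E_mem (Nat.lt_succ_of_le (le_max_left i j))
      (Nat.lt_succ_of_le (le_max_right i j))⟩
  | zero => exact ⟨0, Submodule.zero_mem _⟩
  | add x y _ _ hx hy =>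
    obtain ⟨n, hn⟩ := hx
    obtain ⟨m, hm⟩ := hy
    exact ⟨max n m, Submodule.add_mem _
      (gl_mono (upTo_mono (Nat.succ_le_succ (le_max_left n m))) hn)
      (gl_mono (upTo_mono (Nat.succ_le_succ (le_max_right n m))) hm)⟩
  | smul c x _ hx => exact hx.imp fun n hn => Submodule.smul_mem _ c hn

/-- A matrix with finitely many entries lies in `gl_n` for large `n`, acts on all later terms
compatibly, and so acts on the union. The Lie algebra axioms are checked at a level that contains
the matrices and the vector involved. -/
theorem exists_union {A : ∀ n, LieMod (gl (upTo (n + 1)))} (s : ∀ n, A n →ₗ[ℂ] A (n + 1))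
    (hs : ∀ n, Function.Injective (s n))
    (he : ∀ n (a : Module.End ℂ CInf) (h : a ∈ gl (upTo (n + 1)))
      (h' : a ∈ gl (upTo (n + 1 + 1))) x,
      s n ⁅(⟨a, h⟩ : gl (upTo (n + 1))), x⁆ = ⁅(⟨a, h'⟩ : gl (upTo (n + 1 + 1))), s n x⁆) :
    ∃ (V : LieMod (gl Set.univ)) (ι : ∀ n, A n →ₗ[ℂ] V),
      (∀ n, Function.Injective (ι n)) ∧ (∀ n x, ι (n + 1) (s n x) = ι n x) ∧
        (∀ v, ∃ n x, ι n x = v) ∧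
        ∀ n (a : Module.End ℂ CInf) (h : a ∈ gl (upTo (n + 1))) (h' : a ∈ gl Set.univ) x,
          ι n ⁅(⟨a, h⟩ : gl (upTo (n + 1))), x⁆ = ⁅(⟨a, h'⟩ : gl Set.univ), ι n x⁆ := by
  obtain ⟨V, i1, i2, ι, h1, h2, h3⟩ := exists_linear_union s hs
  have hgl : ∀ {n m}, n ≤ m → gl (upTo (n + 1)) ≤ gl (upTo (m + 1)) := fun h =>
    gl_mono (upTo_mono (Nat.succ_le_succ h))
  have hup : ∀ {n m} (hnm : n ≤ m) (x : A n), ∃ y : A m, ι m y = ι n x ∧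
      ∀ (a : Module.End ℂ CInf) (h : a ∈ gl (upTo (n + 1))) (h' : a ∈ gl (upTo (m + 1))),
        ι m ⁅(⟨a, h'⟩ : gl (upTo (m + 1))), y⁆ = ι n ⁅(⟨a, h⟩ : gl (upTo (n + 1))), x⁆ := by
    intro n m hnm x
    induction m, hnm using Nat.le_induction with
    | base => exact ⟨x, rfl, fun a h h' => rfl⟩
    | succ m hnm ih =>
      obtain ⟨y, h4, h5⟩ := ih
      refine ⟨s m y, (h2 m y).trans h4, fun a h h' => ?_⟩
      rw [← he m a (hgl hnm h) h', h2, h5 a h]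
  have hφ : ∀ a : gl Set.univ, ∃ φ : V →ₗ[ℂ] V, ∀ n (h : a.1 ∈ gl (upTo (n + 1))) x,
      φ (ι n x) = ι n ⁅(⟨a, h⟩ : gl (upTo (n + 1))), x⁆ := by
    intro a
    obtain ⟨N, hN⟩ := exists_mem_gl_upTo a.2
    have hN' : ∀ n, a.1 ∈ gl (upTo (N + n + 1)) := fun n => hgl (N.le_add_right n) hN
    obtain ⟨φ, hφ⟩ := exists_glued_map (A := fun n => A (N + n)) (fun n => ι (N + n))
      (fun n => (ι (N + n)).comp (LieModule.toEnd ℂ (gl (upTo (N + n + 1))) (A (N + n)) ⟨a, hN' n⟩))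
      (fun n => h1 _)
      (fun n x => by
        obtain ⟨y, h4, h5⟩ := hup (N + n).le_succ x
        exact ⟨y, h4, h5 a (hN' n) (hN' (n + 1))⟩)
      (fun v => by
        obtain ⟨n, x, rfl⟩ := h3 v
        obtain ⟨y, h4, -⟩ := hup (Nat.le_add_left n N) x
        exact ⟨n, y, h4⟩)
    refine ⟨φ, fun n h x => ?_⟩
    obtain ⟨y, h4, h5⟩ := hup (Nat.le_add_left n N) x
    rw [← h4, ← h5 a h (hN' n)]
    exact hφ n y
  choose φ hφ using hφ
  have hrep : ∀ (a b : gl Set.univ) (v : V), ∃ n, ∃ _ : a.1 ∈ gl (upTo (n + 1)),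
      ∃ _ : b.1 ∈ gl (upTo (n + 1)), ∃ x, ι n x = v := by
    intro a b v
    obtain ⟨n, x, rfl⟩ := h3 v
    obtain ⟨k, hk⟩ := exists_mem_gl_upTo a.2
    obtain ⟨l, hl⟩ := exists_mem_gl_upTo b.2
    obtain ⟨y, h4, -⟩ := hup (le_max_left n (max k l)) x
    exact ⟨_, hgl ((le_max_left k l).trans (le_max_right n _)) hk,
      hgl ((le_max_right k l).trans (le_max_right n _)) hl, y, h4⟩
  let : LieRingModule (gl Set.univ) V :=
    { bracket := fun a v => φ a v
      add_lie := fun a b v => by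
        obtain ⟨n, ha, hb, x, rfl⟩ := hrep a b v
        rw [hφ a n ha, hφ b n hb, hφ (a + b) n (add_mem ha hb), ← map_add, ← add_lie]
        rfl
      lie_add := fun a v w => map_add _ _ _
      leibniz_lie := fun a b v => by
        obtain ⟨n, ha, hb, x, rfl⟩ := hrep a b v
        change φ a (φ b _) = φ ⁅a, b⁆ _ + φ b (φ a _)
        rw [hφ a n ha, hφ b n hb, hφ b n hb, hφ a n ha,
          hφ ⁅a, b⁆ n ((gl (upTo (n + 1))).lie_mem ha hb), ← map_add, leibniz_lie]
        rfl }
  let : LieModule ℂ (gl Set.univ) V :=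
    { smul_lie := fun c a v => by
        obtain ⟨n, ha, -, x, rfl⟩ := hrep a a v
        change φ (c • a) _ = c • φ a _
        rw [hφ a n ha, hφ (c • a) n (Submodule.smul_mem _ c ha), ← map_smul, ← smul_lie]
        rfl
      lie_smul := fun c a v => map_smul _ _ _ }
  exact ⟨LieMod.of _ V, ι, h1, h2, h3, fun n a h h' x => (hφ ⟨a, h'⟩ n h x).symm⟩

end ParabolicO

namespace ParabolicO

attribute [local instance 100] LieRing.ofAssociativeRing

/-! ### Invariants, weights and polynomiality of the union. -/

/-- `V` is the union of the `A n`, and each `A n` consists of the invariants in the next one. -/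
structure IsUnion (ν : ℂ) {A : ∀ n, LieMod (gl (upTo (n + 1)))} (s : ∀ n, A n →ₗ[ℂ] A (n + 1))
    {V : LieMod (gl Set.univ)} (ι : ∀ n, A n →ₗ[ℂ] V) : Prop where
  isO : ∀ n, IsO ν (upTo (n + 1)) (A n).e
  range : ∀ n y, y ∈ glInv (upTo (n + 1 + 1)) (upTo (n + 1)) (A (n + 1)).e ↔ ∃ x, s n x = y
  inj : ∀ n, Function.Injective (ι n)
  map : ∀ n x, ι (n + 1) (s n x) = ι n x
  ex : ∀ v, ∃ n x, ι n x = v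
  e_map : ∀ n, ∀ i ∈ upTo (n + 1), ∀ j ∈ upTo (n + 1), ∀ x, ι n ((A n).e i j x) = V.e i j (ι n x)

namespace IsUnion

variable {ν : ℂ} {A : ∀ n, LieMod (gl (upTo (n + 1)))} {s : ∀ n, A n →ₗ[ℂ] A (n + 1)}
  {V : LieMod (gl Set.univ)} {ι : ∀ n, A n →ₗ[ℂ] V}

theorem exists_lift (h : IsUnion ν s ι) {n m : ℕ} (hnm : n ≤ m) (x : A n) :
    ∃ y, ι m y = ι n x := by
  induction m, hnm using Nat.le_induction with
  | base => exact ⟨x, rfl⟩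
  | succ m hnm ih =>
    obtain ⟨y, hy⟩ := ih
    exact ⟨s m y, (h.map m y).trans hy⟩

/-- At level `i - 1` the vector is still present, so at level `i` it is an invariant of the new
index `i`. -/
theorem apply_diag (h : IsUnion ν s ι) {n : ℕ} (x : A n) {i : ℕ} (hi : i ∉ upTo (n + 1)) :
    V.e i i (ι n x) = 0 := by
  have hi' : n + 1 ≤ i := not_lt.1 hi
  obtain ⟨k, rfl⟩ := Nat.exists_eq_add_of_le' (Nat.le_of_succ_le hi')
  obtain ⟨k, rfl⟩ : ∃ l, k = l + 1 := ⟨k - 1, by omega⟩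
  obtain ⟨y, hy⟩ := h.exists_lift (Nat.le_add_left n k) x
  have h1 := (h.range (k + n) (s _ y)).2 ⟨y, rfl⟩
  have h2 : k + n + 1 ∈ upTo (k + n + 1 + 1) := Nat.lt_succ_self _
  have h3 := h1 (k + n + 1) ⟨h2, fun hc => lt_irrefl (k + n + 1) hc⟩ (k + n + 1)
    ⟨h2, fun hc => lt_irrefl (k + n + 1) hc⟩
  rw [← hy, ← h.map, show k + 1 + n = k + n + 1 by omega, ← h.e_map _ _ h2 _ h2, h3, map_zero]

theorem isWt_map (h : IsUnion ν s ι) {n : ℕ} {μ : ℕ →₀ ℕ}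
    (hμ : (μ.support : Set ℕ) ⊆ idxU (upTo (n + 1))) {x : A n}
    (hx : IsWt (idxU (upTo (n + 1))) (A n).e μ x) : IsWt (idxU Set.univ) V.e μ (ι n x) := by
  intro i hi
  by_cases hin : i ∈ upTo (n + 1)
  · rw [← h.e_map n i hin i hin, hx i ⟨hin, hi.2⟩, map_smul]
  · rw [h.apply_diag x hin, Finsupp.notMem_support_iff.1 fun hc => hin (hμ hc).1, Nat.cast_zero,
      zero_smul]

theorem isWt_of_map (h : IsUnion ν s ι) {n : ℕ} {μ : ℕ →₀ ℕ} {x : A n}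
    (hx : IsWt (idxU Set.univ) V.e μ (ι n x)) : IsWt (idxU (upTo (n + 1))) (A n).e μ x :=
  fun i hi => h.inj n (by rw [h.e_map n i hi.1 i hi.1, hx i ⟨trivial, hi.2⟩, map_smul])

theorem isWtRep (h : IsUnion ν s ι) : IsWtRep Set.univ (idxU Set.univ) V.e := by
  refine ⟨V.isGlRep, idxU_subset _, eq_top_iff.2 fun v _ => ?_⟩
  obtain ⟨n, x, rfl⟩ := h.ex v
  have h1 : wtSpan (idxU (upTo (n + 1))) (A n).e Set.univ ≤
      (wtSpan (idxU Set.univ) V.e Set.univ).comap (ι n) :=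
    wtSpan_induction fun μ hμ hI x hx =>
      (h.isWt_map hI hx).mem_wtSpan hμ (hI.trans (idxU_mono (Set.subset_univ _)))
  exact h1 ((h.isO n).isWtRep.top ▸ Submodule.mem_top)

theorem mem_glInv_iff (h : IsUnion ν s ι) (n : ℕ) (v : V) :
    v ∈ glInv Set.univ (upTo (n + 1)) V.e ↔ ∃ x, ι n x = v := by
  constructor
  · intro hv
    obtain ⟨m, x, rfl⟩ := h.ex v
    obtain ⟨x', hx⟩ := h.exists_lift (Nat.le_add_left m n) x
    rw [← hx] at hv ⊢
    clear hx x
    generalize m = k at *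
    induction k with
    | zero => exact ⟨x', rfl⟩
    -- An invariant at level `n + k + 1` is in particular invariant under the last index, hence
    -- comes from level `n + k`.
    | succ k ih =>
      obtain ⟨y, rfl⟩ := (h.range (n + k) x').1 fun i hi j hj => h.inj (n + k + 1) (by
        have hnk : upTo (n + 1) ⊆ upTo (n + k + 1) := upTo_mono (by omega)
        rw [h.e_map (n + k + 1) i hi.1 j hj.1, map_zero]
        exact hv i ⟨trivial, fun hc => hi.2 (hnk hc)⟩ j ⟨trivial, fun hc => hj.2 (hnk hc)⟩)
      have h1 := h.map (n + k) y
      change ∃ x, ι n x = ι (n + k + 1) _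
      change ι (n + k + 1) _ ∈ _ at hv
      rw [h1] at hv ⊢
      exact ih y hv
  · rintro ⟨x, rfl⟩
    exact h.isWtRep.mem_glInv_of_diag (sdiff_subset_idxU (zero_mem_upTo n)) fun i hi =>
      h.apply_diag x hi.2

/-- The indices of the basis of `U` for `gl_{n+1}`. -/
theorem coe_Icc_eq (n : ℕ) : ((Finset.Icc 1 n : Finset ℕ) : Set ℕ) = idxU (upTo (n + 1)) := by
  ext i
  simp only [Finset.coe_Icc, Set.mem_Icc, idxU, upTo, Set.mem_sdiff, Set.mem_singleton_iff,
    Set.mem_ofPred_eq]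
  omega

/-- Equivariant maps from tensor powers to `A n` extend, for large `n`. -/
theorem exists_extension (h : IsUnion ν s ι) {n d : ℕ} (hd : d ≤ n)
    {f : (Fin d → idxU (upTo (n + 1))) → A n} (hf : IsTensorMap (idxU (upTo (n + 1))) (A n).e d f) :
    ∃ F : (Fin d → idxU Set.univ) → V, IsTensorMap (idxU Set.univ) V.e d F ∧
      ∀ w, F (Set.inclusion (idxU_mono (Set.subset_univ _)) ∘ w) = ι n (f w) := by
  -- The index set is a variable here, so that it can be replaced by a coerced finite set without
  -- transporting words.
  have key : ∀ {J' : Set ℕ} (J : Finset ℕ) (hJ : (J : Set ℕ) = J') (hJ' : J' ⊆ idxU Set.univ)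
      (_ : d ≤ J.card) {f : (Fin d → J') → V} (_ : IsTensorMap J' V.e d f)
      (_ : ∀ w, f w ∈ glInv (idxU Set.univ) J' V.e),
      ∃ F : (Fin d → idxU Set.univ) → V, IsTensorMap (idxU Set.univ) V.e d F ∧
        ∀ w, F (Set.inclusion hJ' ∘ w) = f w := by
    rintro _ J rfl hJ' hd f hf hr
    exact exists_tensorMap_extension hJ' h.isWtRep.restrict hd hf hr
  refine key (Finset.Icc 1 n) (coe_Icc_eq n) _ (by rw [Nat.card_Icc]; omega) ?_ fun w => ?_
  · intro k l w
    rw [← h.e_map n k k.2.1 l l.2.1, hf k l w, map_sum]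
    refine Finset.sum_congr rfl fun t _ => ?_
    split_ifs
    · rfl
    · exact map_zero _
  · intro i hi j hj
    exact (h.mem_glInv_iff n _).2 ⟨_, rfl⟩ i ⟨trivial, fun hc => hi.2 ⟨hc, hi.1.2⟩⟩ j
      ⟨trivial, fun hc => hj.2 ⟨hc, hj.1.2⟩⟩

/-- A weight vector occurs at some level at least its degree. There it is a combination of values of
tensor maps of that degree, and these maps extend. -/
theorem tensorSpan_eq_top (h : IsUnion ν s ι) : tensorSpan (idxU Set.univ) V.e = ⊤ := by
  rw [eq_top_iff, ← h.isWtRep.top]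
  refine wtSpan_induction fun μ _ hI v hv => ?_
  obtain ⟨n, hn⟩ := h.isWtRep.exists_mem_glInv v
  have hn' := glInv_mono Set.univ (upTo_mono (Nat.succ_le_succ (le_max_left n μ.degree))) hn
  obtain ⟨x, rfl⟩ := (h.mem_glInv_iff _ v).1 hn'
  have hx : x ∈ wtSpan (idxU (upTo (max n μ.degree + 1))) (A _).e {μ' | μ'.degree = μ.degree} := by
    by_cases hx0 : x = 0
    · rw [hx0]; exact Submodule.zero_mem _
    · refine (h.isWt_of_map hv).mem_wtSpan (by exact rfl) fun i hi => ⟨?_, (hI hi).2⟩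
      by_contra hin
      have h1 := h.apply_diag x hin
      rw [hv i (hI hi)] at h1
      rcases smul_eq_zero.1 h1 with h2 | h2
      · exact Finsupp.mem_support_iff.1 hi (Nat.cast_eq_zero.1 h2)
      · exact hx0 (h.inj _ (h2.trans (map_zero _).symm))
  have h1 := mem_span_tensor_of_mem_wtSpan (h.isO _).span hx
  have h2 : ι _ x ∈ (tensorSpan (idxU Set.univ) V.e).comap LinearMap.id := by
    refine (Submodule.span_le (p := (tensorSpan (idxU Set.univ) V.e).comap (ι _))).2 ?_ h1
    rintro _ ⟨d, f, w, hf, hw, rfl⟩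
    have hd : d = μ.degree := (degree_wordWt w).symm.trans hw
    obtain ⟨F, hF, hFw⟩ := h.exists_extension (hd.trans_le (le_max_right _ _)) hf
    exact Submodule.subset_span ⟨d, F, _, hF, (hFw w).symm⟩
  exact h2

theorem apply_zero (h : IsUnion ν s ι) {μ : ℕ →₀ ℕ} (hI : (μ.support : Set ℕ) ⊆ idxU Set.univ)
    {v : V} (hv : IsWt (idxU Set.univ) V.e μ v) : V.e 0 0 v = (ν - μ.degree) • v := by
  obtain ⟨n, hn⟩ := h.isWtRep.exists_mem_glInv v
  have hn' := glInv_mono Set.univ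
    (upTo_mono (Nat.succ_le_succ (le_max_left n (μ.support.sup id)))) hn
  obtain ⟨x, rfl⟩ := (h.mem_glInv_iff _ v).1 hn'
  rw [← h.e_map _ 0 (zero_mem_upTo _) 0 (zero_mem_upTo _),
    (h.isO _).deg_wt (fun i hi => ⟨?_, (hI hi).2⟩) (h.isWt_of_map hv), map_smul]
  exact Nat.lt_succ_of_le ((Finset.le_sup (f := id) hi).trans (le_max_right _ _))

end IsUnion

end ParabolicO

namespace ParabolicO

attribute [local instance 100] LieRing.ofAssociativeRing

/-! ### Finite generation of the union when the lengths stabilize. -/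

section Generation

variable {V : Type*} [AddCommGroup V] [Module ℂ V] {S : Set ℕ} {e : ℕ → ℕ → Module.End ℂ V}

/-- The lowering operators applied to a subspace stable under the other operators give a stable
subspace. -/
theorem isStable_opClosure (h : IsGlRep S e) (h0 : 0 ∈ S) {X : Set V}
    (hX : ∀ k ∈ S, ∀ l ∈ S, (l = 0 → k = 0) → ∀ v ∈ X, e k l v ∈ X) :
    IsStable S e (opClosure {g | ∃ i ∈ idxU S, g = e i 0} X) := by
  set W := opClosure {g | ∃ i ∈ idxU S, g = e i 0} X with hW
  have hlow : ∀ i ∈ S, i ≠ 0 → ∀ v ∈ W, e i 0 v ∈ W := fun i hi hi0 v hv =>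
    opClosure_apply (by exact ⟨i, ⟨hi, hi0⟩, rfl⟩) hv
  let W' : Submodule ℂ V := ⨅ k ∈ S, ⨅ l ∈ S, W.comap (e k l)
  have hW' : ∀ {v}, v ∈ W' ↔ ∀ k ∈ S, ∀ l ∈ S, e k l v ∈ W := by
    intro v
    simp only [W', Submodule.mem_iInf, Submodule.mem_comap]
  have key : W ≤ W' := by
    refine opClosure_le' (fun v hv => hW'.2 fun k hk l hl => ?_) ?_
    · by_cases hkl : l = 0 → k = 0
      · exact subset_opClosure _ _ (hX k hk l hl hkl v hv)
      · push Not at hkl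
        rw [hkl.1]
        exact hlow k hk hkl.2 v (subset_opClosure _ _ hv)
    · rintro _ ⟨i, hi, rfl⟩ v hv hv'
      refine hW'.2 fun k hk l hl => ?_
      have hv'' := hW'.1 hv'
      rw [h k hk l hl i hi.1 0 h0]
      refine Submodule.add_mem _ (hlow i hi.1 hi.2 _ (hv'' k hk l hl)) (Submodule.sub_mem _ ?_ ?_)
      · split_ifs
        · exact hv'' k hk 0 h0
        · exact Submodule.zero_mem _
      · split_ifs
        · exact hv'' i hi.1 l hl
        · exact Submodule.zero_mem _
  exact fun k hk l hl v hv => hW'.1 (key hv) k hk l hl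

theorem IsWtRep.apply_mem_wtSpan_degree_le (h : IsWtRep S (idxU S) e) (m : ℕ) {k l : ℕ}
    (hk : k ∈ S) (hl : l ∈ S) (hkl : l = 0 → k = 0) {v : V}
    (hv : v ∈ wtSpan (idxU S) e {μ | μ.degree ≤ m}) :
    e k l v ∈ wtSpan (idxU S) e {μ | μ.degree ≤ m} := by
  refine h.apply_mem_wtSpan hk hl (fun μ hμ μ' h1 h2 h3 => ?_) hv
  rw [Set.mem_ofPred_eq] at hμ ⊢
  by_cases hl0 : l = 0
  · have hk0 := hkl hl0
    subst hl0 hk0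
    rwa [ext_of_support_subset h2 h1 fun i hi => by
      have := h3 i hi; rwa [if_neg (ne_zero_of_mem_idxU hi)] at this]
  · by_cases hk0 : k = 0
    · subst hk0
      have := degree_of_lower h1 h2 (zero_notMem_idxU S) ⟨hl, hl0⟩ h3
      omega
    · rwa [degree_of_move h1 h2 ⟨hk, hk0⟩ ⟨hl, hl0⟩ h3]

end Generation

namespace IsUnion

variable {ν : ℂ} {A : ∀ n, LieMod (gl (upTo (n + 1)))} {s : ∀ n, A n →ₗ[ℂ] A (n + 1)}
  {V : LieMod (gl Set.univ)} {ι : ∀ n, A n →ₗ[ℂ] V}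

/-- If the length does not grow, `A n` generates the later modules. -/
theorem eq_top_of_length (h : IsUnion ν s ι) {n m l : ℕ} (hnm : n ≤ m)
    (hn : (A n).length = l) (hm : (A m).length = l) {Z : Submodule ℂ (A m)}
    (hZ : IsStable (upTo (m + 1)) (A m).e Z) (hZn : ∀ x y, ι m y = ι n x → y ∈ Z) : Z = ⊤ := by
  have hmem : ∀ x, ι n x ∈ LinearMap.range (ι m) := fun x => by
    obtain ⟨y, hy⟩ := h.exists_lift hnm x
    exact ⟨y, hy⟩
  let j : A n →ₗ[ℂ] A m := (LinearEquiv.ofInjective (ι m) (h.inj m)).symm.toLinearMap.comp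
    ((ι n).codRestrict _ hmem)
  have hj : ∀ x, ι m (j x) = ι n x := fun x => by
    have := LinearEquiv.ofInjective_symm_apply (h := h.inj m) (f := ι m) ⟨ι n x, hmem x⟩
    exact this
  have hup : upTo (n + 1) ⊆ upTo (m + 1) := upTo_mono (Nat.succ_le_succ hnm)
  obtain ⟨g, hg, hg'⟩ := length_le_height (zero_mem_upTo n) hup (h.isO m).isWtRep
    (N := A n) (ι := j)
    (fun x y hxy => h.inj n (by rw [← hj, ← hj, hxy]))
    (fun x i hi k hk => h.inj m (by
      rw [h.e_map m i hi.1 k hk.1, hj, map_zero]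
      exact (h.mem_glInv_iff n _).2 ⟨x, rfl⟩ i ⟨trivial, hi.2⟩ k ⟨trivial, hk.2⟩))
    (fun i hi k hk x => h.inj m (by
      rw [hj, h.e_map n i hi k hk, h.e_map m i (hup hi) k (hup hk), hj]))
  by_contra hne
  have h1 : (g ⊤).1 ≤ Z := by
    rw [hg']
    refine IsWtRep.lower_le hup ?_ hZ
    rintro _ ⟨x, -, rfl⟩
    exact hZn x _ (hj x)
  have h2 : (A m).stableOrderIso (g ⊤) < ⊤ := by
    refine lt_top_iff_ne_top.2 fun h3 => hne (eq_top_iff.2 (le_trans ?_ h1))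
    exact (congrArg LieSubmodule.toSubmodule h3).ge
  -- If `A n` generated a proper submodule of `A m`, the chains of submodules of `A n`, carried into
  -- it, could be lengthened by the whole module, making `A m` longer than `A n`.
  have h4 : Order.height (⊤ : LieSubmodule ℂ (gl (upTo (n + 1))) (A n)) ≤
      Order.height ((A m).stableOrderIso (g ⊤)) :=
    Order.height_le_height_apply_of_strictMono (fun W => (A m).stableOrderIso (g W))
      ((A m).stableOrderIso.strictMono.comp hg) ⊤
  have h5 : Order.height ((A m).stableOrderIso (g ⊤)) ≤ (l : ℕ∞) :=
    (Order.height_mono le_top).trans hm.le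
  have h6 := Order.height_strictMono h2 (h5.trans_lt (ENat.natCast_lt_top l))
  exact absurd (h4.trans_lt h6) (by
    rw [show Order.height (⊤ : LieSubmodule ℂ (gl (upTo (n + 1))) (A n)) = l from hn,
      show Order.height (⊤ : LieSubmodule ℂ (gl (upTo (m + 1))) (A m)) = l from hm]
    exact lt_irrefl _)

/-- Let the lengths be constant from `n` on, and let `m` be a bound for the generators of `A n`.
Lowering the part of `V` of degree at most `m` gives a submodule containing `A n`, hence all later
terms. -/
theorem exists_bound (h : IsUnion ν s ι) {l : ℕ}
    (hl : ∀ᶠ n in Filter.atTop, (A n).length = l) :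
    ∃ m : ℕ, opClosure {g | ∃ i ∈ idxU Set.univ, g = V.e i 0}
      (wtSpan (idxU Set.univ) V.e {μ | μ.degree ≤ m}) = ⊤ := by
  obtain ⟨n, hn⟩ := Filter.eventually_atTop.1 hl
  obtain ⟨m, hm⟩ := (h.isO n).exists_bound
  refine ⟨m, ?_⟩
  set W := opClosure {g | ∃ i ∈ idxU Set.univ, g = V.e i 0}
    (wtSpan (idxU Set.univ) V.e {μ | μ.degree ≤ m})
  have hW : IsStable Set.univ V.e W := isStable_opClosure V.isGlRep (Set.mem_univ 0)
    fun k hk l hl hkl v hv => h.isWtRep.apply_mem_wtSpan_degree_le m hk hl hkl hv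
  have h1 : ∀ x, ι n x ∈ W := by
    have : (⊤ : Submodule ℂ (A n)) ≤ W.comap (ι n) := by
      rw [← hm]
      refine opClosure_le ?_ ?_
      · refine wtSpan_induction (W := W.comap (ι n)) fun μ hμ hI x hx => ?_
        exact subset_opClosure _ _ ((h.isWt_map hI hx).mem_wtSpan hμ
          (hI.trans (idxU_mono (Set.subset_univ _))))
      · rintro _ ⟨i, hi, rfl⟩ x hx
        rw [Submodule.mem_comap, h.e_map n i hi.1 0 (zero_mem_upTo n)]
        exact hW i trivial 0 trivial _ hx
    exact fun x => this Submodule.mem_top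
  rw [eq_top_iff]
  intro v _
  obtain ⟨k, x, rfl⟩ := h.ex v
  obtain ⟨y, hy⟩ := h.exists_lift (le_max_left k n) x
  rw [← hy]
  have h2 := h.eq_top_of_length (le_max_right k n) (hn n le_rfl) (hn _ (le_max_right k n))
    (Z := W.comap (ι (max k n))) (fun i hi j hj x hx => by
      rw [Submodule.mem_comap, h.e_map _ i hi j hj]
      exact hW i trivial j trivial _ hx)
    fun x y hxy => by
      rw [Submodule.mem_comap, hxy]
      exact h1 x
  exact h2.ge (Submodule.mem_top (x := y))

/-- The part of degree at most `m` is spanned by finitely many equivariant maps. -/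
theorem exists_finite_span (h : IsUnion ν s ι) (m : ℕ) :
    ∃ (k : ℕ) (d : Fin k → ℕ) (f : ∀ a, (Fin (d a) → idxU Set.univ) → V),
      (∀ a, IsTensorMap (idxU Set.univ) V.e (d a) (f a)) ∧
        wtSpan (idxU Set.univ) V.e {μ | μ.degree ≤ m} ≤
          Submodule.span ℂ {v | ∃ a w, v = f a w} := by
  let X : Set (A m) := {x | ∃ (d : ℕ) (f : (Fin d → idxU (upTo (m + 1))) → A m)
    (w : Fin d → idxU (upTo (m + 1))), IsTensorMap (idxU (upTo (m + 1))) (A m).e d f ∧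
      wordWt w ∈ {μ : ℕ →₀ ℕ | μ.degree ≤ m} ∧ x = f w}
  have hX : Submodule.span ℂ X = wtSpan (idxU (upTo (m + 1))) (A m).e {μ | μ.degree ≤ m} := by
    refine le_antisymm (Submodule.span_le.2 ?_)
      fun x hx => mem_span_tensor_of_mem_wtSpan (h.isO m).span hx
    rintro _ ⟨d, f, w, hf, hw, rfl⟩
    exact (hf.isWt w).mem_wtSpan hw (support_wordWt_subset w)
  have hfin := (h.isO m).finiteDimensional (zero_mem_upTo m) (Set.finite_lt_nat (m + 1)) m
  -- In rank `m + 1` the part of degree at most `m` is finite-dimensional, so finitely many values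
  -- of tensor maps span it. Their degrees are at most `m`, which is what the extension to all words
  -- requires.
  obtain ⟨B, hBX, hB⟩ := Submodule.fg_span_iff_fg_span_finset_subset X |>.1
    (hX ▸ (Submodule.fg_iff_finiteDimensional _).2 hfin)
  have hB' : ∀ a : Fin B.card, ((B.equivFin.symm a : B) : A m) ∈ X := fun a =>
    hBX (B.equivFin.symm a).2
  choose d f w hf hw hfw using hB'
  have hd : ∀ a, d a ≤ m := fun a => (degree_wordWt (w a)).symm.trans_le (hw a)
  choose F hF hFw using fun a => h.exists_extension (hd a) (hf a)
  refine ⟨B.card, d, F, hF, ?_⟩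
  set Z := Submodule.span ℂ {v | ∃ a w, v = F a w}
  have hZ : IsStable (idxU Set.univ) V.e Z := by
    intro i hi j hj v hv
    induction hv using Submodule.span_induction with
    | mem v hv =>
      obtain ⟨a, w, rfl⟩ := hv
      rw [hF a ⟨i, hi⟩ ⟨j, hj⟩ w]
      refine Submodule.sum_mem _ fun t _ => ?_
      split_ifs
      · exact Submodule.subset_span ⟨a, _, rfl⟩
      · exact Submodule.zero_mem _
    | zero => rw [map_zero]; exact Submodule.zero_mem _
    | add x y _ _ hx hy => rw [map_add]; exact Submodule.add_mem _ hx hy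
    | smul c x _ hx => rw [map_smul]; exact Submodule.smul_mem _ c hx
  have hBZ : wtSpan (idxU (upTo (m + 1))) (A m).e {μ | μ.degree ≤ m} ≤ Z.comap (ι m) := by
    rw [← hX, hB]
    refine Submodule.span_le.2 fun b hb => ?_
    have h1 := hfw (B.equivFin ⟨b, hb⟩)
    rw [Equiv.symm_apply_apply] at h1
    rw [SetLike.mem_coe, Submodule.mem_comap]
    change b = _ at h1
    rw [h1, ← hFw]
    exact Submodule.subset_span ⟨_, _, rfl⟩
  -- A vector of degree at most `m` missing from the stable space `Z` could be moved to the indices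
  -- `1, …, m`, where nothing is missing by `hBZ`.
  by_contra hne
  have hWs : ∀ i ∈ idxU Set.univ, ∀ j ∈ idxU Set.univ,
      ∀ v ∈ wtSpan (idxU Set.univ) V.e {μ | μ.degree ≤ m},
      V.e i j v ∈ wtSpan (idxU Set.univ) V.e {μ | μ.degree ≤ m} := fun i hi j hj v hv =>
    h.isWtRep.apply_mem_wtSpan_degree_le m hi.1 hj.1 (fun hc => absurd hc hj.2) hv
  obtain ⟨μ, h1, h2, v, h3, h4, h5⟩ := exists_wt_of_not_le (fun i hi v hv => hWs i hi i hi v hv)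
    le_rfl hne
  have hT : ((Finset.Icc 1 m : Finset ℕ) : Set ℕ) ⊆ idxU Set.univ := by
    rw [coe_Icc_eq]
    exact idxU_mono (Set.subset_univ _)
  obtain ⟨μ', h6, h7, -, h8, v', h9, h10, h11⟩ := h.isWtRep.exists_moved hT
    (fun i hi j hj v hv => hWs j (hT hj) i hi v hv) (fun i hi j hj v hv => hZ i hi j (hT hj) v hv)
    (J := ∅) (by simp) μ h2 (by
      rw [Finsupp.filter_eq_self_iff _ _ |>.2 fun i _ => Finset.notMem_empty i, Nat.card_Icc]
      exact h1) h5 h3 h4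
  rw [Finset.union_empty] at h6
  have h12 : (μ'.support : Set ℕ) ⊆ idxU (upTo (m + 1)) := coe_Icc_eq m ▸ Finset.coe_subset.2 h6
  have h13 : v' ∈ glInv Set.univ (upTo (m + 1)) V.e := by
    rw [h.isWtRep.glInv_eq (sdiff_subset_idxU (zero_mem_upTo _))]
    exact h11.mem_wtSpan (h12.trans (idxU_subset _)) h7
  obtain ⟨x, rfl⟩ := (h.mem_glInv_iff m v').1 h13
  exact h10 (hBZ ((h.isWt_of_map h11).mem_wtSpan (h8.trans_le h1) h12))

theorem isO_union (h : IsUnion ν s ι) {l : ℕ} (hl : ∀ᶠ n in Filter.atTop, (A n).length = l) :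
    IsO ν Set.univ V.e := by
  refine ⟨V.isGlRep, h.tensorSpan_eq_top, fun d f hf w => ?_, ?_⟩
  · rw [h.apply_zero (support_wordWt_subset w) (hf.isWt w), degree_wordWt]
  · obtain ⟨m, hm⟩ := h.exists_bound hl
    obtain ⟨k, d, f, hf, hspan⟩ := h.exists_finite_span m
    refine ⟨k, d, f, hf, eq_top_iff.2 ?_⟩
    rw [← hm]
    refine opClosure_le (fun v hv => ?_) fun g hg w hw => opClosure_apply hg hw
    exact (Submodule.span_le.2 (subset_opClosure _ _)) (hspan hv)

end IsUnion

end ParabolicO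

namespace ParabolicO

attribute [local instance 100] LieRing.ofAssociativeRing

/-! ### Essential surjectivity -/

/-- Isomorphisms in the inverse limit are compatible sequences of isomorphisms. -/
def InvLim.isoMk {C : ℕ → Type*} [∀ n, Category (C n)] {F : ∀ n, C (n + 1) ⥤ C n} {X Y : InvLim F}
    (i : ∀ n, X.obj n ≅ Y.obj n)
    (h : ∀ n, (F n).map (i (n + 1)).hom ≫ (Y.iso n).hom = (X.iso n).hom ≫ (i n).hom) : X ≅ Y where
  hom := { app := fun n => (i n).hom, comm := h }
  inv :=
    { app := fun n => (i n).inv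
      comm := fun n => by
        rw [Iso.eq_comp_inv, Category.assoc, ← h, ← Category.assoc, ← Functor.map_comp,
          Iso.inv_hom_id, CategoryTheory.Functor.map_id, Category.id_comp] }
  hom_inv_id := InvLim.Hom.ext (funext fun n => (i n).hom_inv_id)
  inv_hom_id := InvLim.Hom.ext (funext fun n => (i n).inv_hom_id)

/-- Bijective homomorphisms are isomorphisms. -/
noncomputable def LieMod.isoOfBijective {L : Type} [LieRing L] [LieAlgebra ℂ L] {M N : LieMod L}
    (φ : M →ₗ⁅ℂ,L⁆ N) (hφ : Function.Bijective φ) : M ≅ N :=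
  @asIso _ _ M N φ (LieMod.isIso_of_bijective _ hφ)

section Comparison

variable {L L' L'' : Type} [LieRing L] [LieAlgebra ℂ L] [LieRing L'] [LieAlgebra ℂ L']
  [LieRing L''] [LieAlgebra ℂ L''] {f : L'' →ₗ⁅ℂ⁆ L} {g : L' →ₗ⁅ℂ⁆ L} {e : L'' →ₗ⁅ℂ⁆ L'}

theorem invariants_map_eq {hfg : ∀ x, f x = g (e x)} {K₁ K₂ : Set L} {K₃ : Set L'}
    {hK₁ : ∀ a ∈ K₁, ∀ x, ⁅a, f x⁆ = 0} {hK₂ : ∀ a ∈ K₂, ∀ x, ⁅a, g x⁆ = 0}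
    {hK₃ : ∀ a ∈ K₃, ∀ x, ⁅a, e x⁆ = 0} {h₂ : K₂ ⊆ K₁} {h₃ : ∀ a ∈ K₃, g a ∈ K₁} {M : LieMod L}
    {A : LieMod L''} {B : LieMod L'} (p : (invariants e K₃ hK₃).obj B →ₗ⁅ℂ,L''⁆ A)
    (φ₁ : A →ₗ⁅ℂ,L''⁆ (invariants f K₁ hK₁).obj M) (φ₂ : B →ₗ⁅ℂ,L'⁆ (invariants g K₂ hK₂).obj M)
    (h : ∀ z, invariantsIncl g K₂ hK₂ M (φ₂ (invariantsIncl e K₃ hK₃ B z)) =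
      invariantsIncl f K₁ hK₁ M (φ₁ (p z))) :
    (invariants e K₃ hK₃).map φ₂ = CategoryStruct.comp (X := (invariants e K₃ hK₃).obj B)
      (Y := (invariants f K₁ hK₁).obj M) (φ₁.comp p)
        ((invariantsComparison hfg hK₁ hK₂ hK₃ h₂ h₃).app M) := by
  refine LieModuleHom.ext fun z => invariantsIncl_injective e K₃ hK₃ _
    (invariantsIncl_injective g K₂ hK₂ M ?_)
  exact (h z).trans (invariantsIncl_comparison hfg hK₁ hK₂ hK₃ h₂ h₃ M _).symm

end Comparison

/-- The two injections `ι` and `invIncl` have the same image, so one can be inverted along the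
other. -/
theorem exists_hom_invFunctor {T S : Set ℕ} (hT : T ⊆ S) {M : LieMod (gl S)} {N : LieMod (gl T)}
    {ι : N →ₗ[ℂ] M} (hι : Function.Injective ι) (hr : ∀ v, v ∈ glInv S T M.e ↔ ∃ x, ι x = v)
    (he : ∀ i ∈ T, ∀ j ∈ T, ∀ x, ι (N.e i j x) = M.e i j (ι x)) :
    ∃ φ : N →ₗ⁅ℂ,gl T⁆ (invFunctor hT).obj M, Function.Bijective φ ∧
      ∀ x, invIncl hT M (φ x) = ι x := by
  have hmem : ∀ x, ι x ∈ LinearMap.range (invIncl hT M) := fun x =>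
    (mem_glInv_iff hT M _).1 ((hr _).2 ⟨x, rfl⟩)
  let j : N →ₗ[ℂ] (invFunctor hT).obj M :=
    (LinearEquiv.ofInjective _ (invIncl_injective hT M)).symm.toLinearMap.comp
      (ι.codRestrict _ hmem)
  have hj : ∀ x, invIncl hT M (j x) = ι x := fun x => by
    have := LinearEquiv.ofInjective_symm_apply (h := invIncl_injective hT M) (f := invIncl hT M)
      ⟨ι x, hmem x⟩
    exact this
  refine ⟨LieMod.homOfE j fun i hi k hk x => invIncl_injective hT M ?_, ⟨fun x y hxy => hι ?_,
    fun y => ?_⟩, hj⟩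
  · rw [hj, he i hi k hk, invIncl_e hT M hi hk, hj]
  · rw [← hj x, ← hj y]
    exact congrArg (invIncl hT M) hxy
  · obtain ⟨x, hx⟩ := (hr _).1 ((mem_glInv_iff hT M _).2 ⟨y, rfl⟩)
    exact ⟨x, invIncl_injective hT M ((hj x).trans hx)⟩

section Coherent

variable {ν : ℂ} {hR : ResPreserves ν}

/-- The inclusions between the members of a coherent sequence. -/
noncomputable def stepMap (X : InvLim (resO hR)) (n : ℕ) :
    (X.obj n).obj →ₗ[ℂ] (X.obj (n + 1)).obj :=
  (invIncl (upTo_mono (n + 1).le_succ) (X.obj (n + 1)).obj).comp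
    (show (X.obj n).obj →ₗ⁅ℂ,gl (upTo (n + 1))⁆ (resMod (n + 1)).obj (X.obj (n + 1)).obj from
      (X.iso n).inv.hom).toLinearMap

/-- The structure isomorphisms of a coherent sequence, as equivariant maps. -/
noncomputable def stepInv (X : InvLim (resO hR)) (n : ℕ) :
    (resMod (n + 1)).obj (X.obj (n + 1)).obj →ₗ⁅ℂ,gl (upTo (n + 1))⁆ (X.obj n).obj :=
  (X.iso n).hom.hom

theorem stepMap_stepInv (X : InvLim (resO hR)) (n : ℕ)
    (z : (resMod (n + 1)).obj (X.obj (n + 1)).obj) :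
    stepMap X n (stepInv X n z) =
      invIncl (upTo_mono (n + 1).le_succ) (X.obj (n + 1)).obj z := by
  have h1 := congrArg (fun k : (resO hR n).obj (X.obj (n + 1)) ⟶ (resO hR n).obj (X.obj (n + 1)) =>
    (show (resMod (n + 1)).obj (X.obj (n + 1)).obj →ₗ⁅ℂ,gl (upTo (n + 1))⁆
      (resMod (n + 1)).obj (X.obj (n + 1)).obj from k.hom) z) (X.iso n).hom_inv_id
  exact congrArg (invIncl (upTo_mono (n + 1).le_succ) (X.obj (n + 1)).obj) h1

theorem stepMap_injective (X : InvLim (resO hR)) (n : ℕ) : Function.Injective (stepMap X n) := by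
  have h1 := fun z => congrArg (fun k : X.obj n ⟶ X.obj n =>
    (show (X.obj n).obj →ₗ⁅ℂ,gl (upTo (n + 1))⁆ (X.obj n).obj from k.hom) z) (X.iso n).inv_hom_id
  intro x y hxy
  have h2 := invIncl_injective _ _ hxy
  exact (h1 x).symm.trans ((congrArg (stepInv X n) h2).trans (h1 y))

theorem mem_glInv_iff_stepMap (X : InvLim (resO hR)) (n : ℕ) (y : (X.obj (n + 1)).obj) :
    y ∈ glInv (upTo (n + 1 + 1)) (upTo (n + 1)) (X.obj (n + 1)).obj.e ↔
      ∃ x, stepMap X n x = y := by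
  rw [mem_glInv_iff (upTo_mono (n + 1).le_succ)]
  exact ⟨fun ⟨z, hz⟩ => ⟨stepInv X n z, (stepMap_stepInv X n z).trans hz⟩, fun ⟨x, hx⟩ => ⟨_, hx⟩⟩

theorem stepMap_lie (X : InvLim (resO hR)) (n : ℕ) (a : Module.End ℂ CInf)
    (h : a ∈ gl (upTo (n + 1))) (h' : a ∈ gl (upTo (n + 1 + 1))) (x : (X.obj n).obj) :
    stepMap X n ⁅(⟨a, h⟩ : gl (upTo (n + 1))), x⁆ =
      ⁅(⟨a, h'⟩ : gl (upTo (n + 1 + 1))), stepMap X n x⁆ := by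
  have h1 := (show (X.obj n).obj →ₗ⁅ℂ,gl (upTo (n + 1))⁆ (resMod (n + 1)).obj (X.obj (n + 1)).obj
    from (X.iso n).inv.hom).map_lie ⟨a, h⟩ x
  exact (congrArg (invIncl (upTo_mono (n + 1).le_succ) (X.obj (n + 1)).obj) h1).trans
    (invariantsIncl_lie _ _ _ _ _ _)

theorem exists_isUnion (X : InvLim (resO hR)) :
    ∃ (V : LieMod (gl Set.univ)) (ι : ∀ n, (X.obj n).obj →ₗ[ℂ] V), IsUnion ν (stepMap X) ι := by
  obtain ⟨V, ι, h1, h2, h3, h4⟩ := exists_union (stepMap X) (stepMap_injective X) (stepMap_lie X)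
  refine ⟨V, ι, fun n => (catO_iff _ (zero_mem_upTo n)).1 (X.obj n).property,
    mem_glInv_iff_stepMap X, h1, h2, h3, fun n i hi j hj x => ?_⟩
  have h5 : glE (upTo (n + 1)) i j = ⟨E i j, E_mem hi hj⟩ := glE_of_mem hi hj
  rw [LieMod.e_apply, h5, h4 n _ _ (E_mem trivial trivial)]
  exact V.e_of_coe trivial trivial rfl _

/-- A compatible sequence of isomorphisms onto the invariants of a `gl_∞`-module. -/
noncomputable def isoGammaLim (hG : GammaPreserves ν) (hC : GammaCompatible ν)
    (X : InvLim (resO hR)) (M : OInf ν)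
    (φ : ∀ n, (X.obj n).obj →ₗ⁅ℂ,gl (upTo (n + 1))⁆ (gammaMod (n + 1)).obj M.obj)
    (hb : ∀ n, Function.Bijective (φ n))
    (h : ∀ n, (resMod (n + 1)).map (X := (X.obj (n + 1)).obj)
      (Y := (gammaMod (n + 1 + 1)).obj M.obj) (φ (n + 1)) =
      CategoryStruct.comp (X := (resMod (n + 1)).obj (X.obj (n + 1)).obj)
        (Y := (gammaMod (n + 1)).obj M.obj)
        (Z := (gammaMod (n + 1 + 1) ⋙ resMod (n + 1)).obj M.obj)
        ((φ n).comp (stepInv X n)) ((gammaComparison (n + 1)).app M.obj)) :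
    X ≅ (gammaLim hR hG hC).obj M :=
  InvLim.isoMk (Y := (gammaLim hR hG hC).obj M)
    (fun n => ObjectProperty.isoMk _ (LieMod.isoOfBijective (φ n) (hb n))) fun n => by
      have := hC n M.obj M.property
      have h1 := (IsIso.comp_inv_eq ((gammaComparison (n + 1)).app M.obj)).2 (h n)
      refine ObjectProperty.hom_ext _ ?_
      exact h1

/-- The preimage is the union of the sequence. Stabilization of the lengths is needed only to see
that the union is finitely generated. -/
theorem exists_iso_gammaLim (hG : GammaPreserves ν) (hC : GammaCompatible ν) (X : InvLim (resO hR))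
    (hX : restrictedLim hR X) : ∃ M : OInf ν, Nonempty ((gammaLim hR hG hC).obj M ≅ X) := by
  obtain ⟨V, ι, h⟩ := exists_isUnion X
  obtain ⟨l, hl⟩ := hX
  have hV : catO ν Set.univ V := (catO_iff V (Set.mem_univ 0)).2 (h.isO_union hl)
  have hφ := fun n => exists_hom_invFunctor (Set.subset_univ (upTo (n + 1))) (h.inj n)
    (h.mem_glInv_iff n) (h.e_map n)
  choose φ hb hφ using hφ
  refine ⟨⟨V, hV⟩, ⟨(isoGammaLim hG hC X ⟨V, hV⟩ φ hb fun n => ?_).symm⟩⟩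
  -- Both sides are the same vector of `V`: passing to the next level does not move vectors in the
  -- union.
  have h1 : ∀ z, invIncl (Set.subset_univ _) V (φ (n + 1)
      (invIncl (upTo_mono (n + 1).le_succ) (X.obj (n + 1)).obj z)) =
      invIncl (Set.subset_univ _) V (φ n (stepInv X n z)) := fun z => by
    refine (hφ (n + 1) _).trans (Eq.trans ?_ (hφ n _).symm)
    exact (congrArg (ι (n + 1)) (stepMap_stepInv X n z).symm).trans (h.map n _)
  exact invariants_map_eq (stepInv X n) (φ n) (φ (n + 1)) h1

theorem essSurj_gammaRestr (hG : GammaPreserves ν) (hC : GammaCompatible ν)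
    (hS : ∀ M, restrictedLim hR ((gammaLim hR hG hC).obj M)) : (gammaRestr hR hG hC hS).EssSurj :=
  ⟨fun X => by
    obtain ⟨M, ⟨i⟩⟩ := exists_iso_gammaLim hG hC X.obj X.property
    exact ⟨M, ⟨ObjectProperty.isoMk _ i⟩⟩⟩

end Coherent

end ParabolicO

theorem mainTheorem3 (ν : ℂ) :
    ∃ (hR : ParabolicO.ResPreserves ν) (hG : ParabolicO.GammaPreserves ν)
      (hC : ParabolicO.GammaCompatible ν)
      (hS : ∀ M : ParabolicO.OInf ν,
        ParabolicO.restrictedLim hR ((ParabolicO.gammaLim hR hG hC).obj M)),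
      (ParabolicO.gammaRestr hR hG hC hS).IsEquivalence := by
  have hR := ParabolicO.resPreserves ν
  have hG := ParabolicO.gammaPreserves ν
  have hC := ParabolicO.gammaCompatible ν
  have hS := ParabolicO.restrictedLim_gammaLim hR hG hC
  refine ⟨hR, hG, hC, hS, ?_⟩
  have := ParabolicO.faithful_gammaLim (hR := hR) (hG := hG) (hC := hC)
  have := ParabolicO.full_gammaLim (hR := hR) (hG := hG) (hC := hC)
  have := ParabolicO.essSurj_gammaRestr hG hC hS
  have : (ParabolicO.gammaRestr hR hG hC hS).Faithful :=
    inferInstanceAs (ObjectProperty.lift _ (ParabolicO.gammaLim hR hG hC) hS).Faithful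
  have : (ParabolicO.gammaRestr hR hG hC hS).Full :=
    inferInstanceAs (ObjectProperty.lift _ (ParabolicO.gammaLim hR hG hC) hS).Full
  exact { }
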